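/- **Locality of fermionic thermal states.** Let $V$ be a finite set of sites with fermionic operators $f_x, f_x^\dagger$ ($x\in V$) acting on the fermionic Fock space over $V$ and satisfying $\{f_x,f_y^\dagger\}=\delta_{x,y}\mathbb 1$, $\{f_x,f_y\}=0$. For $X\subseteq V$ let $\mathcal G_X$ be the algebra of even operators supported on $X$, i.e. the linear combinations of products of an even number of operators $f_x,f_x^\dagger$ with $x\in X$. Let $E$ be a finite set of (hyper)edges $\lambda\subseteq V$, and let $H=\sum_{\lambda\in E}h_\lambda$ with self-adjoint local terms $h_\lambda\in\mathcal G_\lambda$. Write $J=\max_{\lambda\in E}\|h_\lambda\|_\infty$ for the local interaction strength, and $g[H'](\beta)=e^{-\beta H'}/\operatorname{Tr}e^{-\beta H'}$ for the thermal state of a Hamiltonian $H'$. Here $\|\cdot\|_\infty$ is the operator norm and $\|\cdot\|_1$ the trace norm. Two sets of vertices *overlap* if they intersect. A set $F\subseteq E$ *connects* $X,Y\subseteq V$ if it contains a sequence of edges, each overlapping the next one, whose first edge overlaps $X$ and whose last edge overlaps $Y$; $F$ is *connected* if it connects $\lambda$ and $\lambda'$ for all $\lambda,\lambda'\in F$.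 Let $a_m=\max_{\lambda\in E}|\{F\subseteq E\text{ connected}:\lambda\in F,\ |F|=m\}|$, and let the growth constant $\alpha$ be the smallest $\alpha\ge 0$ with $a_m\le\alpha^m$ for all $m$. Put $$\beta^*=\frac{1}{2J}\ln\frac{1+\sqrt{1+4/\alpha}}{2},\qquad \xi(\beta)=\bigl|\ln\bigl[\alpha e^{2|\beta|J}(e^{2|\beta|J}-1)\bigr]\bigr|^{-1},\qquad L_0(\beta,a)=\xi(\beta)\,\Bigl|\ln\frac{\ln(3)\,(1-e^{-1/\xi(\beta)})}{a}\Bigr|,$$ with $\beta^*=\infty$ if $J=0$ or $\alpha=0$. For $X\subseteq V$ let $\partial X\subseteq E$ be the set of edges that overlap both $X$ and $V\setminus X$. For $F\subseteq E$ let $\operatorname{dist}(X,F)$ be $0$ if an edge of $F$ overlaps $X$, and otherwise the size of a smallest $G\subseteq E$ that connects $X$ to an edge of $F$ ($\infty$ if there is none, with $e^{-\infty}=0$). Let $|\beta|<\beta^*$ and let $S\subseteq B\subseteq V$ satisfy $\operatorname{dist}(S,\partial B)\ge L_0(\beta,|\partial S|)$. Let $H_B=\sum_{\lambda\in E,\ \lambda\subseteq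 B}h_\lambda$ be the truncated Hamiltonian, and let $g^S[H'](\beta)$ denote the reduction (fermionic partial trace over $V\setminus S$) of $g[H'](\beta)$ to $S$. Then, with $v=4\,|\partial S|\,|\partial B|/\ln 3$, $$\bigl\|g^S[H](\beta)-g^S[H_B](\beta)\bigr\|_1\le\frac{v\,|\beta|\,J}{1-e^{-1/\xi(\beta)}}\,e^{-\operatorname{dist}(S,\partial B)/\xi(\beta)} .$$ If $\beta J=0$ or $\alpha=0$ (so that $\xi(\beta)=0$), or if $|\partial S|=0$, there is no requirement on the distance and the right-hand side is read as $0$. -/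

import Mathlib

open scoped Matrix.Norms.L2Operator NNReal ENNReal

noncomputable section

namespace FermionLattice

/-! ## Hypergraphs: animals, growth constant, boundaries, distances -/

section Hypergraph

variable {V : Type*} [DecidableEq V]

/-- The edge set `F` contains a sequence of edges, consecutive ones overlapping, whose first edge
overlaps the vertex set `X` and whose last edge overlaps the vertex set `Y`. -/
def Connects (F : Finset (Finset V)) (X Y : Finset V) : Prop :=
  ∃ l ∈ F, ∃ k ∈ F, (l ∩ X).Nonempty ∧ (k ∩ Y).Nonempty ∧
    Relation.ReflTransGen (fun a b => a ∈ F ∧ b ∈ F ∧ (a ∩ b).Nonempty) l k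

/-- `F` is connected (an edge animal): it connects all pairs of its elements. -/
def IsAnimal (F : Finset (Finset V)) : Prop :=
  ∀ l ∈ F, ∀ k ∈ F, Connects F l k

open Classical in
/-- `a_m`: the largest number, over `l ∈ E`, of connected `F ⊆ E` with `l ∈ F` and `|F| = m`. -/
def animalNumber (E : Finset (Finset V)) (m : ℕ) : ℕ :=
  E.sup fun l => (E.powerset.filter fun F => IsAnimal F ∧ l ∈ F ∧ F.card = m).card

/-- The growth constant: the smallest `α ≥ 0` with `a_m ≤ α ^ m` for all `m`. -/
def growthConst (E : Finset (Finset V)) : ℝ :=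
  sInf {c : ℝ | 0 ≤ c ∧ ∀ m : ℕ, (animalNumber E m : ℝ) ≤ c ^ m}

/-- The boundary edges of `X`: the edges that meet both `X` and its complement. -/
def boundary (E : Finset (Finset V)) (X : Finset V) : Finset (Finset V) :=
  E.filter fun l => (l ∩ X).Nonempty ∧ (l \ X).Nonempty

/-- The restricted edge set `E(B)`: the edges contained in `B`. -/
def edgesIn (E : Finset (Finset V)) (B : Finset V) : Finset (Finset V) :=
  E.filter fun l => l ⊆ B

open Classical in
/-- The distance of a vertex set `X` and an edge set `F`: it is `0` if some edge of `F` meets `X`,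
and otherwise the size of a smallest `G ⊆ E` that connects `X` to some edge of `F`
(`⊤` if there is no such `G`). -/
def edgeDist (E : Finset (Finset V)) (X : Finset V) (F : Finset (Finset V)) : ℕ∞ :=
  if ∃ l ∈ F, (l ∩ X).Nonempty then 0
  else ⨅ G : {G : Finset (Finset V) // G ⊆ E ∧ ∃ l ∈ F, Connects G X l}, (G.1.card : ℕ∞)

end Hypergraph

/-! ## The constants -/

/-- The critical inverse temperature
`β* = ln [(1 + √(1 + 4 / α)) / 2] / (2 J)`; it is infinite if `J = 0` or `α = 0`. -/
def critBeta (α J : ℝ) : EReal :=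
  if J = 0 ∨ α = 0 then ⊤
  else ((Real.log ((1 + √(1 + 4 / α)) / 2) / (2 * J) : ℝ) : EReal)

/-- The thermal correlation length `ξ(β) = |ln [α e^{2|β|J} (e^{2|β|J} - 1)]|⁻¹`. -/
def corrLength (α J β : ℝ) : ℝ :=
  |Real.log (α * Real.exp (2 * |β| * J) * (Real.exp (2 * |β| * J) - 1))|⁻¹

/-- The minimal distance `L₀(β, a) = ξ(β) |ln (ln 3 (1 - e^{-1/ξ(β)}) / a)|`. -/
def minDist (α J β a : ℝ) : ℝ :=
  corrLength α J β *
    |Real.log (Real.log 3 * (1 - Real.exp (-1 / corrLength α J β)) / a)|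

/-- `e^{-d/ξ}`, which is `0` for `d = ⊤`. -/
def expDecay (d : ℕ∞) (ξ : ℝ) : ℝ :=
  if d = ⊤ then 0 else Real.exp (-(d.toNat : ℝ) / ξ)

/-! ## Fermionic operators -/

section Fermions

variable {V : Type*} [Fintype V] [LinearOrder V]

/-- Operators on the fermionic Fock space with one mode per site of `V`, as matrices in the
orthonormal occupation number basis `|T⟩ = f†_{x₁} ⋯ f†_{x_k} |vac⟩`, `T = {x₁ < ⋯ < x_k} ⊆ V`.
The norm on operators is the operator norm. -/
abbrev Op (V : Type*) := Matrix (Finset V) (Finset V) ℂ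

/-- The annihilation operator `f_x`:
`f_x |T⟩ = (-1)^{#{y ∈ T : y < x}} |T \ {x}⟩` if `x ∈ T`, and `f_x |T⟩ = 0` otherwise. -/
def annih (x : V) : Op V :=
  Matrix.of fun T' T =>
    if x ∈ T ∧ T' = T.erase x then (-1 : ℂ) ^ (T.filter (· < x)).card else 0

/-- The fermionic operators: `f†_x` for `(x, true)` and `f_x` for `(x, false)`. -/
def gen (p : V × Bool) : Op V :=
  if p.2 then (annih p.1).conjTranspose else annih p.1

/-- The algebra of the even operators supported on `X`: the linear combinations of products of an
even number of fermionic operators of sites in `X`. -/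
def evenOps (X : Finset V) : Submodule ℂ (Op V) :=
  Submodule.span ℂ
    {M | ∃ w : List (V × Bool), Even w.length ∧ (∀ p ∈ w, p.1 ∈ X) ∧ M = (w.map gen).prod}

/-- The Hamiltonian `H_F = ∑_{l ∈ F} h_l`. -/
def hamiltonian (h : Finset V → Op V) (F : Finset (Finset V)) : Op V := ∑ l ∈ F, h l

/-- The thermal state `e^{-β H} / Tr e^{-β H}`. -/
def thermalState (H : Op V) (β : ℝ) : Op V :=
  (Matrix.trace (NormedSpace.exp (-(β : ℂ) • H)))⁻¹ • NormedSpace.exp (-(β : ℂ) • H)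

/-- The local interaction strength `J = max_{l ∈ E} ‖h_l‖` (which is `0` if `E` is empty). -/
def strength (h : Finset V → Op V) (E : Finset (Finset V)) : ℝ :=
  ((E.sup fun l => ‖h l‖₊ : ℝ≥0) : ℝ)

/-- The sign in `f†_T f†_R |vac⟩ = ± |T ∪ R⟩` for disjoint `T` and `R`, where `f†_T` is the product
of the `f†_x`, `x ∈ T`, in increasing order. -/
def mergeSign (T R : Finset V) : ℂ :=
  (-1) ^ ((T ×ˢ R).filter fun p => p.2 < p.1).card

/-- The reduction `ρ^S = Tr_{Sᶜ} ρ`, an operator on the Fock space over `S`: the partial trace over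
the second factor for the identification of the Fock space over `V` with the tensor product of those
over `S` and over `Sᶜ`, which sends `f†_T f†_R |vac⟩` to `|T⟩ ⊗ |R⟩` for `T ⊆ S` and `R ⊆ Sᶜ`. -/
def reduce (S : Finset V) (ρ : Op V) : Op S :=
  Matrix.of fun T T' =>
    let t := T.map (Function.Embedding.subtype _)
    let t' := T'.map (Function.Embedding.subtype _)
    ∑ R ∈ Sᶜ.powerset, mergeSign t R * mergeSign t' R * ρ (t ∪ R) (t' ∪ R)

end Fermions

/-- The trace norm (Schatten 1-norm): the sum of the singular values. -/
def traceNorm {n : Type*} [Fintype n] [DecidableEq n] (M : Matrix n n ℂ) : ℝ :=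
  ∑ i, √((Matrix.isHermitian_conjTranspose_mul_self M).eigenvalues i)

end FermionLattice

end

open FermionLattice

/-!
The trace norm of the difference of the two reduced states is the difference of the expectations
of a local even contraction `A` in the two thermal states (`exists_commute_traceNorm_eq`,
`extend_mem_siteCommutant`). The interaction terms are given real couplings `t_l ∈ [0, 1]`, and the
expectation is the ratio `R = F / Z` of `F t = Tr (A e^{H_t})` and the partition function
`Z t = Tr e^{H_t}`. Switching off the boundary edges of `B` turns the first state into the second,
since the edges outside `B` then factor out. So it is enough to bound the response `∂_f R` for a
boundary edge `f` of `B`. If `f` meets `S`, the distance is zero and a trivial bound is enough.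
Otherwise this derivative vanishes once the boundary edges of `S` are switched off, hence a bound
for the mixed derivatives `∂_e ∂_f R`, with `e` a boundary edge of `S`, suffices.

Two properties of `F` and `Z` enter. The first is analytic: every iterated derivative in `k`
couplings is at most `b ^ k Z`, where `b = |β| J` (`norm_pdl_expectFn_le`). It follows from Leibniz'
rule for `e^{H_t} = (e^{H_t / N}) ^ N` with `N → ∞` and from Hölder's inequality for the trace
(`norm_trace_ofFn_mul_exp_le`), which is a consequence of the three lines theorem. The second is
algebraic: if all edges that overlap a set `K` of edges away from `S` are switched off, then `F`
and `Z` factorize, because even operators with disjoint supports commute and the trace of a product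
of operators on complementary sites factorizes (`factorizes_expectFn`, `trace_mul_mul_card`).

The decay follows from these two alone (`norm_iterated_pd_sub_le`). If `K` is decoupled, the
derivatives of `F` in `K` are those of `Z` times a ratio that does not see `K`. In general the edges
adjacent to `K` are switched off continuously by a factor `u`. The derivative in `u` is a sum over
adjacent edges `e`, and for each of them the statement for `K ∪ {e}` and for `{e}` applies, with one
step less of distance. Weights `e^{2 b t_l} - 1` for the edges reproduce themselves under this
recursion (`clusterSum_step`): integrating in `u` yields the generating function of all sets of
edges which are attached to `K` and have at least as many elements as the distance allows steps.
Sets attached to a single edge are, together with that edge, connected, so their number is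
controlled by the growth constant, and the generating function becomes a geometric series in
`α e^{2b} (e^{2b} - 1) = e^{-1/ξ}` (`two_mul_clusterSum_le`). The mixed derivative is the derivative
of a ratio `Ξ / Z` of the same type, where `Ξ` is a truncated function that factorizes away from
both `S` and `e` (`norm_pd_pd_ratio_le`).
-/

noncomputable section

namespace FermionLattice

/-! ### Generating functions of attached sets -/

section Clusters

set_option linter.unusedSectionVars false

open Classical Finset

variable {ι : Type*} [Fintype ι] (adj : ι → ι → Prop)

/-- The outer neighbourhood of `K` in the graph `adj`. -/
def nbhd (K : Finset ι) : Finset ι := univ.filter fun f => f ∉ K ∧ ∃ k ∈ K, adj k f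

/-- `C` is disjoint from `K`, and each of its elements is reached from `K` by a path which runs in
`C` after its start. -/
def Attached (K C : Finset ι) : Prop :=
  Disjoint C K ∧ ∀ c ∈ C, ∃ k ∈ K, Relation.ReflTransGen (fun a b => adj a b ∧ b ∈ C) k c

/-- The generating function of the sets of at least `r` elements that are attached to `K`. -/
def clusterSum (r : ℕ) (K : Finset ι) (w : ι → ℝ) : ℝ :=
  ∑ C ∈ univ.filter (fun C => Attached adj K C ∧ r ≤ C.card), ∏ f ∈ C, w f

variable {adj}

lemma mem_nbhd {K : Finset ι} {f : ι} : f ∈ nbhd adj K ↔ f ∉ K ∧ ∃ k ∈ K, adj k f := by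
  simp [nbhd]

lemma attached_empty (K : Finset ι) : Attached adj K ∅ := ⟨by simp, by simp⟩

lemma clusterSum_nonneg {r : ℕ} {K : Finset ι} {w : ι → ℝ} (hw : 0 ≤ w) :
    0 ≤ clusterSum adj r K w :=
  sum_nonneg fun _ _ => prod_nonneg fun f _ => hw f

lemma one_le_clusterSum_zero {K : Finset ι} {w : ι → ℝ} (hw : 0 ≤ w) :
    1 ≤ clusterSum adj 0 K w := by
  have h : (∅ : Finset ι) ∈ univ.filter (fun C => Attached adj K C ∧ 0 ≤ C.card) := by
    simp [attached_empty]
  have h1 := single_le_sum (f := fun C => ∏ f ∈ C, w f)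
    (fun C _ => prod_nonneg fun f _ => hw f) h
  rwa [prod_empty] at h1

/-- If `C` is attached to `K ∪ {e}` and `M` consists of neighbours of `K`, then adding `e` and `M`
to `C` gives a set that is attached to `K`. -/
lemma attached_insert_union {K C M : Finset ι} {e : ι} (he : e ∈ nbhd adj K)
    (hC : Disjoint C K) (hM : M ⊆ nbhd adj K)
    (h : ∀ c ∈ C, ∃ k ∈ insert e K, Relation.ReflTransGen (fun a b => adj a b ∧ b ∈ C) k c) :
    Attached adj K (insert e (C ∪ M)) := by
  have step : ∀ f ∈ nbhd adj K, f ∈ insert e (C ∪ M) → ∃ k ∈ K,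
      Relation.ReflTransGen (fun a b => adj a b ∧ b ∈ insert e (C ∪ M)) k f := by
    intro f hf hf'
    obtain ⟨_, k, hk, hkf⟩ := mem_nbhd.1 hf
    exact ⟨k, hk, Relation.ReflTransGen.single ⟨hkf, hf'⟩⟩
  refine ⟨?_, ?_⟩
  · rw [disjoint_insert_left, disjoint_union_left]
    refine ⟨(mem_nbhd.1 he).1, hC, ?_⟩
    rw [Finset.disjoint_left]
    exact fun a ha => (mem_nbhd.1 (hM ha)).1
  · intro c hc
    rcases mem_insert.1 hc with rfl | hc'
    · exact step _ he hc
    rcases mem_union.1 hc' with hc'' | hc''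
    · obtain ⟨k, hk, hkc⟩ := h c hc''
      have hkc' : Relation.ReflTransGen (fun a b => adj a b ∧ b ∈ insert e (C ∪ M)) k c :=
        Relation.ReflTransGen.mono
          (fun a b hab => ⟨hab.1, mem_insert_of_mem (mem_union_left _ hab.2)⟩) _ _ hkc
      rcases mem_insert.1 hk with rfl | hk
      · obtain ⟨k', hk', hk'k⟩ := step _ he (mem_insert_self _ _)
        exact ⟨k', hk', hk'k.trans hkc'⟩
      · exact ⟨k, hk, hkc'⟩
    · exact step _ (hM hc'') hc

lemma Attached.inter_nbhd_nonempty {K C : Finset ι} (h : Attached adj K C) (hC : C.Nonempty) :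
    (C ∩ nbhd adj K).Nonempty := by
  obtain ⟨c, hc⟩ := hC
  obtain ⟨k, hk, hkc⟩ := h.2 c hc
  rcases hkc.cases_head with rfl | ⟨d, ⟨hkd, hd⟩, _⟩
  · exact absurd hk (Finset.disjoint_left.1 h.1 hc)
  · exact ⟨d, mem_inter.2 ⟨hd, mem_nbhd.2 ⟨Finset.disjoint_left.1 h.1 hd, k, hk, hkd⟩⟩⟩

/-- Expanding the product of the factors `1 + p f` over the neighbours outside `C ∪ {e}` turns a sum
over sets attached to `K ∪ {e}` into a sum over sets attached to `K` that contain `e`. -/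
lemma prod_mul_sum_le {K : Finset ι} {e : ι} (he : e ∈ nbhd adj K) (r : ℕ)
    (𝒞 : Finset (Finset ι))
    (h𝒞 : ∀ C ∈ 𝒞, e ∉ C ∧ Disjoint C K ∧ r ≤ C.card ∧
      ∀ c ∈ C, ∃ k ∈ insert e K, Relation.ReflTransGen (fun a b => adj a b ∧ b ∈ C) k c)
    (p q w : ι → ℝ) (hp : 0 ≤ p) (hq : 0 ≤ q) (hw : 0 ≤ w) :
    (∑ C ∈ 𝒞, (∏ f ∈ (nbhd adj K \ C).erase e, (1 + p f)) * (∏ f ∈ C ∩ nbhd adj K, q f) *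
        ∏ f ∈ C \ nbhd adj K, w f) ≤
      ∑ C ∈ univ.filter (fun C => (Attached adj K C ∧ r + 1 ≤ C.card) ∧ e ∈ C),
        (∏ f ∈ C \ nbhd adj K, w f) * ∏ f ∈ (C ∩ nbhd adj K).erase e, (p f + q f) := by
  set N := nbhd adj K with hN
  have h1 : ∀ C ∈ 𝒞, (∏ f ∈ (N \ C).erase e, (1 + p f)) * (∏ f ∈ C ∩ N, q f) *
        ∏ f ∈ C \ N, w f = ∑ M ∈ ((N \ C).erase e).powerset,
          (∏ f ∈ M, p f) * (∏ f ∈ C ∩ N, q f) * ∏ f ∈ C \ N, w f := by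
    intro C _
    rw [prod_one_add, sum_mul, sum_mul]
  rw [sum_congr rfl h1, sum_sigma']
  simp_rw [prod_add, mul_sum]
  rw [sum_sigma']
  set 𝒯 := 𝒞.sigma fun C => ((N \ C).erase e).powerset with h𝒯
  -- The pair `(C, M)` is recovered from `C ∪ M ∪ {e}` and `M`.
  let φ : ((_ : Finset ι) × Finset ι) → ((_ : Finset ι) × Finset ι) :=
    fun x => ⟨insert e (x.1 ∪ x.2), x.2⟩
  have key : ∀ x ∈ 𝒯, e ∉ x.1 ∧ e ∉ x.2 ∧ Disjoint x.1 x.2 ∧ x.2 ⊆ N ∧ x.1 ∈ 𝒞 := by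
    intro x hx
    rw [h𝒯, mem_sigma, mem_powerset] at hx
    refine ⟨(h𝒞 _ hx.1).1, fun h => by simpa using hx.2 h, ?_, fun a ha => ?_, hx.1⟩
    · rw [Finset.disjoint_right]
      intro a ha
      have := hx.2 ha
      simp only [mem_erase, mem_sdiff] at this
      exact this.2.2
    · have := hx.2 ha
      simp only [mem_erase, mem_sdiff] at this
      exact this.2.1
  have hinj : Set.InjOn φ 𝒯 := by
    rintro ⟨C, M⟩ hx ⟨C', M'⟩ hy hxy
    have hx' := key _ hx
    have hy' := key _ hy
    simp only [φ, Sigma.mk.injEq, heq_eq_eq] at hxy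
    obtain ⟨h1, rfl⟩ := hxy
    simp only [Sigma.mk.injEq, heq_eq_eq, and_true]
    ext a
    have h2 : a ∈ insert e (C ∪ M) ↔ a ∈ insert e (C' ∪ M) := by rw [h1]
    simp only [mem_insert, mem_union] at h2
    have h3 : a ∈ C → a ∉ M := fun h => Finset.disjoint_left.1 hx'.2.2.1 h
    have h4 : a ∈ C' → a ∉ M := fun h => Finset.disjoint_left.1 hy'.2.2.1 h
    have h5 : a = e → a ∉ C ∧ a ∉ C' := fun h => h ▸ ⟨hx'.1, hy'.1⟩
    tauto
  have hsub : 𝒯.image φ ⊆ (univ.filter fun C => (Attached adj K C ∧ r + 1 ≤ C.card) ∧ e ∈ C).sigma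
      fun C => ((C ∩ N).erase e).powerset := by
    intro y hy
    obtain ⟨⟨C, M⟩, hx, rfl⟩ := mem_image.1 hy
    obtain ⟨k1, k2, k3, k4, k5⟩ := key _ hx
    simp only at k1 k2 k3 k4 k5
    obtain ⟨-, l2, l3, l4⟩ := h𝒞 _ k5
    simp only [φ, mem_sigma, mem_filter, mem_univ, true_and, mem_powerset]
    refine ⟨⟨⟨attached_insert_union he l2 k4 l4, ?_⟩, mem_insert_self _ _⟩, ?_⟩
    · rw [card_insert_of_notMem (by simp [k1, k2])]
      exact Nat.succ_le_succ (l3.trans (card_le_card subset_union_left))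
    · intro a ha
      have : a ≠ e := fun h => k2 (h ▸ ha)
      simp [this, ha, k4 ha]
  refine le_trans (le_of_eq ?_) (sum_le_sum_of_subset_of_nonneg hsub fun x _ _ =>
    mul_nonneg (prod_nonneg fun f _ => hw f)
      (mul_nonneg (prod_nonneg fun f _ => hp f) (prod_nonneg fun f _ => hq f)))
  rw [sum_image hinj]
  refine sum_congr rfl ?_
  rintro ⟨C, M⟩ hx
  obtain ⟨k1, k2, k3, k4, k5⟩ := key _ hx
  simp only at k1 k2 k3 k4 k5
  simp only [φ]
  have e1 : insert e (C ∪ M) \ N = C \ N := by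
    ext a
    have := @k4 a
    simp only [mem_sdiff, mem_insert, mem_union]
    constructor
    · rintro ⟨rfl | h | h, h'⟩
      · exact absurd he h'
      · exact ⟨h, h'⟩
      · exact absurd (this h) h'
    · tauto
  have e2 : (insert e (C ∪ M) ∩ N).erase e \ M = C ∩ N := by
    ext a
    have : a ∈ C → a ∉ M := fun h => Finset.disjoint_left.1 k3 h
    have h6 : a ∈ M → a ∈ N := fun h => k4 h
    have h7 : a = e → a ∈ N ∧ a ∉ M := fun h => h ▸ ⟨he, k2⟩
    have h5 : a = e → a ∉ C := fun h => h ▸ k1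
    simp only [mem_sdiff, mem_insert, mem_union, mem_erase, mem_inter]
    tauto
  rw [e1, e2]
  ring

/-- The factors of the neighbours are distributed to `e`, to the other neighbours outside `C`, and
to those in `C`. -/
lemma prod_one_add_mul_prod {N C : Finset ι} {e : ι} (he : e ∈ N) (heC : e ∉ C) (p w : ι → ℝ) :
    (∏ f ∈ N, (1 + p f)) * ∏ f ∈ C, w f =
      (1 + p e) * ((∏ f ∈ (N \ C).erase e, (1 + p f)) * (∏ f ∈ C ∩ N, ((1 + p f) * w f)) *
        ∏ f ∈ C \ N, w f) := by
  rw [← prod_inter_mul_prod_sdiff C N w, ← prod_inter_mul_prod_sdiff N C (fun f => 1 + p f),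
    ← mul_prod_erase (N \ C) (fun f => 1 + p f) (mem_sdiff.2 ⟨he, heC⟩), inter_comm N C,
    prod_mul_distrib]
  ring

/-- The weights `e^{2y} - 1` are chosen such that the expansions around the elements of the
neighbourhood of `K`, with couplings to that neighbourhood scaled by `u`, add up to at most the
derivative in `u` of the expansion around `K` (`hasDerivAt_clusterBound`). -/
lemma clusterSum_step {K : Finset ι} {r : ℕ} {x : ι → ℝ} (hx : 0 ≤ x) {u : ℝ} (hu0 : 0 ≤ u)
    (hu1 : u ≤ 1) :
    (∏ f ∈ nbhd adj K, Real.exp ((1 - u) * x f)) * ∑ e ∈ nbhd adj K, x e *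
        (clusterSum adj r (insert e K)
            (fun f => Real.exp (2 * (if f ∈ nbhd adj K then u * x f else x f)) - 1) +
          clusterSum adj r {e}
            (fun f => Real.exp (2 * (if f ∈ nbhd adj K ∨ f ∈ K then 0 else x f)) - 1)) ≤
      ∑ C ∈ univ.filter (fun C => Attached adj K C ∧ r + 1 ≤ C.card),
        (∏ f ∈ C \ nbhd adj K, (Real.exp (2 * x f) - 1)) * ∑ e ∈ C ∩ nbhd adj K,
          (x e * Real.exp ((1 + u) * x e) *
              ∏ f ∈ (C ∩ nbhd adj K).erase e, (Real.exp ((1 + u) * x f) - 1) +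
            x e * Real.exp ((1 - u) * x e) *
              ∏ f ∈ (C ∩ nbhd adj K).erase e, (Real.exp ((1 - u) * x f) - 1)) := by
  set N := nbhd adj K with hN
  set p : ι → ℝ := fun f => Real.exp ((1 - u) * x f) - 1 with hpdef
  set w : ι → ℝ := fun f => Real.exp (2 * x f) - 1 with hwdef
  have hexp : ∀ y : ℝ, 0 ≤ y → 0 ≤ Real.exp y - 1 := fun y hy => by
    linarith [Real.one_le_exp hy]
  have hp : 0 ≤ p := fun f => hexp _ (mul_nonneg (by linarith) (hx f))
  have hw : 0 ≤ w := fun f => hexp _ (mul_nonneg (by norm_num) (hx f))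
  have h1p : ∀ f, Real.exp ((1 - u) * x f) = 1 + p f := fun f => by simp [hpdef]
  -- Exchange the sums over `C` and `e` on the right-hand side.
  have hR : ∀ Q : Finset ι → ι → ℝ,
      ∑ C ∈ univ.filter (fun C => Attached adj K C ∧ r + 1 ≤ C.card), ∑ e ∈ C ∩ N, Q C e =
      ∑ e ∈ N, ∑ C ∈ univ.filter (fun C => (Attached adj K C ∧ r + 1 ≤ C.card) ∧ e ∈ C),
        Q C e := by
    intro Q
    refine sum_comm' fun C e => ?_
    simp only [mem_filter, mem_univ, true_and, mem_inter]
    tauto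
  simp_rw [mul_sum]
  rw [hR]
  refine sum_le_sum fun e he => ?_
  have hc : 0 ≤ x e * (1 + p e) := mul_nonneg (hx e) (by linarith [show 0 ≤ p e from hp e])
  have first : (∏ f ∈ N, (1 + p f)) * clusterSum adj r (insert e K)
        (fun f => Real.exp (2 * (if f ∈ N then u * x f else x f)) - 1) ≤
      (1 + p e) * ∑ C ∈ univ.filter (fun C => (Attached adj K C ∧ r + 1 ≤ C.card) ∧ e ∈ C),
        (∏ f ∈ C \ N, w f) * ∏ f ∈ (C ∩ N).erase e, (Real.exp ((1 + u) * x f) - 1) := by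
    set q : ι → ℝ := fun f => (1 + p f) * (Real.exp (2 * (u * x f)) - 1) with hq
    have hq0 : 0 ≤ q := fun f => mul_nonneg (by linarith [show 0 ≤ p f from hp f])
      (hexp _ (mul_nonneg (by norm_num) (mul_nonneg hu0 (hx f))))
    have hpq : ∀ f, Real.exp ((1 + u) * x f) - 1 = p f + q f := fun f => by
      simp only [hq, hpdef]
      rw [show (1 + u) * x f = (1 - u) * x f + 2 * (u * x f) by ring, Real.exp_add]
      ring
    simp_rw [hpq]
    have hmem : ∀ C ∈ univ.filter (fun C => Attached adj (insert e K) C ∧ r ≤ C.card),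
        e ∉ C ∧ Disjoint C K ∧ r ≤ C.card ∧ ∀ c ∈ C, ∃ k ∈ insert e K,
          Relation.ReflTransGen (fun a b => adj a b ∧ b ∈ C) k c := by
      intro C hC
      simp only [mem_filter, mem_univ, true_and] at hC
      have := hC.1.1
      rw [disjoint_insert_right] at this
      exact ⟨this.1, this.2, hC.2, hC.1.2⟩
    refine le_trans (le_of_eq ?_)
      (mul_le_mul_of_nonneg_left (prod_mul_sum_le he r _ hmem p q w hp hq0 hw)
        (by linarith [show 0 ≤ p e from hp e]))
    rw [clusterSum, mul_sum, mul_sum]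
    refine sum_congr rfl fun C hC => ?_
    rw [prod_one_add_mul_prod he (hmem C hC).1]
    congr 2
    · congr 1
      refine prod_congr rfl fun f hf => ?_
      simp [hq, show f ∈ N from (mem_inter.1 hf).2]
    · refine prod_congr rfl fun f hf => ?_
      simp [hwdef, show f ∉ N from (mem_sdiff.1 hf).2]
  have second : (∏ f ∈ N, (1 + p f)) * clusterSum adj r {e}
        (fun f => Real.exp (2 * (if f ∈ N ∨ f ∈ K then 0 else x f)) - 1) ≤
      (1 + p e) * ∑ C ∈ univ.filter (fun C => (Attached adj K C ∧ r + 1 ≤ C.card) ∧ e ∈ C),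
        (∏ f ∈ C \ N, w f) * ∏ f ∈ (C ∩ N).erase e, p f := by
    -- The weights vanish on `K`, so that only the sets disjoint from `K` contribute.
    set 𝒞 := univ.filter (fun C => (Attached adj {e} C ∧ r ≤ C.card) ∧ Disjoint C K) with h𝒞
    have hmem : ∀ C ∈ 𝒞,
        e ∉ C ∧ Disjoint C K ∧ r ≤ C.card ∧ ∀ c ∈ C, ∃ k ∈ insert e K,
          Relation.ReflTransGen (fun a b => adj a b ∧ b ∈ C) k c := by
      intro C hC
      simp only [h𝒞, mem_filter, mem_univ, true_and] at hC
      have := hC.1.1.1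
      rw [disjoint_singleton_right] at this
      refine ⟨this, hC.2, hC.1.2, fun c hc => ?_⟩
      obtain ⟨k, hk, hkc⟩ := hC.1.1.2 c hc
      rw [mem_singleton] at hk
      exact ⟨k, by simp [hk], hkc⟩
    have := prod_mul_sum_le he r _ hmem p 0 w hp le_rfl hw
    simp only [Pi.zero_apply, add_zero] at this
    refine le_trans (le_of_eq ?_)
      (mul_le_mul_of_nonneg_left this (by linarith [show 0 ≤ p e from hp e]))
    rw [clusterSum, mul_sum, mul_sum]
    have hsub : 𝒞 ⊆ univ.filter (fun C => Attached adj {e} C ∧ r ≤ C.card) := by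
      intro C
      simp only [h𝒞, mem_filter, mem_univ, true_and]
      exact fun h => h.1
    rw [← sum_subset hsub]
    · refine sum_congr rfl fun C hC => ?_
      rw [prod_one_add_mul_prod he (hmem C hC).1]
      congr 2
      · congr 1
        refine prod_congr rfl fun f hf => ?_
        simp [show f ∈ N from (mem_inter.1 hf).2]
      · refine prod_congr rfl fun f hf => ?_
        have h1 := mem_sdiff.1 hf
        have h2 := Finset.disjoint_left.1 (hmem C hC).2.1 h1.1
        simp [hwdef, show f ∉ N from h1.2, h2]
    · intro C hC hC'
      have : ¬ Disjoint C K := fun h => hC' (by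
        simp only [h𝒞, mem_filter, mem_univ, true_and] at hC ⊢
        exact ⟨hC, h⟩)
      obtain ⟨f, hf, hfK⟩ := Finset.not_disjoint_iff.1 this
      rw [prod_eq_zero hf, mul_zero]
      simp [hfK]
  simp_rw [h1p]
  -- The right-hand side has the larger factor `e^{(1+u) x_e}` in its first term.
  have mono : 1 + p e ≤ Real.exp ((1 + u) * x e) := by
    rw [← h1p]
    exact Real.exp_le_exp.2 (mul_le_mul_of_nonneg_right (by linarith) (hx e))
  have hG : 0 ≤ ∑ C ∈ univ.filter (fun C => (Attached adj K C ∧ r + 1 ≤ C.card) ∧ e ∈ C),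
        (∏ f ∈ C \ N, w f) * ∏ f ∈ (C ∩ N).erase e, (Real.exp ((1 + u) * x f) - 1) :=
    sum_nonneg fun C _ => mul_nonneg (prod_nonneg fun f _ => hw f)
      (prod_nonneg fun f _ => hexp _ (mul_nonneg (by linarith) (hx f)))
  have first' := mul_le_mul_of_nonneg_left (first.trans (mul_le_mul_of_nonneg_right mono hG)) (hx e)
  have second' := mul_le_mul_of_nonneg_left second (hx e)
  refine le_trans (le_of_eq (by ring)) ((add_le_add first' second').trans (le_of_eq ?_))
  rw [mul_sum, mul_sum, mul_sum, mul_sum, ← sum_add_distrib]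
  refine sum_congr rfl fun C _ => ?_
  ring

end Clusters

/-! ### Iterated partial derivatives -/

section PartialDerivatives

set_option linter.unusedSectionVars false

open Classical
open scoped _root_.ContDiff

variable {ι : Type*} [Fintype ι]
  {G : Type*} [NormedAddCommGroup G] [NormedSpace ℝ G]

/-- The partial derivative in the coordinate direction `e`. -/
def pd (e : ι) (f : (ι → ℝ) → G) (t : ι → ℝ) : G := fderiv ℝ f t (Pi.single e 1)

/-- The iterated partial derivative along a list of coordinate directions. -/
def pdl : List ι → ((ι → ℝ) → G) → (ι → ℝ) → G
  | [], f => f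
  | e :: l, f => pd e (pdl l f)

lemma contDiff_pd {f : (ι → ℝ) → G} (hf : ContDiff ℝ ∞ f) (e : ι) : ContDiff ℝ ∞ (pd e f) :=
  (hf.fderiv_right (m := ∞) le_rfl).clm_apply contDiff_const

lemma contDiff_pdl {f : (ι → ℝ) → G} (hf : ContDiff ℝ ∞ f) : ∀ l : List ι, ContDiff ℝ ∞ (pdl l f)
  | [] => hf
  | e :: l => contDiff_pd (contDiff_pdl hf l) e

lemma differentiableAt_of_contDiff {f : (ι → ℝ) → G} (hf : ContDiff ℝ ∞ f) {t : ι → ℝ} :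
    DifferentiableAt ℝ f t :=
  (hf.differentiable (by simp)).differentiableAt

lemma hasDerivAt_line {f : (ι → ℝ) → G} {t d : ι → ℝ} {u : ℝ}
    (hf : DifferentiableAt ℝ f (t + u • d)) :
    HasDerivAt (fun v : ℝ => f (t + v • d)) (∑ e, d e • pd e f (t + u • d)) u := by
  have h1 : HasDerivAt (fun v : ℝ => t + v • d) d u := by
    simpa using ((hasDerivAt_id u).smul_const d).const_add t
  have h2 := hf.hasFDerivAt.comp_hasDerivAt u h1
  have h3 : (∑ e, d e • pd e f (t + u • d)) = fderiv ℝ f (t + u • d) d := by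
    conv_rhs => rw [show fderiv ℝ f (t + u • d) d = fderiv ℝ f (t + u • d)
      (∑ e, Pi.single e (d e)) by rw [Finset.univ_sum_single]]
    rw [map_sum]
    refine Finset.sum_congr rfl fun e _ => ?_
    rw [pd, ← map_smul, ← Pi.single_smul, smul_eq_mul, mul_one]
  rw [h3]
  exact h2

lemma hasDerivAt_single {f : (ι → ℝ) → G} {t : ι → ℝ} {e : ι} (hf : DifferentiableAt ℝ f t) :
    HasDerivAt (fun v : ℝ => f (t + v • Pi.single e 1)) (pd e f t) 0 := by
  have h := hasDerivAt_line (f := f) (t := t) (d := Pi.single e 1) (u := 0) (by simpa using hf)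
  simpa [Pi.single_apply] using h

end PartialDerivatives

/-! ### Functions of couplings that factorize -/

section Expansion

set_option linter.unusedSectionVars false

open Classical Finset
open scoped ContDiff

variable {ι : Type*} [Fintype ι] {G : Type*} [NormedAddCommGroup G] [NormedSpace ℝ G]

/-- The vector `t` with the coordinates in `K` set to zero. -/
def zeroOn (K : Finset ι) (t : ι → ℝ) : ι → ℝ := fun f => if f ∈ K then 0 else t f

/-- `f` has graph distance at least `r` from the set `T`. -/
def Safe (adj : ι → ι → Prop) (T : ι → Prop) : ℕ → ι → Prop
  | 0, _ => True
  | r + 1, f => ¬ T f ∧ ∀ g, adj f g → Safe adj T r g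

lemma Safe.of_succ {adj : ι → ι → Prop} {T : ι → Prop} :
    ∀ {r : ℕ} {f : ι}, Safe adj T (r + 1) f → Safe adj T r f
  | 0, _, _ => trivial
  | _ + 1, _, h => ⟨h.1, fun g hg => (h.2 g hg).of_succ⟩

/-- The function `Ψ` of the couplings factorizes at each set `K` of edges that avoids `T` and
is decoupled from the rest. The constant `D` stands for the value of `Z` at zero. -/
def Factorizes (adj : ι → ι → Prop) (T : ι → Prop) (D : ℝ) (Z : (ι → ℝ) → ℝ)
    (Ψ : (ι → ℝ) → G) : Prop :=
  ∀ K : Finset ι, (∀ k ∈ K, ¬ T k) → ∀ t : ι → ℝ, (∀ f ∈ nbhd adj K, t f = 0) →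
    D • Ψ t = Z (zeroOn Kᶜ t) • Ψ (zeroOn K t)

/-- `‖∂_l Ψ‖ ≤ ν b^{|l|} Z` for all iterated partial derivatives. -/
def DerivBound (b ν : ℝ) (Z : (ι → ℝ) → ℝ) (Ψ : (ι → ℝ) → G) : Prop :=
  ∀ (l : List ι) (t : ι → ℝ), ‖pdl l Ψ t‖ ≤ ν * b ^ l.length * Z t

variable {adj : ι → ι → Prop} {T : ι → Prop} {D b ν : ℝ} {Z : (ι → ℝ) → ℝ} {Ξ : (ι → ℝ) → G}

lemma zeroOn_add_single {K : Finset ι} {t : ι → ℝ} {e : ι} (he : e ∈ K) (v : ℝ) :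
    zeroOn K (t + v • Pi.single e 1) = zeroOn K t := by
  funext f
  simp only [zeroOn]
  split_ifs with hf
  · rfl
  · have : f ≠ e := fun h => hf (h ▸ he)
    simp [this]

lemma zeroOn_add_single_of_notMem {K : Finset ι} {t : ι → ℝ} {e : ι} (he : e ∉ K) (v : ℝ) :
    zeroOn K (t + v • Pi.single e 1) = zeroOn K t + v • Pi.single e 1 := by
  funext f
  simp only [zeroOn, Pi.add_apply]
  split_ifs with hf
  · have : f ≠ e := fun h => he (h ▸ hf)
    simp [this]
  · rfl

/-- Differentiating in directions in `K` acts on the factor of `K`. -/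
lemma Factorizes.iterated_pd (hΞ : Factorizes adj T D Z Ξ) (hZs : ContDiff ℝ ∞ Z)
    (hΞs : ContDiff ℝ ∞ Ξ)
    {K : Finset ι} (hK : ∀ k ∈ K, ¬ T k) : ∀ (J : List ι), (∀ j ∈ J, j ∈ K) → ∀ t : ι → ℝ,
    (∀ f ∈ nbhd adj K, t f = 0) →
    D • pdl J Ξ t = pdl J Z (zeroOn Kᶜ t) • Ξ (zeroOn K t)
  | [], _, t, ht => hΞ K hK t ht
  | e :: J, hJ, t, ht => by
    have heK : e ∈ K := hJ e (by simp)
    have ih := fun v : ℝ => Factorizes.iterated_pd hΞ hZs hΞs hK J (fun j hj => hJ j (by simp [hj]))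
      (t + v • Pi.single e 1) (fun f hf => by
        have : f ≠ e := fun h => (mem_nbhd.1 hf).1 (h ▸ heK)
        simp [ht f hf, this])
    have h1 := (hasDerivAt_single (e := e) (differentiableAt_of_contDiff (contDiff_pdl hΞs J)
      (t := t))).const_smul D
    have h2 := (hasDerivAt_single (e := e) (differentiableAt_of_contDiff (contDiff_pdl hZs J)
      (t := zeroOn Kᶜ t))).smul_const (Ξ (zeroOn K t))
    have h3 : (fun v : ℝ => D • pdl J Ξ (t + v • Pi.single e 1)) = fun v =>
        pdl J Z (zeroOn Kᶜ t + v • Pi.single e 1) • Ξ (zeroOn K t) := by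
      funext v
      rw [ih v, zeroOn_add_single heK, zeroOn_add_single_of_notMem (by simpa using heK)]
    have h1' : HasDerivAt (fun v : ℝ => D • pdl J Ξ (t + v • Pi.single e 1))
      (D • pd e (pdl J Ξ) t) 0 := h1
    rw [h3] at h1'
    exact h1'.unique h2

/-- Differentiating in a direction away from `K` and its neighbourhood acts on the other factor. -/
lemma Factorizes.pd_outside {T' : ι → Prop} (hΞ : Factorizes adj T D Z Ξ)
    (hΞs : ContDiff ℝ ∞ Ξ) (e : ι)
    (hT : ∀ k, ¬ T' k → ¬ T k ∧ k ≠ e ∧ ¬ adj k e) :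
    Factorizes adj T' D Z (pd e Ξ) := by
  intro K hK t ht
  have heK : e ∉ K := fun h => (hT e (hK e h)).2.1 rfl
  have heN : e ∉ nbhd adj K := fun h => by
    obtain ⟨_, k, hk, hke⟩ := mem_nbhd.1 h
    exact (hT k (hK k hk)).2.2 hke
  have h := fun v : ℝ => hΞ K (fun k hk => (hT k (hK k hk)).1) (t + v • Pi.single e 1)
    (fun f hf => by
      have : f ≠ e := fun h => heN (h ▸ hf)
      simp [ht f hf, this])
  have h1 := (hasDerivAt_single (e := e) (differentiableAt_of_contDiff hΞs (t := t))).const_smul D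
  have h2 := (hasDerivAt_single (e := e) (differentiableAt_of_contDiff hΞs
    (t := zeroOn K t))).const_smul (Z (zeroOn Kᶜ t))
  have h3 : (fun v : ℝ => D • Ξ (t + v • Pi.single e 1)) = fun v =>
      Z (zeroOn Kᶜ t) • Ξ (zeroOn K t + v • Pi.single e 1) := by
    funext v
    rw [h v, zeroOn_add_single (by simpa using heK), zeroOn_add_single_of_notMem heK]
  have h1' : HasDerivAt (fun v : ℝ => D • Ξ (t + v • Pi.single e 1))
    (D • pd e Ξ t) 0 := h1
  rw [h3] at h1'
  exact h1'.unique h2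

/-- Since `|∂_e log Z| ≤ b`, changing the couplings changes `Z` by at most an exponential factor. -/
lemma DerivBound.le_mul_exp (hZ : DerivBound b 1 Z Z) (hZs : ContDiff ℝ ∞ Z) (hpos : ∀ t, 0 < Z t)
    (t d : ι → ℝ) : Z t ≤ Z (t + d) * Real.exp (b * ∑ e, |d e|) := by
  have hder : ∀ u : ℝ, HasDerivAt (fun v : ℝ => Real.log (Z (t + v • d)))
      ((∑ e, d e • pd e Z (t + u • d)) / Z (t + u • d)) u := fun u =>
    (hasDerivAt_line (differentiableAt_of_contDiff hZs)).log (hpos _).ne'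
  have hb : ∀ u : ℝ, ‖(∑ e, d e • pd e Z (t + u • d)) / Z (t + u • d)‖
      ≤ b * ∑ e, |d e| := by
    intro u
    rw [norm_div, Real.norm_of_nonneg (hpos _).le, div_le_iff₀ (hpos _), mul_sum, sum_mul]
    refine (norm_sum_le _ _).trans (sum_le_sum fun e _ => ?_)
    rw [norm_smul, Real.norm_eq_abs]
    have := hZ [e] (t + u • d)
    simp only [pdl, List.length_singleton, pow_one, one_mul] at this
    calc _ ≤ |d e| * (b * Z (t + u • d)) := mul_le_mul_of_nonneg_left this (abs_nonneg _)
      _ = _ := by ring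
  have h := Convex.norm_image_sub_le_of_norm_hasDerivWithin_le (s := Set.univ)
    (fun u _ => (hder u).hasDerivWithinAt) (fun u _ => hb u) convex_univ
    (Set.mem_univ 1) (Set.mem_univ 0)
  simp only [zero_smul, add_zero, one_smul, zero_sub, norm_neg, norm_one, mul_one] at h
  have h' := (le_abs_self _).trans h
  rw [← Real.log_le_log_iff (hpos t) (mul_pos (hpos _) (Real.exp_pos _)),
    Real.log_mul (hpos _).ne' (Real.exp_pos _).ne', Real.log_exp]
  linarith

end Expansion

/-! ### The recursion over neighbourhoods -/

section Recursion

set_option linter.unusedSectionVars false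

open Classical Finset
open scoped _root_.ContDiff

variable {ι : Type*} [Fintype ι] {G : Type*} [NormedAddCommGroup G] [NormedSpace ℝ G]
  {adj : ι → ι → Prop} {T : ι → Prop} {D b ν : ℝ} {Z : (ι → ℝ) → ℝ} {Ξ : (ι → ℝ) → G}

/-- The primitive of the right-hand side of `clusterSum_step`. -/
lemma hasDerivAt_clusterBound (K : Finset ι) (r : ℕ) (x : ι → ℝ) (u : ℝ) :
    HasDerivAt (fun u : ℝ => ∑ C ∈ univ.filter (fun C => Attached adj K C ∧ r + 1 ≤ C.card),
      (∏ f ∈ C \ nbhd adj K, (Real.exp (2 * x f) - 1)) *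
        (∏ f ∈ C ∩ nbhd adj K, (Real.exp ((1 + u) * x f) - 1) -
          ∏ f ∈ C ∩ nbhd adj K, (Real.exp ((1 - u) * x f) - 1)))
      (∑ C ∈ univ.filter (fun C => Attached adj K C ∧ r + 1 ≤ C.card),
        (∏ f ∈ C \ nbhd adj K, (Real.exp (2 * x f) - 1)) * ∑ e ∈ C ∩ nbhd adj K,
          (x e * Real.exp ((1 + u) * x e) *
              ∏ f ∈ (C ∩ nbhd adj K).erase e, (Real.exp ((1 + u) * x f) - 1) +
            x e * Real.exp ((1 - u) * x e) *
              ∏ f ∈ (C ∩ nbhd adj K).erase e, (Real.exp ((1 - u) * x f) - 1))) u := by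
  refine HasDerivAt.fun_sum fun C _ => HasDerivAt.const_mul _ ?_
  have h1 : ∀ f, HasDerivAt (fun u : ℝ => Real.exp ((1 + u) * x f) - 1)
      (Real.exp ((1 + u) * x f) * (1 * x f)) u := fun f =>
    ((((hasDerivAt_id u).const_add 1).mul_const (x f)).exp).sub_const 1
  have h2 : ∀ f, HasDerivAt (fun u : ℝ => Real.exp ((1 - u) * x f) - 1)
      (Real.exp ((1 - u) * x f) * (-1 * x f)) u := fun f =>
    ((((hasDerivAt_id u).const_sub 1).mul_const (x f)).exp).sub_const 1
  have h := (HasDerivAt.fun_finsetProd (u := C ∩ nbhd adj K) fun f _ => h1 f).sub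
    (HasDerivAt.fun_finsetProd (u := C ∩ nbhd adj K) fun f _ => h2 f)
  refine h.congr_deriv ?_
  rw [← sum_sub_distrib]
  refine sum_congr rfl fun e _ => ?_
  simp only [smul_eq_mul]
  ring

lemma clusterBound_one (K : Finset ι) (r : ℕ) (x : ι → ℝ) :
    (∑ C ∈ univ.filter (fun C => Attached adj K C ∧ r + 1 ≤ C.card),
      (∏ f ∈ C \ nbhd adj K, (Real.exp (2 * x f) - 1)) *
        (∏ f ∈ C ∩ nbhd adj K, (Real.exp ((1 + 1) * x f) - 1) -
          ∏ f ∈ C ∩ nbhd adj K, (Real.exp ((1 - 1) * x f) - 1))) =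
      clusterSum adj (r + 1) K (fun f => Real.exp (2 * x f) - 1) := by
  refine sum_congr rfl fun C hC => ?_
  simp only [mem_filter, mem_univ, true_and] at hC
  obtain ⟨f, hf⟩ := hC.1.inter_nbhd_nonempty (card_pos.1 (Nat.lt_of_lt_of_le r.succ_pos hC.2))
  rw [prod_eq_zero (f := fun f => Real.exp ((1 - 1) * x f) - 1) hf (by simp), sub_zero, one_add_one_eq_two,
    mul_comm, prod_inter_mul_prod_sdiff]

/-- If `K` is decoupled from its neighbourhood, the iterated derivatives of `Ξ` in `K` are those
of `Z` times a ratio that does not depend on `K`. -/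
lemma Factorizes.iterated_pd_eq (hΞ : Factorizes adj T D Z Ξ) (hZ : Factorizes adj T D Z Z)
    (hZs : ContDiff ℝ ∞ Z) (hΞs : ContDiff ℝ ∞ Ξ) (hD : D ≠ 0) (hpos : ∀ t, 0 < Z t)
    {K : Finset ι} (hK : ∀ k ∈ K, ¬ T k) (J : List ι) (hJ : ∀ j ∈ J, j ∈ K) (t : ι → ℝ)
    (ht : ∀ f ∈ nbhd adj K, t f = 0) :
    pdl J Ξ t = pdl J Z t • (Z (zeroOn K t))⁻¹ • Ξ (zeroOn K t) := by
  have h1 := hΞ.iterated_pd hZs hΞs hK J hJ t ht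
  have h2 := hZ.iterated_pd hZs hZs hK J hJ t ht
  have h3 := (hpos (zeroOn K t)).ne'
  rw [← (IsUnit.mk0 D hD).smul_left_cancel, h1, ← smul_assoc, h2, smul_eq_mul, ← smul_assoc,
    smul_eq_mul, mul_assoc, mul_inv_cancel₀ h3, mul_one]

lemma norm_ratio_le (hΞb : DerivBound b ν Z Ξ) (hpos : ∀ t, 0 < Z t) (s : ι → ℝ) :
    ‖(Z s)⁻¹ • Ξ s‖ ≤ ν := by
  have h := hΞb [] s
  simp only [pdl, List.length_nil, pow_zero, mul_one] at h
  rw [norm_smul, norm_inv, Real.norm_of_nonneg (hpos s).le, inv_mul_le_iff₀ (hpos s), mul_comm]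
  exact h

/-- The vector `t` with the coordinates in `N` multiplied by `u`. -/
def scaleOn (N : Finset ι) (u : ℝ) (t : ι → ℝ) : ι → ℝ := fun f => if f ∈ N then u * t f else t f

lemma scaleOn_eq (N : Finset ι) (u : ℝ) (t : ι → ℝ) :
    scaleOn N u t = zeroOn N t + u • fun f => if f ∈ N then t f else 0 := by
  funext f
  simp only [scaleOn, zeroOn, Pi.add_apply, Pi.smul_apply, smul_eq_mul]
  split_ifs <;> simp

lemma scaleOn_zero (N : Finset ι) (t : ι → ℝ) : scaleOn N 0 t = zeroOn N t := by
  funext f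
  simp [scaleOn, zeroOn]

lemma scaleOn_one (N : Finset ι) (t : ι → ℝ) : scaleOn N 1 t = t := by
  funext f
  simp [scaleOn]

lemma scaleOn_nonneg {N : Finset ι} {u : ℝ} {t : ι → ℝ} (hu : 0 ≤ u) (ht : 0 ≤ t) :
    0 ≤ scaleOn N u t := fun f => by
  simp only [scaleOn]
  split_ifs
  exacts [mul_nonneg hu (ht f), ht f]

lemma zeroOn_nonneg {N : Finset ι} {t : ι → ℝ} (ht : 0 ≤ t) : 0 ≤ zeroOn N t := fun f => by
  simp only [zeroOn]
  split_ifs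
  exacts [le_rfl, ht f]

lemma hasDerivAt_scaleOn {Ψ : (ι → ℝ) → G} (hΨ : ContDiff ℝ ∞ Ψ) (N : Finset ι) (t : ι → ℝ)
    (u : ℝ) : HasDerivAt (fun v => Ψ (scaleOn N v t)) (∑ e ∈ N, t e • pd e Ψ (scaleOn N u t)) u := by
  simp_rw [scaleOn_eq]
  refine (hasDerivAt_line (differentiableAt_of_contDiff hΨ)).congr_deriv ?_
  simp [ite_smul, sum_ite_mem]

/-- The integration of the derivative in the couplings to the neighbourhood of `K`, which are
switched off continuously. -/
lemma norm_iterated_pd_sub_le_of_step (hΞ : Factorizes adj T D Z Ξ) (hZ : Factorizes adj T D Z Z)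
    (hZs : ContDiff ℝ ∞ Z) (hΞs : ContDiff ℝ ∞ Ξ) (hD : D ≠ 0) (hpos : ∀ t, 0 < Z t)
    (hb : 0 ≤ b) (hν : 0 ≤ ν) (hZb : DerivBound b 1 Z Z) (r : ℕ)
    (K : Finset ι) (hK : ∀ k ∈ K, ¬ T k) (J : List ι) (hJ : ∀ j ∈ J, j ∈ K)
    (t : ι → ℝ) (ht : 0 ≤ t) (s : ι → ℝ) (hs : s = zeroOn (K ∪ nbhd adj K) t)
    (step : ∀ e ∈ nbhd adj K, ∀ u : ℝ, 0 ≤ u →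
      ‖pdl (e :: J) Ξ (scaleOn (nbhd adj K) u t) -
          pdl (e :: J) Z (scaleOn (nbhd adj K) u t) • (Z s)⁻¹ • Ξ s‖ ≤
        ν * b ^ (J.length + 1) * Z (scaleOn (nbhd adj K) u t) *
          (clusterSum adj r (insert e K)
              (fun f => Real.exp (2 * (b * scaleOn (nbhd adj K) u t f)) - 1) +
            clusterSum adj r {e} (fun f => Real.exp (2 * (b * s f)) - 1))) :
    ‖pdl J Ξ t - pdl J Z t • (Z s)⁻¹ • Ξ s‖ ≤
      ν * b ^ J.length * Z t *
        clusterSum adj (r + 1) K (fun f => Real.exp (2 * (b * t f)) - 1) := by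
  set N := nbhd adj K with hN
  set x : G := (Z s)⁻¹ • Ξ s with hx
  set c := ν * b ^ J.length * Z t with hc
  have hc0 : 0 ≤ c := mul_nonneg (mul_nonneg hν (pow_nonneg hb _)) (hpos t).le
  have hder : ∀ u : ℝ, HasDerivAt
      (fun u : ℝ => pdl J Ξ (scaleOn N u t) - pdl J Z (scaleOn N u t) • x)
      (∑ e ∈ N, t e • (pdl (e :: J) Ξ (scaleOn N u t) - pdl (e :: J) Z (scaleOn N u t) • x)) u := by
    intro u
    refine ((hasDerivAt_scaleOn (contDiff_pdl hΞs J) N t u).sub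
      ((hasDerivAt_scaleOn (contDiff_pdl hZs J) N t u).smul_const x)).congr_deriv ?_
    rw [sum_smul, ← sum_sub_distrib]
    refine sum_congr rfl fun e _ => ?_
    rw [pdl, pdl, smul_sub, smul_assoc]
  have hstart : pdl J Ξ (scaleOn N 0 t) - pdl J Z (scaleOn N 0 t) • x = 0 := by
    have h0 : ∀ f ∈ nbhd adj K, zeroOn N t f = 0 := fun f hf => by simp [zeroOn, hN, hf]
    have h1 : zeroOn K (zeroOn N t) = s := by
      funext f
      simp only [hs, zeroOn, mem_union]
      split_ifs <;> first | rfl | tauto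
    rw [scaleOn_zero, hΞ.iterated_pd_eq hZ hZs hΞs hD hpos hK J hJ _ h0, h1, sub_self]
  have hbound := fun u : ℝ => (hasDerivAt_clusterBound (adj := adj) K r
    (fun f => b * t f) u).const_mul c
  have hZle : ∀ u : ℝ, u ≤ 1 →
      Z (scaleOn N u t) ≤ Z t * ∏ f ∈ N, Real.exp ((1 - u) * (b * t f)) := by
    intro u hu
    have h := hZb.le_mul_exp hZs hpos (scaleOn N u t) (t - scaleOn N u t)
    rw [add_sub_cancel] at h
    refine h.trans (le_of_eq ?_)
    rw [← Real.exp_sum, ← sum_filter_add_sum_filter_not univ (· ∈ N)]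
    congr 2
    rw [sum_eq_zero (s := univ.filter (fun f => ¬ f ∈ N))
      (fun f hf => by simp [scaleOn, (mem_filter.1 hf).2]), add_zero, mul_sum, filter_mem_eq_inter, univ_inter]
    refine sum_congr rfl fun f hf => ?_
    rw [Pi.sub_apply, scaleOn, if_pos hf, abs_of_nonneg]
    · ring
    · have h1 : 0 ≤ (1 - u) * t f := mul_nonneg (by linarith) (ht f)
      linarith
  have hle := image_norm_le_of_norm_deriv_right_le_deriv_boundary (a := 0) (b := 1)
    (fun u _ => (hder u).continuousAt.continuousWithinAt) (fun u _ => (hder u).hasDerivWithinAt)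
    (by rw [hstart]; simp) hbound (fun u hu => ?_) (Set.right_mem_Icc.2 zero_le_one)
  · simp only [scaleOn_one, clusterBound_one] at hle
    exact hle
  · calc _ ≤ ∑ e ∈ N, t e * (ν * b ^ (J.length + 1) * Z (scaleOn N u t) *
          (clusterSum adj r (insert e K) (fun f => Real.exp (2 * (b * scaleOn N u t f)) - 1) +
            clusterSum adj r {e} (fun f => Real.exp (2 * (b * s f)) - 1))) := by
          refine (norm_sum_le _ _).trans (sum_le_sum fun e he => ?_)
          rw [norm_smul, Real.norm_of_nonneg (ht e)]
          exact mul_le_mul_of_nonneg_left (step e he u hu.1) (ht e)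
      _ = (ν * b ^ J.length * ∑ e ∈ N, (b * t e) *
          (clusterSum adj r (insert e K) (fun f => Real.exp (2 * (b * scaleOn N u t f)) - 1) +
            clusterSum adj r {e} (fun f => Real.exp (2 * (b * s f)) - 1))) *
              Z (scaleOn N u t) := by
          rw [mul_sum, sum_mul]
          exact sum_congr rfl fun e _ => by ring
      _ ≤ (ν * b ^ J.length * ∑ e ∈ N, (b * t e) *
          (clusterSum adj r (insert e K) (fun f => Real.exp (2 * (b * scaleOn N u t f)) - 1) +
            clusterSum adj r {e} (fun f => Real.exp (2 * (b * s f)) - 1))) *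
              (Z t * ∏ f ∈ N, Real.exp ((1 - u) * (b * t f))) := by
          refine mul_le_mul_of_nonneg_left (hZle u hu.2.le) (mul_nonneg (mul_nonneg hν
            (pow_nonneg hb _)) (sum_nonneg fun e _ => mul_nonneg (mul_nonneg hb (ht e)) ?_))
          have hw : ∀ t' : ι → ℝ, 0 ≤ t' → (0 : ι → ℝ) ≤ fun f => Real.exp (2 * (b * t' f)) - 1 :=
            fun t' ht' f => by
              simpa using Real.one_le_exp (mul_nonneg two_pos.le (mul_nonneg hb (ht' f)))
          exact add_nonneg (clusterSum_nonneg (hw _ (scaleOn_nonneg hu.1 ht)))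
            (clusterSum_nonneg (hw _ (hs ▸ zeroOn_nonneg ht)))
      _ = c * ((∏ f ∈ N, Real.exp ((1 - u) * (b * t f))) * ∑ e ∈ N, (b * t e) *
          (clusterSum adj r (insert e K) (fun f => Real.exp (2 * (b * scaleOn N u t f)) - 1) +
            clusterSum adj r {e} (fun f => Real.exp (2 * (b * s f)) - 1))) := by
          rw [hc]; ring
      _ ≤ _ := by
          refine mul_le_mul_of_nonneg_left ?_ hc0
          refine le_trans (le_of_eq ?_) (clusterSum_step (adj := adj) (K := K) (r := r)
            (x := fun f => b * t f) (fun f => mul_nonneg hb (ht f)) hu.1 hu.2.le)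
          congr 1
          refine sum_congr rfl fun e _ => ?_
          congr 3
          · funext f
            simp only [scaleOn]
            congr 3
            split_ifs <;> ring
          · funext f
            simp only [hs, zeroOn, mem_union]
            simp only [or_comm (a := f ∈ K), mul_ite, mul_zero, ← hN]

/-- **Decay of the influence of the exterior.** If every element of `K` has distance at least
`r + 1` from `T`, then the derivatives of `Ξ` in `K` agree with those of `Z`, times the value of
`Ξ / Z` for the system without `K` and its neighbourhood, up to the weight of the sets of at
least `r + 1` elements that are attached to `K`. The derivative in a coupling `e` to the
neighbourhood of `K` is compared both with the ratio for `K ∪ {e}` and with the ratio for `{e}`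
in the system without `K`, and these two ratios coincide. -/
theorem norm_iterated_pd_sub_le (hΞ : Factorizes adj T D Z Ξ) (hZ : Factorizes adj T D Z Z)
    (hZs : ContDiff ℝ ∞ Z) (hΞs : ContDiff ℝ ∞ Ξ) (hD : D ≠ 0) (hpos : ∀ t, 0 < Z t)
    (hb : 0 ≤ b) (hν : 0 ≤ ν) (hZb : DerivBound b 1 Z Z) (hΞb : DerivBound b ν Z Ξ) :
    ∀ (r : ℕ) (K : Finset ι), (∀ k ∈ K, Safe adj T (r + 1) k) → ∀ J : List ι, (∀ j ∈ J, j ∈ K) →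
    ∀ t : ι → ℝ, 0 ≤ t →
    ‖pdl J Ξ t - pdl J Z t • (Z (zeroOn (K ∪ nbhd adj K) t))⁻¹ • Ξ (zeroOn (K ∪ nbhd adj K) t)‖ ≤
      ν * b ^ J.length * Z t *
        clusterSum adj (r + 1) K (fun f => Real.exp (2 * (b * t f)) - 1) := by
  have hw : ∀ t' : ι → ℝ, 0 ≤ t' → (0 : ι → ℝ) ≤ fun f => Real.exp (2 * (b * t' f)) - 1 :=
    fun t' ht' f => by
      simpa using Real.one_le_exp (mul_nonneg two_pos.le (mul_nonneg hb (ht' f)))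
  intro r
  induction r with
  | zero =>
    intro K hK J hJ t ht
    refine norm_iterated_pd_sub_le_of_step hΞ hZ hZs hΞs hD hpos hb hν hZb 0 K
      (fun k hk => (hK k hk).1) J hJ t ht _ rfl fun e _ u hu => ?_
    set s := zeroOn (K ∪ nbhd adj K) t
    set t' := scaleOn (nbhd adj K) u t with ht'
    have h1 := hΞb (e :: J) t'
    have h2 := hZb (e :: J) t'
    have h3 := norm_ratio_le hΞb hpos s
    have h4 := one_le_clusterSum_zero (adj := adj) (K := insert e K)
      (hw t' (scaleOn_nonneg hu ht))
    have h5 := one_le_clusterSum_zero (adj := adj) (K := {e}) (hw s (zeroOn_nonneg ht))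
    rw [List.length_cons] at h1 h2
    rw [one_mul] at h2
    have h0 : 0 ≤ ν * b ^ (J.length + 1) * Z t' :=
      mul_nonneg (mul_nonneg hν (pow_nonneg hb _)) (hpos _).le
    calc _ ≤ ‖pdl (e :: J) Ξ t'‖ + ‖pdl (e :: J) Z t'‖ * ‖(Z s)⁻¹ • Ξ s‖ :=
          (norm_sub_le _ _).trans (by rw [norm_smul])
      _ ≤ ν * b ^ (J.length + 1) * Z t' + (b ^ (J.length + 1) * Z t') * ν :=
          add_le_add h1 (mul_le_mul h2 h3 (norm_nonneg _) ((norm_nonneg _).trans h2))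
      _ = ν * b ^ (J.length + 1) * Z t' * (1 + 1) := by ring
      _ ≤ _ := mul_le_mul_of_nonneg_left (add_le_add h4 h5) h0
  | succ r ih =>
    intro K hK J hJ t ht
    refine norm_iterated_pd_sub_le_of_step hΞ hZ hZs hΞs hD hpos hb hν hZb (r + 1) K
      (fun k hk => (hK k hk).1) J hJ t ht _ rfl fun e he u hu => ?_
    set s := zeroOn (K ∪ nbhd adj K) t with hs
    set t' := scaleOn (nbhd adj K) u t with ht'
    obtain ⟨heK, k, hk, hke⟩ := mem_nbhd.1 he
    have hesafe : Safe adj T (r + 1) e := (hK k hk).2 e hke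
    have i1 := ih (insert e K) (fun k hk => by
      rcases mem_insert.1 hk with rfl | hk
      exacts [hesafe, (hK k hk).of_succ]) (e :: J) (fun j hj => by
        rcases List.mem_cons.1 hj with rfl | hj
        exacts [mem_insert_self _ _, mem_insert_of_mem (hJ j hj)]) t' (scaleOn_nonneg hu ht)
    have i2 := ih {e} (fun k hk => by rwa [mem_singleton.1 hk]) [] (by simp) s (zeroOn_nonneg ht)
    -- Both closures leave the same couplings.
    have hsame : zeroOn (insert e K ∪ nbhd adj (insert e K)) t' =
        zeroOn ({e} ∪ nbhd adj {e}) s := by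
      funext f
      simp only [zeroOn, hs, ht', scaleOn, mem_union, mem_insert, mem_singleton, mem_nbhd,
        not_or, exists_eq_or_imp, exists_eq_left]
      by_cases h1 : f = e <;> by_cases h2 : f ∈ K <;> by_cases h3 : ∃ a ∈ K, adj a f <;>
        by_cases h4 : adj e f <;>
        simp only [h1, h2, h3, h4, true_or, or_true, or_false, not_true, not_false_eq_true,
          and_true, false_and, and_false, if_true, if_false]
    rw [hsame] at i1
    set y := (Z (zeroOn ({e} ∪ nbhd adj {e}) s))⁻¹ • Ξ (zeroOn ({e} ∪ nbhd adj {e}) s) with hy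
    set x := (Z s)⁻¹ • Ξ s with hx
    set S₁ := clusterSum adj (r + 1) (insert e K) (fun f => Real.exp (2 * (b * t' f)) - 1)
    set S₂ := clusterSum adj (r + 1) {e} (fun f => Real.exp (2 * (b * s f)) - 1)
    have h2 := hZb (e :: J) t'
    rw [List.length_cons] at h2 i1
    rw [one_mul] at h2
    have i3 : ‖x - y‖ ≤ ν * S₂ := by
      have h : x - y = (Z s)⁻¹ • (pdl [] Ξ s - pdl [] Z s • y) := by
        rw [pdl, pdl, smul_sub, ← smul_assoc, smul_eq_mul, inv_mul_cancel₀ (hpos s).ne', one_smul]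
      rw [h, norm_smul, norm_inv, Real.norm_of_nonneg (hpos s).le, inv_mul_le_iff₀ (hpos s)]
      refine i2.trans (le_of_eq ?_)
      rw [List.length_nil]
      ring
    calc ‖pdl (e :: J) Ξ t' - pdl (e :: J) Z t' • x‖
        = ‖(pdl (e :: J) Ξ t' - pdl (e :: J) Z t' • y) - pdl (e :: J) Z t' • (x - y)‖ := by
          rw [smul_sub]; congr 1; abel
      _ ≤ ‖pdl (e :: J) Ξ t' - pdl (e :: J) Z t' • y‖ + ‖pdl (e :: J) Z t'‖ * ‖x - y‖ :=
          (norm_sub_le _ _).trans (by rw [norm_smul])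
      _ ≤ ν * b ^ (J.length + 1) * Z t' * S₁ + (b ^ (J.length + 1) * Z t') * (ν * S₂) :=
          add_le_add i1 (mul_le_mul h2 i3 (norm_nonneg _) ((norm_nonneg _).trans h2))
      _ = _ := by ring

/-- The response of the ratio `Ξ / Z` to the coupling `e` decays with the distance of `e` from
`T`. -/
theorem norm_pd_ratio_le (hΞ : Factorizes adj T D Z Ξ) (hZ : Factorizes adj T D Z Z)
    (hZs : ContDiff ℝ ∞ Z) (hΞs : ContDiff ℝ ∞ Ξ) (hD : D ≠ 0) (hpos : ∀ t, 0 < Z t)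
    (hb : 0 ≤ b) (hν : 0 ≤ ν) (hZb : DerivBound b 1 Z Z) (hΞb : DerivBound b ν Z Ξ)
    {r : ℕ} {e : ι} (he : Safe adj T r e) (t : ι → ℝ) (ht : 0 ≤ t) :
    ‖pd e (fun t => (Z t)⁻¹ • Ξ t) t‖ ≤
      2 * b * ν * clusterSum adj r {e} (fun f => Real.exp (2 * (b * t f)) - 1) := by
  have hw : (0 : ι → ℝ) ≤ fun f => Real.exp (2 * (b * t f)) - 1 := fun f => by
    simpa using Real.one_le_exp (mul_nonneg two_pos.le (mul_nonneg hb (ht f)))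
  set S := clusterSum adj r {e} (fun f => Real.exp (2 * (b * t f)) - 1) with hS
  have hZt := (hpos t).ne'
  have hder : pd e (fun t => (Z t)⁻¹ • Ξ t) t =
      (Z t)⁻¹ • pd e Ξ t - ((Z t)⁻¹ * pd e Z t * (Z t)⁻¹) • Ξ t := by
    have h1 := hasDerivAt_single (e := e) (differentiableAt_of_contDiff hZs (t := t))
    have h2 := hasDerivAt_single (e := e) (differentiableAt_of_contDiff hΞs (t := t))
    have h3 := (h1.fun_inv (by simpa using hZt)).smul h2
    have h4 : DifferentiableAt ℝ (fun t => (Z t)⁻¹ • Ξ t) t :=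
      ((differentiableAt_of_contDiff hZs).inv hZt).smul (differentiableAt_of_contDiff hΞs)
    have h5 := (hasDerivAt_single (e := e) h4).unique h3
    rw [h5]
    simp only [zero_smul, add_zero]
    rw [sub_eq_add_neg, ← neg_smul]
    congr 2
    field_simp
  have hZ1 := hZb [e] t
  have hΞ1 := hΞb [e] t
  simp only [pdl, List.length_singleton, pow_one, one_mul] at hZ1 hΞ1
  -- The derivative does not change when `Ξ` is replaced by `Ξ - y Z`.
  have hshift : ∀ y : G, pd e (fun t => (Z t)⁻¹ • Ξ t) t = (Z t)⁻¹ • (pd e Ξ t - pd e Z t • y) -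
      ((Z t)⁻¹ * pd e Z t) • ((Z t)⁻¹ • (Ξ t - Z t • y)) := by
    intro y
    rw [hder, smul_sub, smul_sub, smul_sub, ← smul_assoc, ← smul_assoc (Z t)⁻¹ (Z t) y,
      smul_eq_mul, smul_eq_mul, inv_mul_cancel₀ hZt, one_smul, smul_smul]
    abel
  have main : ∃ y : G, ‖pd e Ξ t - pd e Z t • y‖ ≤ ν * b * Z t * S ∧
      ‖Ξ t - Z t • y‖ ≤ ν * Z t * S := by
    rcases r with _ | r
    · have h1 : 1 ≤ S := one_le_clusterSum_zero hw
      have hΞ0 := hΞb [] t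
      simp only [pdl, List.length_nil, pow_zero, mul_one] at hΞ0
      refine ⟨0, ?_, ?_⟩
      · rw [smul_zero, sub_zero]
        exact hΞ1.trans (le_mul_of_one_le_right
          (mul_nonneg (mul_nonneg hν hb) (hpos t).le) h1)
      · rw [smul_zero, sub_zero]
        exact hΞ0.trans (le_mul_of_one_le_right (mul_nonneg hν (hpos t).le) h1)
    · have h := norm_iterated_pd_sub_le hΞ hZ hZs hΞs hD hpos hb hν hZb hΞb r {e}
        (fun k hk => by rwa [mem_singleton.1 hk])
      have h1 := h [e] (by simp) t ht
      have h2 := h [] (by simp) t ht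
      simp only [pdl, List.length_singleton, pow_one, List.length_nil, pow_zero, mul_one] at h1 h2
      exact ⟨_, h1, h2⟩
  obtain ⟨y, h1, h2⟩ := main
  rw [hshift y]
  refine (norm_sub_le _ _).trans ?_
  rw [norm_smul, norm_smul, norm_smul, norm_mul, norm_inv, Real.norm_of_nonneg (hpos t).le]
  have hi : 0 ≤ (Z t)⁻¹ := inv_nonneg.2 (hpos t).le
  calc _ ≤ (Z t)⁻¹ * (ν * b * Z t * S) + (Z t)⁻¹ * (b * Z t) * ((Z t)⁻¹ * (ν * Z t * S)) := by
        have hZ1' : ‖pd e Z t‖ ≤ b * Z t := hZ1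
        gcongr
        exact mul_nonneg hi (mul_nonneg hb (hpos t).le)
    _ = _ := by field_simp; ring

end Recursion

/-! ### Hölder's inequality for traces -/

section TraceInequality

set_option linter.unusedSectionVars false

open Matrix
open scoped ComplexOrder

variable {n : Type*} [Fintype n] [DecidableEq n]

lemma norm_trace_conjTranspose_mul_mul_le (C G : Matrix n n ℂ) :
    ‖trace (Gᴴ * C * G)‖ ≤ ‖C‖ * (trace (Gᴴ * G)).re := by
  have h : ∀ M : Matrix n n ℂ, ∀ i, (Gᴴ * M * G) i i =
      inner ℂ (WithLp.toLp 2 (G.col i)) (WithLp.toLp 2 (M *ᵥ G.col i)) := by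
    intro M i
    rw [EuclideanSpace.inner_toLp_toLp, Matrix.mul_assoc, mul_apply, dotProduct]
    refine Finset.sum_congr rfl fun j _ => ?_
    rw [mul_comm]
    simp [mul_apply, mulVec, dotProduct, conjTranspose_apply]
  have h1 : ∀ i, ‖(Gᴴ * C * G) i i‖ ≤ ‖C‖ * ((Gᴴ * G) i i).re := by
    intro i
    have h2 := h 1 i
    rw [Matrix.mul_one, one_mulVec] at h2
    rw [h, h2]
    refine (norm_inner_le_norm _ _).trans ?_
    have h3 : (inner ℂ (WithLp.toLp 2 (G.col i)) (WithLp.toLp 2 (G.col i)) : ℂ).re =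
        ‖WithLp.toLp 2 (G.col i)‖ ^ 2 := inner_self_eq_norm_sq (𝕜 := ℂ) _
    rw [h3]
    have h4 := l2_opNorm_mulVec C (WithLp.toLp 2 (G.col i))
    calc _ ≤ ‖WithLp.toLp 2 (G.col i)‖ * (‖C‖ * ‖WithLp.toLp 2 (G.col i)‖) :=
          mul_le_mul_of_nonneg_left h4 (norm_nonneg _)
      _ = _ := by ring
  calc ‖trace (Gᴴ * C * G)‖ ≤ ∑ i, ‖(Gᴴ * C * G) i i‖ := norm_sum_le _ _
    _ ≤ ∑ i, ‖C‖ * ((Gᴴ * G) i i).re := Finset.sum_le_sum fun i _ => h1 i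
    _ = _ := by rw [← Finset.mul_sum, trace, Complex.re_sum]; rfl

lemma exp_eq_conjTranspose_mul_self {H : Matrix n n ℂ} (hH : H.IsHermitian) :
    NormedSpace.exp H = (NormedSpace.exp ((1 / 2 : ℂ) • H))ᴴ * NormedSpace.exp ((1 / 2 : ℂ) • H) := by
  have h1 : ((1 / 2 : ℂ) • H)ᴴ = (1 / 2 : ℂ) • H := by
    rw [conjTranspose_smul, hH.eq]
    congr 1
    simp
  rw [← exp_conjTranspose, h1, ← exp_add_of_commute _ _ (Commute.refl _), ← add_smul]
  norm_num

/-- Left multiplication by `C` changes the trace of `e^H` by a factor of at most `‖C‖`. -/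
lemma norm_trace_mul_exp_le (C : Matrix n n ℂ) {H : Matrix n n ℂ} (hH : H.IsHermitian) :
    ‖trace (C * NormedSpace.exp H)‖ ≤ ‖C‖ * (trace (NormedSpace.exp H)).re := by
  have hG : (NormedSpace.exp ((1 / 2 : ℂ) • H))ᴴ = NormedSpace.exp ((1 / 2 : ℂ) • H) := by
    rw [← exp_conjTranspose, conjTranspose_smul, hH.eq]
    congr 2
    simp
  rw [exp_eq_conjTranspose_mul_self hH]
  refine le_trans (le_of_eq ?_) (norm_trace_conjTranspose_mul_mul_le C _)
  rw [hG, ← Matrix.mul_assoc, trace_mul_comm, Matrix.mul_assoc]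

lemma trace_exp_re_pos [Nonempty n] {H : Matrix n n ℂ} (hH : H.IsHermitian) :
    0 < (trace (NormedSpace.exp H)).re := by
  have hu : IsUnit (NormedSpace.exp ((1 / 2 : ℂ) • H)) := isUnit_exp _
  rw [exp_eq_conjTranspose_mul_self hH]
  exact (Complex.pos_iff.1 (PosDef.conjTranspose_mul_self _
    (mulVec_injective_of_isUnit hu)).trace_pos).1

lemma trace_exp_im {H : Matrix n n ℂ} (hH : H.IsHermitian) :
    (trace (NormedSpace.exp H)).im = 0 := by
  rw [← Complex.conj_eq_iff_im, starRingEnd_apply, ← trace_conjTranspose, ← exp_conjTranspose,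
    hH.eq]

lemma hasDerivAt_ofFn_prod {𝕜 𝔸 : Type*} [NontriviallyNormedField 𝕜] [NormedRing 𝔸]
    [NormedAlgebra 𝕜 𝔸] {x : 𝕜} : ∀ {N : ℕ} {f : Fin N → 𝕜 → 𝔸} {f' : Fin N → 𝔸},
    (∀ i, HasDerivAt (f i) (f' i) x) →
    HasDerivAt (fun y => (List.ofFn fun i => f i y).prod)
      (∑ i, (List.ofFn fun j => if j = i then f' j else f j x).prod) x
  | 0, f, f', _ => by simpa using hasDerivAt_const x (1 : 𝔸)
  | N + 1, f, f', h => by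
    have h1 := (h 0).mul (hasDerivAt_ofFn_prod fun i : Fin N => h i.succ)
    simp only [List.ofFn_succ, List.prod_cons]
    refine h1.congr_deriv ?_
    rw [Fin.sum_univ_succ, Finset.mul_sum]
    simp [Fin.succ_inj, (Fin.succ_ne_zero _).symm]

lemma norm_ofFn_prod_le [Nonempty n] : ∀ {N : ℕ} (f : Fin N → Matrix n n ℂ),
    ‖(List.ofFn f).prod‖ ≤ ∏ i, ‖f i‖
  | 0, f => by simp
  | N + 1, f => by
    rw [List.ofFn_succ, List.prod_cons, Fin.prod_univ_succ]
    exact (norm_mul_le _ _).trans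
      (mul_le_mul_of_nonneg_left (norm_ofFn_prod_le _) (norm_nonneg _))

/-- A product of contractions in which one factor carries the operator `E` is `L E R` with
contractions `L` and `R`. -/
lemma exists_ofFn_prod_eq [Nonempty n] (E : Matrix n n ℂ) : ∀ {N : ℕ} (C : Fin N → Matrix n n ℂ),
    (∀ i, ‖C i‖ ≤ 1) → ∀ j : Fin N, ∃ L R : Matrix n n ℂ, ‖L‖ ≤ 1 ∧ ‖R‖ ≤ 1 ∧
      (List.ofFn fun i => C i * if j = i then E else 1).prod = L * E * R
  | 0, _, _, j => j.elim0
  | N + 1, C, hC, j => by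
    rw [List.ofFn_succ, List.prod_cons]
    refine Fin.cases ?_ (fun j => ?_) j
    · refine ⟨C 0, (List.ofFn fun i : Fin N => C i.succ).prod, hC 0, ?_, ?_⟩
      · exact (norm_ofFn_prod_le _).trans
          (Finset.prod_le_one (fun i _ => norm_nonneg _) fun i _ => hC _)
      · simp [(Fin.succ_ne_zero _).symm]
    · obtain ⟨L, R, hL, hR, h⟩ := exists_ofFn_prod_eq E (fun i => C i.succ) (fun i => hC _) j
      refine ⟨C 0 * L, R, (norm_mul_le _ _).trans (mul_le_one₀ (hC 0) (norm_nonneg _) hL), hR, ?_⟩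
      simp only [Fin.succ_ne_zero, if_false, mul_one, Fin.succ_inj, h]
      simp only [Matrix.mul_assoc]

/-- The exponents for which Hölder's trace inequality holds for all contractions. -/
def holderSet (N : ℕ) (H : Matrix n n ℂ) : Set (Fin N → ℝ) :=
  {θ | ∀ C : Fin N → Matrix n n ℂ, (∀ i, ‖C i‖ ≤ 1) →
    ‖trace (List.ofFn fun i => C i * NormedSpace.exp ((θ i : ℂ) • H)).prod‖ ≤
      (trace (NormedSpace.exp H)).re}

lemma exp_I_smul_mem_unitary {H : Matrix n n ℂ} (hH : H.IsHermitian) (y : ℝ) :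
    NormedSpace.exp ((y * Complex.I : ℂ) • H) ∈ unitary (Matrix n n ℂ) := by
  have h : ((y * Complex.I : ℂ) • H)ᴴ = -((y * Complex.I : ℂ) • H) := by
    rw [conjTranspose_smul, hH.eq, ← neg_smul]
    simp
  rw [Unitary.mem_iff, star_eq_conjTranspose, ← exp_conjTranspose, h,
    ← exp_add_of_commute _ _ (Commute.neg_left (Commute.refl ((y * Complex.I : ℂ) • H))),
    ← exp_add_of_commute _ _ (Commute.neg_right (Commute.refl ((y * Complex.I : ℂ) • H))),
    neg_add_cancel, add_neg_cancel,
    NormedSpace.exp_zero, and_self_iff]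

/-- By the three lines theorem, as imaginary powers of `e^H` are unitary. -/
lemma convex_holderSet [Nonempty n] (N : ℕ) {H : Matrix n n ℂ} (hH : H.IsHermitian) :
    Convex ℝ (holderSet N H) := by
  intro θ hθ η hη a b ha hb hab C hC
  set M := (trace (NormedSpace.exp H)).re with hM
  set d : Fin N → ℝ := η - θ with hd
  let f : ℂ → ℂ := fun z =>
    trace (List.ofFn fun i => C i * NormedSpace.exp (((θ i : ℂ) + z * (d i : ℂ)) • H)).prod
  have hM0 : 0 < M := trace_exp_re_pos hH
  -- Imaginary parts of the exponents can be absorbed into the contractions.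
  have hsplit : ∀ z : ℂ, ∃ C' : Fin N → Matrix n n ℂ, (∀ i, ‖C' i‖ ≤ 1) ∧ f z =
      trace (List.ofFn fun i => C' i *
        NormedSpace.exp (((θ i + z.re * d i : ℝ) : ℂ) • H)).prod := by
    intro z
    refine ⟨fun i => C i * NormedSpace.exp (((z.im * d i : ℝ) * Complex.I : ℂ) • H),
      fun i => ?_, ?_⟩
    · rw [CStarRing.norm_mul_mem_unitary _ (exp_I_smul_mem_unitary hH _)]
      exact hC i
    · simp only [f]
      congr 4
      funext i
      rw [Matrix.mul_assoc, ← exp_add_of_commute _ _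
        (((Commute.refl H).smul_left _).smul_right _), ← add_smul]
      congr 3
      apply Complex.ext <;> simp
  have hdiff : Differentiable ℂ f := by
    intro z
    have h1 : ∀ i, DifferentiableAt ℂ
        (fun z : ℂ => C i * NormedSpace.exp (((θ i : ℂ) + z * (d i : ℂ)) • H)) z := by
      intro i
      have h2 : DifferentiableAt ℂ (fun z : ℂ => ((θ i : ℂ) + z * (d i : ℂ)) • H) z := by
        fun_prop
      exact ((NormedSpace.exp_analytic (𝕂 := ℂ)
        (((θ i : ℂ) + z * (d i : ℂ)) • H)).differentiableAt.comp z h2).const_mul (C i)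
    have h3 := (hasDerivAt_ofFn_prod fun i => (h1 i).hasDerivAt).differentiableAt
    exact (LinearMap.toContinuousLinearMap
      (traceLinearMap n ℂ ℂ)).differentiableAt.comp z h3
  have hbdd : BddAbove ((norm ∘ f) '' Complex.HadamardThreeLines.verticalClosedStrip 0 1) := by
    set τ := LinearMap.toContinuousLinearMap (traceLinearMap n ℂ ℂ)
    have hcont : Continuous fun x : ℝ =>
        ∏ i, ‖NormedSpace.exp (((θ i + x * d i : ℝ) : ℂ) • H)‖ := by
      refine continuous_finsetProd _ fun i _ => ?_
      have h : Continuous (NormedSpace.exp : Matrix n n ℂ → Matrix n n ℂ) :=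
        continuous_iff_continuousAt.2 fun x => (NormedSpace.exp_analytic (𝕂 := ℂ) x).continuousAt
      refine continuous_norm.comp (h.comp ?_)
      fun_prop
    obtain ⟨K, hK⟩ := (isCompact_Icc (a := (0 : ℝ)) (b := 1)).bddAbove_image hcont.continuousOn
    refine ⟨‖τ‖ * K, ?_⟩
    rintro _ ⟨z, hz, rfl⟩
    obtain ⟨C', hC', h⟩ := hsplit z
    simp only [Function.comp_apply, h]
    refine (τ.le_opNorm _).trans (mul_le_mul_of_nonneg_left ?_ (norm_nonneg _))
    refine (norm_ofFn_prod_le _).trans ((Finset.prod_le_prod (fun i _ => norm_nonneg _)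
      fun i _ => ?_).trans (hK (Set.mem_image_of_mem _ hz)))
    exact (norm_mul_le _ _).trans (mul_le_of_le_one_left (norm_nonneg _) (hC' i))
  have h0 : ∀ z ∈ Complex.re ⁻¹' {0}, ‖f z‖ ≤ M := by
    intro z hz
    obtain ⟨C', hC', h⟩ := hsplit z
    rw [h, Set.mem_singleton_iff.1 (Set.mem_preimage.1 hz)]
    simpa using hθ C' hC'
  have h1 : ∀ z ∈ Complex.re ⁻¹' {1}, ‖f z‖ ≤ M := by
    intro z hz
    obtain ⟨C', hC', h⟩ := hsplit z
    rw [h, Set.mem_singleton_iff.1 (Set.mem_preimage.1 hz)]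
    simpa [hd] using hη C' hC'
  have hb1 : b ≤ 1 := by linarith
  have key := Complex.HadamardThreeLines.norm_le_interp_of_mem_verticalClosedStrip₀₁' f
    (z := (b : ℂ)) ⟨by simpa using hb, by simpa using hb1⟩ hdiff.diffContOnCl hbdd h0 h1
  rw [← Real.rpow_add hM0, sub_add_cancel, Real.rpow_one] at key
  refine le_trans (le_of_eq ?_) key
  simp only [f]
  congr 5
  funext i
  congr 3
  have : a = 1 - b := by linarith
  simp only [Pi.add_apply, Pi.smul_apply, smul_eq_mul, this, hd, Pi.sub_apply]
  push_cast
  ring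

/-- **Hölder's inequality** for the trace of a product of contractions and powers of `e^H`, with
equal exponents. -/
theorem norm_trace_ofFn_mul_exp_le [Nonempty n] {N : ℕ} (hN : N ≠ 0) {H : Matrix n n ℂ}
    (hH : H.IsHermitian) (C : Fin N → Matrix n n ℂ) (hC : ∀ i, ‖C i‖ ≤ 1) :
    ‖trace (List.ofFn fun i => C i * NormedSpace.exp ((N : ℂ)⁻¹ • H)).prod‖ ≤
      (trace (NormedSpace.exp H)).re := by
  -- The equal exponents are the barycentre of the exponent vectors with a single entry one.
  have hvert : Set.range (fun i j : Fin N => if i = j then (1 : ℝ) else 0) ⊆ holderSet N H := by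
    rintro _ ⟨j, rfl⟩ C hC
    obtain ⟨L, R, hL, hR, h⟩ := exists_ofFn_prod_eq (NormedSpace.exp H) C hC j
    have h' : (List.ofFn fun i => C i *
        NormedSpace.exp (((if j = i then (1 : ℝ) else 0 : ℝ) : ℂ) • H)).prod =
        L * NormedSpace.exp H * R := by
      rw [← h]
      congr 2
      funext i
      split_ifs <;> simp
    rw [h', trace_mul_comm, ← Matrix.mul_assoc]
    refine (norm_trace_mul_exp_le _ hH).trans (mul_le_of_le_one_left (trace_exp_re_pos hH).le ?_)
    exact (norm_mul_le _ _).trans (mul_le_one₀ hR (norm_nonneg _) hL)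
  have hmem : (fun _ : Fin N => (N : ℝ)⁻¹) ∈ holderSet N H := by
    refine convexHull_min hvert (convex_holderSet N hH) ?_
    rw [convexHull_basis_eq_stdSimplex]
    refine ⟨fun _ => by positivity, ?_⟩
    simp [hN]
  have := hmem C hC
  simpa using this

end TraceInequality

/-! ### Derivatives of thermal expectation values -/

section GibbsDerivatives

set_option linter.unusedSectionVars false

open Matrix Classical
open scoped _root_.ContDiff

variable {n : Type*} [Fintype n] [DecidableEq n] {ι : Type*} [Fintype ι]

lemma ofFn_smul_prod {N : ℕ} (c : Fin N → ℂ) (M : Fin N → Matrix n n ℂ) :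
    (List.ofFn fun i => c i • M i).prod = (∏ i, c i) • (List.ofFn M).prod := by
  induction N with
  | zero => simp
  | succ N ih =>
    rw [List.ofFn_succ, List.prod_cons, ih, List.ofFn_succ, List.prod_cons, Fin.prod_univ_succ,
      smul_mul_smul_comm]

lemma norm_trace_ofFn_mul_exp_le_prod [Nonempty n] {N : ℕ} (hN : N ≠ 0) {H : Matrix n n ℂ}
    (hH : H.IsHermitian) (C : Fin N → Matrix n n ℂ) :
    ‖trace (List.ofFn fun i => C i * NormedSpace.exp ((N : ℂ)⁻¹ • H)).prod‖ ≤
      (∏ i, ‖C i‖) * (trace (NormedSpace.exp H)).re := by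
  have h : ∀ i, C i * NormedSpace.exp ((N : ℂ)⁻¹ • H) =
      (‖C i‖ : ℂ) • (((‖C i‖ : ℂ)⁻¹ • C i) * NormedSpace.exp ((N : ℂ)⁻¹ • H)) := by
    intro i
    rcases eq_or_ne (C i) 0 with h0 | h0
    · simp [h0]
    · rw [smul_mul_assoc, smul_smul, mul_inv_cancel₀ (by simpa using h0), one_smul]
  simp_rw [h]
  rw [ofFn_smul_prod, trace_smul, norm_smul]
  have h1 : ‖∏ i, (‖C i‖ : ℂ)‖ = ∏ i, ‖C i‖ := by simp
  rw [h1]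
  refine mul_le_mul_of_nonneg_left (norm_trace_ofFn_mul_exp_le hN hH _ fun i => ?_)
    (Finset.prod_nonneg fun i _ => norm_nonneg _)
  rw [norm_smul, norm_inv, Complex.norm_real, norm_norm]
  exact inv_mul_le_one

/-- The operator `A` is absorbed into the first factor. -/
lemma norm_trace_mul_ofFn_mul_exp_le [Nonempty n] {N : ℕ} (hN : N ≠ 0) {H : Matrix n n ℂ}
    (hH : H.IsHermitian) (A : Matrix n n ℂ) (C : Fin N → Matrix n n ℂ) :
    ‖trace (A * (List.ofFn fun i => C i * NormedSpace.exp ((N : ℂ)⁻¹ • H)).prod)‖ ≤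
      ‖A‖ * (∏ i, ‖C i‖) * (trace (NormedSpace.exp H)).re := by
  obtain ⟨N, rfl⟩ := Nat.exists_eq_succ_of_ne_zero hN
  have h := norm_trace_ofFn_mul_exp_le_prod hN hH
    (Fin.cons (A * C 0) fun i => C i.succ : Fin (N + 1) → Matrix n n ℂ)
  rw [Fin.prod_univ_succ] at h ⊢
  rw [List.ofFn_succ, List.prod_cons] at h ⊢
  simp only [Fin.cons_zero, Fin.cons_succ] at h
  rw [Matrix.mul_assoc, Matrix.mul_assoc] at h
  rw [Matrix.mul_assoc]
  refine h.trans (mul_le_mul_of_nonneg_right ?_ (trace_exp_re_pos hH).le)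
  rw [← mul_assoc]
  exact mul_le_mul_of_nonneg_right (norm_mul_le _ _) (Finset.prod_nonneg fun i _ => norm_nonneg _)

/-- The Hamiltonian with couplings `t` and interaction terms `Y`. -/
def linHam (Y : ι → Matrix n n ℂ) (t : ι → ℝ) : Matrix n n ℂ := ∑ e, t e • Y e

/-- The unnormalized thermal state `e^{∑ t_e Y_e}`. -/
def gibbsExp (Y : ι → Matrix n n ℂ) (t : ι → ℝ) : Matrix n n ℂ := NormedSpace.exp (linHam Y t)

/-- The partition function, a function of the couplings. -/
def partitionFn (Y : ι → Matrix n n ℂ) (t : ι → ℝ) : ℝ := (trace (gibbsExp Y t)).re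

/-- The unnormalized expectation of `A`, a function of the couplings. -/
def expectFn (Y : ι → Matrix n n ℂ) (A : Matrix n n ℂ) (t : ι → ℝ) : ℂ := trace (A * gibbsExp Y t)

variable {Y : ι → Matrix n n ℂ}

lemma linHam_smul (c : ℝ) (t : ι → ℝ) : linHam Y (c • t) = c • linHam Y t := by
  simp [linHam, Finset.smul_sum, smul_smul]

lemma isHermitian_linHam (hY : ∀ e, (Y e).IsHermitian) (t : ι → ℝ) : (linHam Y t).IsHermitian := by
  rw [IsHermitian, linHam, conjTranspose_sum]
  refine Finset.sum_congr rfl fun e _ => ?_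
  rw [conjTranspose_smul, (hY e).eq, star_trivial]

lemma contDiff_gibbsExp : ContDiff ℝ ∞ (gibbsExp Y) := by
  have h : ContDiff ℂ ∞ (NormedSpace.exp : Matrix n n ℂ → Matrix n n ℂ) :=
    contDiff_iff_contDiffAt.2 fun x => (NormedSpace.exp_analytic (𝕂 := ℂ) x).contDiffAt
  refine (h.restrict_scalars ℝ).comp ?_
  unfold linHam
  fun_prop

lemma contDiff_trace_mul {f : (ι → ℝ) → Matrix n n ℂ} (hf : ContDiff ℝ ∞ f) (A : Matrix n n ℂ) :
    ContDiff ℝ ∞ fun t => trace (A * f t) := by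
  have h : ContDiff ℝ ∞ fun M : Matrix n n ℂ => trace (A * M) :=
    (LinearMap.toContinuousLinearMap
      ((traceLinearMap n ℝ ℂ).comp (LinearMap.mulLeft ℝ A))).contDiff
  exact h.comp hf

lemma contDiff_expectFn (A : Matrix n n ℂ) : ContDiff ℝ ∞ (expectFn Y A) :=
  contDiff_trace_mul contDiff_gibbsExp A

lemma contDiff_partitionFn : ContDiff ℝ ∞ (partitionFn Y) := by
  have h : ContDiff ℝ ∞ fun M : Matrix n n ℂ => (trace M).re :=
    (LinearMap.toContinuousLinearMap
      (Complex.reLm.comp (traceLinearMap n ℝ ℂ))).contDiff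
  exact h.comp contDiff_gibbsExp

lemma partitionFn_pos [Nonempty n] (hY : ∀ e, (Y e).IsHermitian) (t : ι → ℝ) :
    0 < partitionFn Y t :=
  trace_exp_re_pos (isHermitian_linHam hY t)

lemma gibbsExp_zero : gibbsExp Y 0 = 1 := by
  simp [gibbsExp, linHam]

lemma pd_gibbsExp_zero (e : ι) : pd e (gibbsExp Y) 0 = Y e := by
  have h1 := hasDerivAt_single (e := e) (differentiableAt_of_contDiff (contDiff_gibbsExp (Y := Y))
    (t := 0))
  have h2 : HasDerivAt (fun v : ℝ => NormedSpace.exp (v • Y e)) (Y e) 0 := by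
    have h3 : HasFDerivAt (NormedSpace.exp : Matrix n n ℂ → Matrix n n ℂ)
        (1 : Matrix n n ℂ →L[ℝ] Matrix n n ℂ) ((0 : ℝ) • Y e) := by
      rw [zero_smul]
      exact hasFDerivAt_exp_zero
    have h4 := h3.comp_hasDerivAt (0 : ℝ) ((hasDerivAt_id (0 : ℝ)).smul_const (Y e))
    simpa [Function.comp_def] using h4
  refine h1.unique (h2.congr_of_eventuallyEq (Filter.Eventually.of_forall fun v => ?_))
  simp [gibbsExp, linHam, Pi.single_apply, ite_smul]

lemma pdl_comp_smul {G : Type*} [NormedAddCommGroup G] [NormedSpace ℝ G] {f : (ι → ℝ) → G}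
    (hf : ContDiff ℝ ∞ f) (c : ℝ) : ∀ (l : List ι) (t : ι → ℝ),
    pdl l (fun t => f (c • t)) t = c ^ l.length • pdl l f (c • t)
  | [], t => by simp [pdl]
  | e :: l, t => by
    have h : pdl l (fun t => f (c • t)) = fun t => c ^ l.length • pdl l f (c • t) :=
      funext (pdl_comp_smul hf c l)
    have h' : ContDiff ℝ ∞ fun t : ι → ℝ => pdl l f (c • t) :=
      (contDiff_pdl hf l).comp (contDiff_const_smul c)
    rw [pdl, pdl, h, pd, pd, fderiv_fun_const_smul (differentiableAt_of_contDiff h'),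
      fderiv_comp_smul]
    simp [smul_smul, pow_succ]

lemma pdl_append_singleton {G : Type*} [NormedAddCommGroup G] [NormedSpace ℝ G]
    (f : (ι → ℝ) → G) (e : ι) : ∀ l : List ι, pdl (l ++ [e]) f = pdl l (pd e f)
  | [] => rfl
  | e' :: l => by rw [List.cons_append, pdl, pdl_append_singleton f e l, pdl]

lemma pdl_sum {G κ : Type*} [NormedAddCommGroup G] [NormedSpace ℝ G] (s : Finset κ)
    {f : κ → (ι → ℝ) → G} (hf : ∀ k, ContDiff ℝ ∞ (f k)) : ∀ l : List ι,
    pdl l (fun t => ∑ k ∈ s, f k t) = fun t => ∑ k ∈ s, pdl l (f k) t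
  | [] => rfl
  | e :: l => by
    rw [pdl, pdl_sum s hf l]
    funext t
    rw [pd, fderiv_fun_sum fun k _ => differentiableAt_of_contDiff (contDiff_pdl (hf k) l)]
    simp [pdl, pd]

/-- The product over `j` of the iterated derivatives along `m j` of the function `Φ`. -/
def derivWord {N : ℕ} (Φ : (ι → ℝ) → Matrix n n ℂ) (m : Fin N → List ι) (t : ι → ℝ) :
    Matrix n n ℂ :=
  (List.ofFn fun j => pdl (m j) Φ t).prod

lemma contDiff_ofFn_prod {N : ℕ} {f : Fin N → (ι → ℝ) → Matrix n n ℂ}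
    (hf : ∀ j, ContDiff ℝ ∞ (f j)) : ContDiff ℝ ∞ fun t => (List.ofFn fun j => f j t).prod := by
  induction N with
  | zero => simpa using contDiff_const
  | succ N ih =>
    simp only [List.ofFn_succ, List.prod_cons]
    exact (hf 0).mul (ih fun j => hf j.succ)

/-- The Leibniz rule. -/
lemma pd_trace_derivWord {N : ℕ} {Φ : (ι → ℝ) → Matrix n n ℂ} (hΦ : ContDiff ℝ ∞ Φ)
    (A : Matrix n n ℂ) (m : Fin N → List ι) (e : ι) :
    pd e (fun t => trace (A * derivWord Φ m t)) =
      fun t => ∑ j, trace (A * derivWord Φ (Function.update m j (e :: m j)) t) := by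
  funext t
  have h1 := hasDerivAt_single (e := e) (differentiableAt_of_contDiff
    (contDiff_trace_mul (contDiff_ofFn_prod fun j => contDiff_pdl hΦ (m j)) A) (t := t))
  have h2 := hasDerivAt_ofFn_prod fun j => hasDerivAt_single (e := e)
    (differentiableAt_of_contDiff (contDiff_pdl hΦ (m j)) (t := t))
  have h3 := (LinearMap.toContinuousLinearMap ((traceLinearMap n ℝ ℂ).comp
    (LinearMap.mulLeft ℝ A))).hasFDerivAt.comp_hasDerivAt (0 : ℝ) h2
  refine (h1.unique h3).trans ?_
  rw [map_sum]
  refine Finset.sum_congr rfl fun i _ => ?_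
  simp only [zero_smul, add_zero, derivWord]
  change trace (A * _) = _
  congr 4
  funext j
  rcases eq_or_ne j i with rfl | h
  · simp [pdl]
  · simp [h]

/-- The weight of a product of derivatives: a factor of `p` for each first derivative, and a factor
of `q` for each further derivative of the same factor. -/
def wordWeight {N : ℕ} (p q : ℝ) (m : Fin N → List ι) : ℝ :=
  ∏ j, if m j = [] then 1 else p * q ^ ((m j).length - 1)

/-- The total weight of the words that arise when one more derivative is distributed over the
factors. -/
lemma sum_wordWeight_update_le {N : ℕ} {p q : ℝ} (hp : 0 ≤ p) (hq : 0 ≤ q) (m : Fin N → List ι)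
    (e : ι) : ∑ j, wordWeight p q (Function.update m j (e :: m j)) ≤
      wordWeight p q m * (N * p + (∑ j, (m j).length : ℕ) * q) := by
  have h1 : ∀ j, wordWeight p q (Function.update m j (e :: m j)) ≤
      wordWeight p q m * (p + (m j).length * q) := by
    intro j
    rw [wordWeight, wordWeight, ← Finset.mul_prod_erase _ _ (Finset.mem_univ j),
      ← Finset.mul_prod_erase Finset.univ (fun j => if m j = [] then (1 : ℝ) else
        p * q ^ ((m j).length - 1)) (Finset.mem_univ j)]
    have h2 : ∏ i ∈ Finset.univ.erase j, (if Function.update m j (e :: m j) i = [] then (1 : ℝ) else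
        p * q ^ ((Function.update m j (e :: m j) i).length - 1)) =
        ∏ i ∈ Finset.univ.erase j, if m i = [] then (1 : ℝ) else p * q ^ ((m i).length - 1) := by
      refine Finset.prod_congr rfl fun i hi => ?_
      rw [Function.update_of_ne (Finset.ne_of_mem_erase hi)]
    rw [h2, mul_right_comm]
    have h3 : 0 ≤ ∏ i ∈ Finset.univ.erase j,
        if m i = [] then (1 : ℝ) else p * q ^ ((m i).length - 1) :=
      Finset.prod_nonneg fun i _ => by split_ifs <;> positivity
    refine mul_le_mul_of_nonneg_right ?_ h3
    simp only [Function.update_self, List.cons_ne_nil, if_false, List.length_cons,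
      Nat.add_sub_cancel]
    cases hm : m j with
    | nil => simp
    | cons a l =>
      simp only [List.cons_ne_nil, if_false, List.length_cons, Nat.add_sub_cancel]
      have h4 : 0 ≤ p * q ^ l.length := by positivity
      rw [pow_succ, ← mul_assoc]
      refine mul_le_mul_of_nonneg_left ?_ h4
      push_cast
      nlinarith [mul_nonneg (Nat.cast_nonneg (α := ℝ) l.length) hq]
  refine (Finset.sum_le_sum fun j _ => h1 j).trans (le_of_eq ?_)
  rw [← Finset.mul_sum, Finset.sum_add_distrib, ← Finset.sum_mul]
  simp

/-- Leibniz' rule for the `N` factors `Φ`, whose derivatives at `t` are small compared with `Φ`. -/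
lemma norm_pdl_trace_derivWord_le [Nonempty n] {N : ℕ} (hN : N ≠ 0) {H : Matrix n n ℂ}
    (hH : H.IsHermitian) {Φ : (ι → ℝ) → Matrix n n ℂ} (hΦ : ContDiff ℝ ∞ Φ) (t : ι → ℝ)
    (A : Matrix n n ℂ) {p q : ℝ} (hp : 0 ≤ p) (hq : 0 ≤ q) {k : ℕ}
    (hder : ∀ l : List ι, l.length ≤ k → ∃ C : Matrix n n ℂ,
      pdl l Φ t = C * NormedSpace.exp ((N : ℂ)⁻¹ • H) ∧
      ‖C‖ ≤ if l = [] then 1 else p * q ^ (l.length - 1)) :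
    ∀ (d : ℕ) (l : List ι) (m : Fin N → List ι), l.length = d →
      l.length + ∑ j, (m j).length ≤ k →
      ‖pdl l (fun t => trace (A * derivWord Φ m t)) t‖ ≤
        ‖A‖ * wordWeight p q m * (N * p + k * q) ^ d * (trace (NormedSpace.exp H)).re := by
  have htr := (trace_exp_re_pos hH).le
  intro d
  induction d with
  | zero =>
    intro l m hl hk
    rw [List.length_eq_zero_iff] at hl
    subst hl
    have hk' : ∀ j, (m j).length ≤ k := fun j =>
      (Finset.single_le_sum (f := fun j => (m j).length) (fun _ _ => Nat.zero_le _)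
        (Finset.mem_univ j)).trans ((Nat.le_add_left _ _).trans hk)
    choose C hC1 hC2 using fun j => hder (m j) (hk' j)
    simp only [pdl, derivWord, hC1, pow_zero, mul_one]
    refine (norm_trace_mul_ofFn_mul_exp_le hN hH A C).trans ?_
    refine mul_le_mul_of_nonneg_right (mul_le_mul_of_nonneg_left ?_ (norm_nonneg _)) htr
    exact Finset.prod_le_prod (fun _ _ => norm_nonneg _) fun j _ => hC2 j
  | succ d ih =>
    intro l m hl hk
    rcases List.eq_nil_or_concat l with rfl | ⟨l, e, rfl⟩
    · simp at hl
    rw [List.concat_eq_append] at hl hk ⊢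
    rw [List.length_append, List.length_singleton] at hl hk
    have hsm : ∀ m : Fin N → List ι, ContDiff ℝ ∞ fun t => trace (A * derivWord Φ m t) := fun m =>
      contDiff_trace_mul (contDiff_ofFn_prod fun i => contDiff_pdl hΦ _) A
    rw [pdl_append_singleton, pd_trace_derivWord hΦ, pdl_sum _ fun j => hsm _]
    have hlen : ∀ j, ∑ i, (Function.update m j (e :: m j) i).length = ∑ i, (m i).length + 1 := by
      intro j
      rw [← Finset.add_sum_erase _ _ (Finset.mem_univ j),
        ← Finset.add_sum_erase Finset.univ (fun i => (m i).length) (Finset.mem_univ j)]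
      simp only [Function.update_self, List.length_cons]
      rw [Finset.sum_congr rfl fun i hi => by
        rw [Function.update_of_ne (Finset.ne_of_mem_erase hi)]]
      ring
    have hB : 0 ≤ (N * p + k * q) ^ d := by positivity
    calc _ ≤ ∑ j, ‖A‖ * wordWeight p q (Function.update m j (e :: m j)) * (N * p + k * q) ^ d *
          (trace (NormedSpace.exp H)).re :=
          (norm_sum_le _ _).trans (Finset.sum_le_sum fun j _ =>
            ih l _ (by omega) (by rw [hlen]; omega))
      _ = ‖A‖ * (∑ j, wordWeight p q (Function.update m j (e :: m j))) * (N * p + k * q) ^ d *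
          (trace (NormedSpace.exp H)).re := by
          rw [Finset.mul_sum, Finset.sum_mul, Finset.sum_mul]
      _ ≤ ‖A‖ * (wordWeight p q m * (N * p + k * q)) * (N * p + k * q) ^ d *
          (trace (NormedSpace.exp H)).re := by
          refine mul_le_mul_of_nonneg_right (mul_le_mul_of_nonneg_right
            (mul_le_mul_of_nonneg_left ?_ (norm_nonneg _)) hB) htr
          refine (sum_wordWeight_update_le hp hq m e).trans (mul_le_mul_of_nonneg_left ?_ ?_)
          · have : (∑ j, (m j).length : ℕ) ≤ k := by omega
            gcongr
          · exact Finset.prod_nonneg fun i _ => by split_ifs <;> positivity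
      _ = _ := by ring

lemma gibbsExp_eq_ofFn_prod {N : ℕ} (hN : N ≠ 0) (t : ι → ℝ) :
    gibbsExp Y t = (List.ofFn fun _ : Fin N => gibbsExp Y ((N : ℝ)⁻¹ • t)).prod := by
  have h : linHam Y t = N • linHam Y ((N : ℝ)⁻¹ • t) := by
    rw [linHam_smul, ← Nat.cast_smul_eq_nsmul ℝ, smul_smul, mul_inv_cancel₀ (by exact_mod_cast hN),
      one_smul]
  rw [List.ofFn_const, List.prod_replicate, gibbsExp, gibbsExp, h, exp_nsmul]

/-- **Derivatives of thermal expectation values.** The state `e^{H_t}` is a product of `N` factors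
`e^{H_t / N}`. By Leibniz' rule and Hölder's inequality the derivatives are bounded by sums over
the factors on which they act; as `N → ∞`, each derivative contributes `‖Y_e‖ / N` per factor, and
repeated derivatives of the same factor become negligible. -/
theorem norm_pdl_expectFn_le [Nonempty n] (hY : ∀ e, (Y e).IsHermitian) {b : ℝ}
    (hb : ∀ e, ‖Y e‖ ≤ b) (hb0 : 0 ≤ b) (A : Matrix n n ℂ) :
    DerivBound b ‖A‖ (partitionFn Y) (expectFn Y A) := by
  intro l t
  set k := l.length with hk
  have htr := (partitionFn_pos hY t).le
  have hΦ := contDiff_gibbsExp (Y := Y)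
  have lim0 : Filter.Tendsto (fun N : ℕ => (N : ℝ)⁻¹ • t) Filter.atTop (nhds 0) := by
    simpa using (tendsto_inv_atTop_nhds_zero_nat (𝕜 := ℝ)).smul_const t
  have cont : ∀ l : List ι, Filter.Tendsto
      (fun N : ℕ => ‖pdl l (gibbsExp Y) ((N : ℝ)⁻¹ • t) * gibbsExp Y (-((N : ℝ)⁻¹ • t))‖)
      Filter.atTop (nhds ‖pdl l (gibbsExp Y) 0‖) := by
    intro l
    have h1 : Continuous fun s : ι → ℝ => ‖pdl l (gibbsExp Y) s * gibbsExp Y (-s)‖ :=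
      ((contDiff_pdl hΦ l).continuous.mul (hΦ.continuous.comp continuous_neg)).norm
    have h2 := (h1.tendsto 0).comp lim0
    rwa [neg_zero, gibbsExp_zero, mul_one] at h2
  suffices h : ∀ b' : ℝ, b < b' → ‖pdl l (expectFn Y A) t‖ ≤ ‖A‖ * b' ^ k * partitionFn Y t by
    have h1 : Filter.Tendsto (fun b' : ℝ => ‖A‖ * b' ^ k * partitionFn Y t)
        (nhdsWithin b (Set.Ioi b)) (nhds (‖A‖ * b ^ k * partitionFn Y t)) :=
      ((by fun_prop : Continuous fun b' : ℝ => ‖A‖ * b' ^ k * partitionFn Y t).tendsto b).mono_left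
        nhdsWithin_le_nhds
    exact ge_of_tendsto h1 (Filter.eventually_of_mem self_mem_nhdsWithin fun b' hb' => h b' hb')
  -- For large `N`, first derivatives of `e^{H_t / N}` are bounded by `b' / N` and all derivatives
  -- of order `j` by `K / N ^ j`, relative to `e^{H_t / N}` itself.
  intro b' hb'
  have hb'0 : 0 < b' := hb0.trans_lt hb'
  have hfin := List.finite_length_le (α := ι) (n := k)
  obtain ⟨K, hK⟩ := (hfin.image fun p => ‖pdl p (gibbsExp Y) 0‖ + 1).bddAbove
  have ev1 : ∀ᶠ N : ℕ in Filter.atTop, ∀ p ∈ {p : List ι | p.length ≤ k},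
      ‖pdl p (gibbsExp Y) ((N : ℝ)⁻¹ • t) * gibbsExp Y (-((N : ℝ)⁻¹ • t))‖ ≤ K := by
    rw [Filter.eventually_all_finite hfin]
    intro p hp
    filter_upwards [(cont p).eventually_lt_const (lt_add_one _)] with N hN
    exact hN.le.trans (hK (Set.mem_image_of_mem _ hp))
  have ev2 : ∀ᶠ N : ℕ in Filter.atTop, ∀ e : ι,
      ‖pdl [e] (gibbsExp Y) ((N : ℝ)⁻¹ • t) * gibbsExp Y (-((N : ℝ)⁻¹ • t))‖ ≤ b' := by
    rw [Filter.eventually_all]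
    intro e
    have h1 := cont [e]
    rw [pdl, pdl, pd_gibbsExp_zero] at h1
    filter_upwards [h1.eventually_lt_const ((hb e).trans_lt hb')] with N hN
    exact hN.le
  set Q := max 1 (K / b') with hQ
  have hQ0 : 0 ≤ Q := zero_le_one.trans (le_max_left _ _)
  have hinv : ∀ s : ι → ℝ, gibbsExp Y (-s) * gibbsExp Y s = 1 := by
    intro s
    have h1 : linHam Y (-s) = -linHam Y s := by
      rw [← neg_one_smul ℝ, linHam_smul, neg_one_smul]
    rw [gibbsExp, gibbsExp, h1, ← exp_add_of_commute _ _
      (Commute.neg_left (Commute.refl (linHam Y s))), neg_add_cancel, NormedSpace.exp_zero]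
  have bound : ∀ᶠ N : ℕ in Filter.atTop, ‖pdl l (expectFn Y A) t‖ ≤
      ‖A‖ * (b' + k * Q * (N : ℝ)⁻¹) ^ k * partitionFn Y t := by
    filter_upwards [ev1, ev2, Filter.eventually_ne_atTop 0] with N h1 h2 hN
    have hN0 : (N : ℝ) ≠ 0 := by exact_mod_cast hN
    have hNi : 0 ≤ (N : ℝ)⁻¹ := by positivity
    have hexp : NormedSpace.exp ((N : ℂ)⁻¹ • linHam Y t) = gibbsExp Y ((N : ℝ)⁻¹ • t) := by
      rw [gibbsExp, linHam_smul]
      congr 1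
      rw [← Complex.coe_smul]
      simp
    have key := norm_pdl_trace_derivWord_le hN (isHermitian_linHam hY t)
      (Φ := fun t => gibbsExp Y ((N : ℝ)⁻¹ • t)) (hΦ.comp (contDiff_const_smul _)) t A
      (p := b' * (N : ℝ)⁻¹) (q := Q * (N : ℝ)⁻¹) (by positivity) (by positivity) (k := k) ?_
      k l (fun _ => []) rfl (by simp [hk])
    · have h3 : (fun t => trace (A * derivWord (fun t => gibbsExp Y ((N : ℝ)⁻¹ • t))
          (fun _ : Fin N => []) t)) = expectFn Y A := by
        funext s
        rw [expectFn, gibbsExp_eq_ofFn_prod hN]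
        rfl
      rw [h3] at key
      refine key.trans (le_of_eq ?_)
      have h4 : wordWeight (b' * (N : ℝ)⁻¹) (Q * (N : ℝ)⁻¹) (fun _ : Fin N => ([] : List ι)) = 1 := by
        simp [wordWeight]
      rw [h4, mul_one, partitionFn, gibbsExp]
      congr 3
      field_simp
    · intro p hp
      refine ⟨pdl p (fun t => gibbsExp Y ((N : ℝ)⁻¹ • t)) t * gibbsExp Y (-((N : ℝ)⁻¹ • t)), ?_, ?_⟩
      · rw [hexp, Matrix.mul_assoc, hinv, Matrix.mul_one]
      · rw [pdl_comp_smul hΦ, smul_mul_assoc, norm_smul, norm_pow, Real.norm_of_nonneg hNi]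
        rcases p with _ | ⟨e, p⟩
        · simp only [List.length_nil, pow_zero, one_mul, if_true, pdl]
          have h5 := hinv (-((N : ℝ)⁻¹ • t))
          rw [neg_neg] at h5
          rw [h5, norm_one]
        · simp only [List.cons_ne_nil, if_false, List.length_cons, Nat.add_sub_cancel]
          rcases p with _ | ⟨e', p⟩
          · simp only [List.length_nil, zero_add, pow_one, pow_zero, mul_one]
            rw [mul_comm]
            exact mul_le_mul_of_nonneg_right (h2 e) hNi
          · have h5 := h1 (e :: e' :: p) hp
            have h6 : K ≤ b' * Q ^ (p.length + 1) := by
              have h7 : K / b' ≤ Q := le_max_right _ _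
              rw [div_le_iff₀' hb'0] at h7
              refine h7.trans (mul_le_mul_of_nonneg_left ?_ hb'0.le)
              exact le_self_pow₀ (le_max_left _ _) (by omega)
            simp only [List.length_cons]
            calc _ ≤ (N : ℝ)⁻¹ ^ (p.length + 1 + 1) * (b' * Q ^ (p.length + 1)) :=
                  mul_le_mul_of_nonneg_left (h5.trans h6) (by positivity)
              _ = _ := by ring
  have lim : Filter.Tendsto (fun N : ℕ => ‖A‖ * (b' + k * Q * (N : ℝ)⁻¹) ^ k * partitionFn Y t)
      Filter.atTop (nhds (‖A‖ * b' ^ k * partitionFn Y t)) := by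
    have h1 := (((tendsto_inv_atTop_nhds_zero_nat (𝕜 := ℝ)).const_mul (k * Q)).const_add b')
    rw [mul_zero, add_zero] at h1
    exact ((h1.pow k).const_mul ‖A‖).mul_const _
  exact ge_of_tendsto lim bound

/-- The partition function is the real part of the unnormalized expectation of `1`. -/
lemma derivBound_partitionFn [Nonempty n] (hY : ∀ e, (Y e).IsHermitian) {b : ℝ}
    (hb : ∀ e, ‖Y e‖ ≤ b) (hb0 : 0 ≤ b) : DerivBound b 1 (partitionFn Y) (partitionFn Y) := by
  have hre : ∀ l : List ι, ∀ t, pdl l (partitionFn Y) t = (pdl l (expectFn Y 1) t).re := by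
    intro l
    induction l with
    | nil => intro t; simp [pdl, partitionFn, expectFn]
    | cons e l ih =>
      intro t
      have h1 := hasDerivAt_single (e := e) (differentiableAt_of_contDiff
        (contDiff_pdl (contDiff_expectFn (Y := Y) 1) l) (t := t))
      have h2 := hasDerivAt_single (e := e) (differentiableAt_of_contDiff
        (contDiff_pdl (contDiff_partitionFn (Y := Y)) l) (t := t))
      simp_rw [ih] at h2
      exact h2.unique (Complex.reCLM.hasFDerivAt.comp_hasDerivAt (0 : ℝ) h1)
  intro l t
  have h := norm_pdl_expectFn_le hY hb hb0 1 l t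
  rw [norm_one] at h
  rw [hre]
  exact (Complex.abs_re_le_norm _).trans h

end GibbsDerivatives

/-! ### Anticommutation relations and commutants -/

section CAR

set_option linter.unusedSectionVars false

open Matrix

variable {V : Type*} [Fintype V] [LinearOrder V]

/-- The sign `(-1)^{#{y ∈ T : y < x}}` of the fermionic operators. -/
def siteSign (x : V) (T : Finset V) : ℂ := (-1) ^ (T.filter (· < x)).card

lemma siteSign_mul_self (x : V) (T : Finset V) : siteSign x T * siteSign x T = 1 := by
  rw [siteSign, ← mul_pow]
  simp

lemma star_siteSign (x : V) (T : Finset V) : star (siteSign x T) = siteSign x T := by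
  simp [siteSign]

lemma siteSign_insert (x y : V) (T : Finset V) (hy : y ∉ T) :
    siteSign x (insert y T) = if y < x then -siteSign x T else siteSign x T := by
  rw [siteSign, siteSign, Finset.filter_insert]
  split_ifs with h
  · rw [Finset.card_insert_of_notMem (by simp [hy]), pow_succ]
    ring
  · rfl

lemma siteSign_erase (x y : V) (T : Finset V) (hy : y ∈ T) :
    siteSign x (T.erase y) = if y < x then -siteSign x T else siteSign x T := by
  have h := siteSign_insert x y (T.erase y) (Finset.notMem_erase _ _)
  rw [Finset.insert_erase hy] at h
  rw [h]
  split_ifs <;> simp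

lemma annih_mul_apply {κ : Type*} (x : V) (M : Matrix (Finset V) κ ℂ) (T : Finset V) (k : κ) :
    (annih x * M) T k = if x ∈ T then 0 else siteSign x T * M (insert x T) k := by
  rw [mul_apply]
  split_ifs with h
  · refine Finset.sum_eq_zero fun R _ => ?_
    rw [annih, of_apply, if_neg, zero_mul]
    rintro ⟨_, rfl⟩
    simp at h
  · rw [Finset.sum_eq_single (insert x T)]
    · rw [annih, of_apply, if_pos ⟨Finset.mem_insert_self _ _, by simp [h]⟩]
      change siteSign x _ * _ = _
      rw [siteSign_insert _ _ _ h, if_neg (lt_irrefl _)]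
    · intro R _ hR
      rw [annih, of_apply, if_neg, zero_mul]
      rintro ⟨hx, rfl⟩
      exact hR (Finset.insert_erase hx).symm
    · simp

lemma mul_annih_apply {κ : Type*} (x : V) (M : Matrix κ (Finset V) ℂ) (k : κ) (T : Finset V) :
    (M * annih x) k T = if x ∈ T then M k (T.erase x) * siteSign x T else 0 := by
  rw [mul_apply]
  split_ifs with h
  · rw [Finset.sum_eq_single (T.erase x)]
    · rw [annih, of_apply, if_pos ⟨h, rfl⟩]
      rfl
    · intro R _ hR
      rw [annih, of_apply, if_neg, mul_zero]
      rintro ⟨-, rfl⟩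
      exact hR rfl
    · simp
  · refine Finset.sum_eq_zero fun R _ => ?_
    rw [annih, of_apply, if_neg, mul_zero]
    exact fun h' => h h'.1

lemma conjTranspose_annih_mul_apply {κ : Type*} (x : V) (M : Matrix (Finset V) κ ℂ) (T : Finset V)
    (k : κ) : ((annih x)ᴴ * M) T k = if x ∈ T then siteSign x T * M (T.erase x) k else 0 := by
  have h := mul_annih_apply x Mᴴ k T
  rw [← conjTranspose_conjTranspose M, ← conjTranspose_mul, conjTranspose_apply, h]
  split_ifs
  · rw [star_mul', star_siteSign, mul_comm]
    rfl
  · simp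

lemma annih_anticomm {x y : V} (hxy : x ≠ y) : annih x * annih y = -(annih y * annih x) := by
  ext T R
  have hyx := hxy.symm
  rw [neg_apply, ← Matrix.mul_one (annih y), ← Matrix.mul_one (annih x * (annih y * 1)),
    ← Matrix.mul_one (annih y * 1 * annih x)]
  simp only [Matrix.mul_assoc, Matrix.one_mul, annih_mul_apply, Finset.mem_insert]
  by_cases h1 : x ∈ T <;> by_cases h2 : y ∈ T <;> simp only [h1, h2, hxy, hyx, or_true,
    if_true, if_false, mul_zero, neg_zero, or_self]
  rw [siteSign_insert _ _ _ h1, siteSign_insert _ _ _ h2, Finset.insert_comm]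
  rcases lt_or_gt_of_ne hxy with h | h
  · rw [if_pos h, if_neg h.not_gt]; ring
  · rw [if_neg h.not_gt, if_pos h]; ring

lemma annih_conjTranspose_anticomm {x y : V} (hxy : x ≠ y) :
    annih x * (annih y)ᴴ = -((annih y)ᴴ * annih x) := by
  ext T R
  have hyx := hxy.symm
  rw [neg_apply, ← Matrix.mul_one (annih x * (annih y)ᴴ), ← Matrix.mul_one ((annih y)ᴴ * annih x)]
  simp only [Matrix.mul_assoc, annih_mul_apply, conjTranspose_annih_mul_apply,
    Finset.mem_insert, Finset.mem_erase]
  by_cases h1 : x ∈ T <;> by_cases h2 : y ∈ T <;> simp only [h1, h2, hxy, hyx, or_true, or_false,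
    if_true, if_false, mul_zero, neg_zero, and_true, and_false, ne_eq, not_false_eq_true]
  rw [siteSign_insert _ _ _ h1, siteSign_erase _ _ _ h2, Finset.erase_insert_of_ne hxy]
  rcases lt_or_gt_of_ne hxy with h | h
  · rw [if_pos h, if_neg h.not_gt]; ring
  · rw [if_neg h.not_gt, if_pos h]; ring

lemma gen_anticomm {p q : V × Bool} (hpq : p.1 ≠ q.1) : gen p * gen q = -(gen q * gen p) := by
  obtain ⟨x, a⟩ := p
  obtain ⟨y, b⟩ := q
  simp only at hpq
  cases a <;> cases b <;> simp only [gen, if_true, if_false, Bool.false_eq_true]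
  · exact annih_anticomm hpq
  · exact annih_conjTranspose_anticomm hpq
  · rw [annih_conjTranspose_anticomm hpq.symm, neg_neg]
  · rw [← conjTranspose_mul, ← conjTranspose_mul, annih_anticomm hpq.symm, conjTranspose_neg]

/-- The operators that commute with all fermionic operators of the sites in `X`. -/
def siteCommutant (X : Finset V) : Subalgebra ℂ (Op V) :=
  Subalgebra.centralizer ℂ {M | ∃ p : V × Bool, p.1 ∈ X ∧ M = gen p}

lemma mem_siteCommutant {X : Finset V} {M : Op V} :
    M ∈ siteCommutant X ↔ ∀ p : V × Bool, p.1 ∈ X → gen p * M = M * gen p := by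
  rw [siteCommutant, Subalgebra.mem_centralizer_iff]
  exact ⟨fun h p hp => h _ ⟨p, hp, rfl⟩, by rintro h _ ⟨p, hp, rfl⟩; exact h p hp⟩

lemma gen_mul_word {X : Finset V} {p : V × Bool} (hp : p.1 ∉ X) : ∀ w : List (V × Bool),
    (∀ q ∈ w, q.1 ∈ X) → gen p * (w.map gen).prod = (-1 : ℂ) ^ w.length • ((w.map gen).prod * gen p)
  | [], _ => by simp
  | q :: w, hw => by
    have hq : p.1 ≠ q.1 := fun h => hp (h ▸ hw q (by simp))
    have ih := gen_mul_word hp w fun q hq => hw q (by simp [hq])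
    rw [List.map_cons, List.prod_cons, ← Matrix.mul_assoc, gen_anticomm hq, Matrix.neg_mul,
      Matrix.mul_assoc, ih, Matrix.mul_smul, List.length_cons, pow_succ, mul_neg_one, neg_smul,
      Matrix.mul_assoc]

lemma evenOps_le_siteCommutant {X Y : Finset V} (hXY : Disjoint X Y) {M : Op V}
    (hM : M ∈ evenOps X) : M ∈ siteCommutant Y := by
  rw [evenOps] at hM
  induction hM using Submodule.span_induction with
  | mem M h =>
    obtain ⟨w, hw, hwX, rfl⟩ := h
    rw [mem_siteCommutant]
    intro p hp
    rw [gen_mul_word (fun h => Finset.disjoint_left.1 hXY h hp) w hwX, hw.neg_one_pow, one_smul]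
  | zero => exact zero_mem _
  | add M N _ _ hM hN => exact add_mem hM hN
  | smul c M _ hM => exact Subalgebra.smul_mem _ hM c

lemma commute_of_mem_siteCommutant {X : Finset V} {M N : Op V} (hM : M ∈ siteCommutant X)
    (hN : N ∈ evenOps X) : Commute M N := by
  rw [evenOps] at hN
  induction hN using Submodule.span_induction with
  | mem N h =>
    obtain ⟨w, -, hwX, rfl⟩ := h
    refine Commute.list_prod_right _ _ fun N hN => ?_
    obtain ⟨p, hp, rfl⟩ := List.mem_map.1 hN
    exact (mem_siteCommutant.1 hM p (hwX p hp)).symm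
  | zero => exact Commute.zero_right _
  | add _ _ _ _ h1 h2 => exact h1.add_right h2
  | smul c _ _ h => exact h.smul_right c

lemma siteCommutant_mono {X Y : Finset V} (h : X ⊆ Y) : siteCommutant Y ≤ siteCommutant X :=
  fun _ hM => mem_siteCommutant.2 fun p hp => mem_siteCommutant.1 hM p (h hp)

lemma exp_mem_siteCommutant {X : Finset V} {M : Op V} (hM : M ∈ siteCommutant X) :
    NormedSpace.exp M ∈ siteCommutant X :=
  mem_siteCommutant.2 fun p hp => (Commute.exp_right (mem_siteCommutant.1 hM p hp)).eq

/-- Operators that commute with `f†_x` and `f_x` do not change the occupation of `x`. -/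
lemma apply_eq_zero_of_mem_siteCommutant {X : Finset V} {M : Op V} (hM : M ∈ siteCommutant X)
    {T R : Finset V} {x : V} (hx : x ∈ X) (h : ¬ (x ∈ T ↔ x ∈ R)) : M T R = 0 := by
  have h1 : annih x * M = M * annih x := mem_siteCommutant.1 hM (x, false) hx
  have h2 : (annih x)ᴴ * M = M * (annih x)ᴴ := mem_siteCommutant.1 hM (x, true) hx
  have h3 : (annih x)ᴴ * annih x * M = M * ((annih x)ᴴ * annih x) := by
    rw [Matrix.mul_assoc, h1, ← Matrix.mul_assoc, h2, Matrix.mul_assoc]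
  have h4 : ∀ T R : Finset V, ((annih x)ᴴ * annih x * M) T R = if x ∈ T then M T R else 0 := by
    intro T R
    rw [Matrix.mul_assoc, conjTranspose_annih_mul_apply, annih_mul_apply]
    split_ifs with h5 h6
    · simp at h6
    · rw [siteSign_erase _ _ _ h5, if_neg (lt_irrefl _), ← mul_assoc, siteSign_mul_self, one_mul,
        Finset.insert_erase h5]
    · rfl
  have h5 : (M * ((annih x)ᴴ * annih x)) T R = if x ∈ R then M T R else 0 := by
    have h6 := h4 R T
    have h7 : ((annih x)ᴴ * annih x) = diagonal fun T => if x ∈ T then (1 : ℂ) else 0 := by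
      ext T R
      have h8 : ((annih x)ᴴ * annih x) T R = if x ∈ T then (1 : Op V) T R else 0 := by
        have := (Matrix.mul_one ((annih x)ᴴ * annih x))
        rw [← this, Matrix.mul_assoc, conjTranspose_annih_mul_apply, annih_mul_apply]
        split_ifs with h5 h6
        · simp at h6
        · rw [siteSign_erase _ _ _ h5, if_neg (lt_irrefl _), ← mul_assoc, siteSign_mul_self, one_mul,
            Finset.insert_erase h5]
        · rfl
      rw [h8, diagonal_apply, one_apply]
      split_ifs <;> rfl
    rw [h7, mul_diagonal]
    split_ifs <;> simp
  have h6 := h4 T R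
  rw [h3, h5] at h6
  by_cases h7 : x ∈ T <;> by_cases h8 : x ∈ R
  · exact absurd (iff_of_true h7 h8) h
  · rw [if_neg h8, if_pos h7] at h6; exact h6.symm
  · rw [if_pos h8, if_neg h7] at h6; exact h6
  · exact absurd (iff_of_false h7 h8) h

lemma diag_insert_of_mem_siteCommutant {X : Finset V} {M : Op V} (hM : M ∈ siteCommutant X)
    {T : Finset V} {x : V} (hx : x ∈ X) : M (insert x T) (insert x T) = M T T := by
  by_cases hxT : x ∈ T
  · rw [Finset.insert_eq_of_mem hxT]
  have h1 : annih x * M = M * annih x := mem_siteCommutant.1 hM (x, false) hx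
  have h2 := congrFun (congrFun h1 T) (insert x T)
  rw [annih_mul_apply, mul_annih_apply, if_neg hxT, if_pos (Finset.mem_insert_self _ _),
    Finset.erase_insert hxT, siteSign_insert _ _ _ hxT, if_neg (lt_irrefl _), mul_comm] at h2
  have h3 : siteSign x T ≠ 0 := fun h => by simpa [h] using siteSign_mul_self x T
  exact mul_right_cancel₀ h3 h2

lemma diag_union_of_mem_siteCommutant {X : Finset V} {M : Op V} (hM : M ∈ siteCommutant X)
    (T R : Finset V) (hR : R ⊆ X) : M (R ∪ T) (R ∪ T) = M T T := by
  induction R using Finset.induction_on with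
  | empty => simp
  | insert x R _ ih =>
    rw [Finset.insert_union, diag_insert_of_mem_siteCommutant hM (hR (Finset.mem_insert_self _ _))]
    exact ih ((Finset.subset_insert _ _).trans hR)

lemma diag_congr_of_mem_siteCommutant {X : Finset V} {M : Op V} (hM : M ∈ siteCommutant X)
    {T R : Finset V} (h : T \ X = R \ X) : M T T = M R R := by
  have h1 : ∀ T : Finset V, M T T = M (T \ X) (T \ X) := fun T => by
    conv_lhs => rw [← Finset.sdiff_union_inter T X, Finset.union_comm]
    exact diag_union_of_mem_siteCommutant hM _ _ Finset.inter_subset_right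
  rw [h1 T, h1 R, h]

/-- The trace factorizes for operators that live on complementary sets of sites. -/
theorem trace_mul_mul_card {X : Finset V} {M N : Op V} (hM : M ∈ siteCommutant X)
    (hN : N ∈ siteCommutant Xᶜ) :
    trace (M * N) * (Fintype.card (Finset V) : ℂ) = trace M * trace N := by
  have h1 : trace (M * N) = ∑ T, M T T * N T T := by
    refine Finset.sum_congr rfl fun T _ => ?_
    rw [diag_apply, mul_apply]
    refine Finset.sum_eq_single T (fun R _ hR => ?_) (by simp)
    obtain ⟨x, hx⟩ : ∃ x, ¬ (x ∈ T ↔ x ∈ R) := by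
      by_contra! h
      exact hR (Finset.ext fun x => (h x).symm)
    by_cases hxX : x ∈ X
    · rw [apply_eq_zero_of_mem_siteCommutant hM hxX hx, zero_mul]
    · rw [apply_eq_zero_of_mem_siteCommutant hN (by simpa using hxX) fun h => hx h.symm, mul_zero]
  -- Exchanging the parts in `X` of two configurations is an involution.
  let σ : Finset V × Finset V → Finset V × Finset V := fun p =>
    ((p.1 \ X) ∪ (p.2 ∩ X), (p.2 \ X) ∪ (p.1 ∩ X))
  have hσ : Function.Involutive σ := by
    rintro ⟨T, R⟩
    simp only [σ, Prod.mk.injEq]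
    constructor <;> ext a <;> simp only [Finset.mem_union, Finset.mem_sdiff, Finset.mem_inter] <;>
      tauto
  have h2 : ∑ p : Finset V × Finset V, M p.1 p.1 * N p.2 p.2 =
      ∑ p : Finset V × Finset V, M p.1 p.1 * N p.1 p.1 := by
    rw [← Equiv.sum_comp hσ.toPerm fun p => M p.1 p.1 * N p.1 p.1]
    refine Finset.sum_congr rfl fun p _ => ?_
    simp only [Function.Involutive.coe_toPerm, σ]
    congr 1
    · refine diag_congr_of_mem_siteCommutant hM ?_
      ext a
      simp only [Finset.mem_union, Finset.mem_sdiff, Finset.mem_inter]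
      tauto
    · refine diag_congr_of_mem_siteCommutant hN ?_
      ext a
      simp only [Finset.mem_union, Finset.mem_sdiff, Finset.mem_inter, Finset.mem_compl]
      tauto
  rw [h1, trace, trace, Finset.sum_mul_sum, ← Finset.sum_product', Finset.univ_product_univ]
  simp only [diag_apply]
  rw [h2, Fintype.sum_prod_type, Finset.sum_mul]
  exact Finset.sum_congr rfl fun T _ => by simp [mul_comm]

end CAR

/-! ### Parity and partial trace -/

section PartialTrace

set_option linter.unusedSectionVars false

open Matrix

variable {V : Type*} [Fintype V] [LinearOrder V]

/-- The fermion parity `(-1)^N`. -/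
def parity (V : Type*) [Fintype V] [LinearOrder V] : Op V :=
  diagonal fun T : Finset V => (-1 : ℂ) ^ T.card

lemma parity_mul_self : parity V * parity V = 1 := by
  rw [parity, diagonal_mul_diagonal, ← diagonal_one]
  congr 1
  funext T
  rw [← mul_pow]
  simp

lemma parity_conjTranspose : (parity V)ᴴ = parity V := by
  rw [parity, diagonal_conjTranspose]
  congr 1
  funext T
  simp

lemma parity_mul_annih (x : V) : parity V * annih x = -(annih x * parity V) := by
  ext T R
  rw [neg_apply, parity, diagonal_mul, mul_diagonal, annih, of_apply]
  split_ifs with h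
  · obtain ⟨hx, rfl⟩ := h
    have := Finset.card_erase_add_one hx
    rw [← this, pow_succ]
    ring
  · simp

lemma parity_mul_gen (p : V × Bool) : parity V * gen p = -(gen p * parity V) := by
  obtain ⟨x, a⟩ := p
  cases a <;> simp only [gen, if_true, if_false, Bool.false_eq_true]
  · exact parity_mul_annih x
  · have h := congrArg conjTranspose (parity_mul_annih x)
    rw [conjTranspose_mul, conjTranspose_neg, conjTranspose_mul, parity_conjTranspose] at h
    rw [h, neg_neg]

lemma commute_parity_of_mem_evenOps {X : Finset V} {M : Op V} (hM : M ∈ evenOps X) :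
    Commute (parity V) M := by
  have hword : ∀ w : List (V × Bool), parity V * (w.map gen).prod =
      (-1 : ℂ) ^ w.length • ((w.map gen).prod * parity V) := by
    intro w
    induction w with
    | nil => simp
    | cons q w ih =>
      rw [List.map_cons, List.prod_cons, ← Matrix.mul_assoc, parity_mul_gen, Matrix.neg_mul,
        Matrix.mul_assoc, ih, Matrix.mul_smul, List.length_cons, pow_succ, mul_neg_one, neg_smul,
        Matrix.mul_assoc]
  rw [evenOps] at hM
  induction hM using Submodule.span_induction with
  | mem M h =>
    obtain ⟨w, hw, -, rfl⟩ := h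
    rw [commute_iff_eq, hword, hw.neg_one_pow, one_smul]
  | zero => exact Commute.zero_right _
  | add _ _ _ _ h1 h2 => exact h1.add_right h2
  | smul c _ _ h => exact h.smul_right c

/-- The operator from the Fock space over `S` to that over `V` which sends `f†_T |vac⟩`
to `f†_T f†_R |vac⟩`. -/
def fill (S R : Finset V) : Matrix (Finset V) (Finset S) ℂ :=
  of fun T t => if T = t.map (Function.Embedding.subtype _) ∪ R
    then mergeSign (t.map (Function.Embedding.subtype _)) R else 0

/-- The operator `O` on the Fock space over `S` as an operator on that over `V`. -/
def extend (S : Finset V) (O : Op S) : Op V :=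
  ∑ R ∈ Sᶜ.powerset, fill S R * O * (fill S R)ᴴ

variable {S : Finset V}

lemma mergeSign_mul_self (T R : Finset V) : mergeSign T R * mergeSign T R = 1 := by
  rw [mergeSign, ← mul_pow]
  simp

lemma star_mergeSign (T R : Finset V) : star (mergeSign T R) = mergeSign T R := by
  simp [mergeSign]

lemma fill_mul_apply {κ : Type*} [Fintype κ] (R : Finset V) (M : Matrix κ (Finset V) ℂ) (k : κ)
    (t : Finset S) : (M * fill S R) k t =
      M k (t.map (Function.Embedding.subtype _) ∪ R) *
        mergeSign (t.map (Function.Embedding.subtype _)) R := by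
  rw [mul_apply, Finset.sum_eq_single (t.map (Function.Embedding.subtype _) ∪ R)]
  · simp [fill]
  · intro T _ hT
    simp [fill, hT]
  · simp

lemma conjTranspose_fill_mul_apply {κ : Type*} [Fintype κ] (R : Finset V)
    (M : Matrix (Finset V) κ ℂ) (t : Finset S) (k : κ) : ((fill S R)ᴴ * M) t k =
      mergeSign (t.map (Function.Embedding.subtype _)) R *
        M (t.map (Function.Embedding.subtype _) ∪ R) k := by
  have h := fill_mul_apply R Mᴴ k t
  rw [← conjTranspose_conjTranspose M, ← conjTranspose_mul, conjTranspose_apply, h]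
  rw [star_mul', star_mergeSign, mul_comm]
  rfl

/-- The partial trace is a sum over the configurations outside `S`. -/
lemma reduce_eq_sum (ρ : Op V) :
    reduce S ρ = ∑ R ∈ Sᶜ.powerset, (fill S R)ᴴ * ρ * fill S R := by
  ext t t'
  rw [Matrix.sum_apply, reduce, of_apply]
  refine Finset.sum_congr rfl fun R _ => ?_
  rw [fill_mul_apply, conjTranspose_fill_mul_apply]
  ring

lemma trace_mul_reduce (O : Op S) (ρ : Op V) :
    trace (O * reduce S ρ) = trace (extend S O * ρ) := by
  rw [reduce_eq_sum, extend, Finset.mul_sum, Finset.sum_mul, trace_sum, trace_sum]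
  refine Finset.sum_congr rfl fun R _ => ?_
  rw [← Matrix.mul_assoc, trace_mul_comm, ← Matrix.mul_assoc, ← Matrix.mul_assoc]

lemma map_union_inj {t t' : Finset S} {R R' : Finset V} (hR : R ⊆ Sᶜ) (hR' : R' ⊆ Sᶜ)
    (h : t.map (Function.Embedding.subtype _) ∪ R = t'.map (Function.Embedding.subtype _) ∪ R') :
    t = t' ∧ R = R' := by
  have h1 : ∀ x : V, x ∈ S → ∀ (t : Finset S) (R : Finset V), R ⊆ Sᶜ →
      (x ∈ t.map (Function.Embedding.subtype _) ∪ R ↔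
        x ∈ t.map (Function.Embedding.subtype _)) := by
    intro x hx t R hR
    have : x ∉ R := fun h => by simpa [hx] using hR h
    simp [this]
  have h2 : ∀ x : V, x ∉ S → ∀ (t : Finset S) (R : Finset V),
      (x ∈ t.map (Function.Embedding.subtype _) ∪ R ↔ x ∈ R) := by
    intro x hx t R
    simp [hx]
  constructor
  · rw [← Finset.map_inj (f := Function.Embedding.subtype (· ∈ S))]
    ext x
    by_cases hx : x ∈ S
    · rw [← h1 x hx t R hR, ← h1 x hx t' R' hR', h]
    · simp [hx]
  · ext x
    by_cases hx : x ∈ S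
    · exact iff_of_false (fun h => by simpa [hx] using hR h) (fun h => by simpa [hx] using hR' h)
    · rw [← h2 x hx t R, ← h2 x hx t' R', h]

lemma conjTranspose_fill_mul_fill {R R' : Finset V} (hR : R ⊆ Sᶜ) (hR' : R' ⊆ Sᶜ) :
    (fill S R)ᴴ * fill S R' = if R = R' then 1 else 0 := by
  ext t t'
  rw [conjTranspose_fill_mul_apply, fill, of_apply]
  by_cases h : t.map (Function.Embedding.subtype _) ∪ R =
      t'.map (Function.Embedding.subtype _) ∪ R'
  · obtain ⟨rfl, rfl⟩ := map_union_inj hR hR' h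
    simp [mergeSign_mul_self]
  · rw [if_neg h, mul_zero]
    split_ifs with h1
    · subst h1
      have : t ≠ t' := fun h' => h (by rw [h'])
      simp [this]
    · rfl

lemma extend_mul (O O' : Op S) : extend S (O * O') = extend S O * extend S O' := by
  rw [extend, extend, extend, Finset.sum_mul_sum]
  refine Finset.sum_congr rfl fun R hR => ?_
  rw [Finset.sum_eq_single R]
  · have h := conjTranspose_fill_mul_fill (Finset.mem_powerset.1 hR) (Finset.mem_powerset.1 hR)
    rw [if_pos rfl] at h
    calc _ = fill S R * O * ((fill S R)ᴴ * fill S R) * O' * (fill S R)ᴴ := by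
            rw [h, Matrix.mul_one]; simp only [Matrix.mul_assoc]
      _ = _ := by simp only [Matrix.mul_assoc]
  · intro R' hR' hne
    have h := conjTranspose_fill_mul_fill (Finset.mem_powerset.1 hR) (Finset.mem_powerset.1 hR')
    rw [if_neg hne.symm] at h
    calc _ = fill S R * O * ((fill S R)ᴴ * fill S R') * O' * (fill S R')ᴴ := by
            simp only [Matrix.mul_assoc]
      _ = 0 := by rw [h]; simp
  · exact fun h => absurd hR h

lemma extend_conjTranspose (O : Op S) : extend S Oᴴ = (extend S O)ᴴ := by
  rw [extend, extend, conjTranspose_sum]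
  refine Finset.sum_congr rfl fun R _ => ?_
  simp [conjTranspose_mul, Matrix.mul_assoc]

/-- The extension as a homomorphism of C*-algebras. -/
def extendHom (S : Finset V) : Op S →⋆ₙₐ[ℂ] Op V where
  toFun := extend S
  map_smul' c O := by
    simp [extend, Finset.smul_sum]
  map_zero' := by simp [extend]
  map_add' O O' := by
    simp [extend, Matrix.mul_add, Matrix.add_mul, Finset.sum_add_distrib]
  map_mul' := extend_mul
  map_star' O := by
    rw [star_eq_conjTranspose, star_eq_conjTranspose, extend_conjTranspose]

lemma norm_extend_le (O : Op S) : ‖extend S O‖ ≤ ‖O‖ := by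
  exact NonUnitalStarAlgHom.norm_apply_le (extendHom S) O

lemma sum_fill_mul_conjTranspose : ∑ R ∈ Sᶜ.powerset, fill S R * (fill S R)ᴴ = 1 := by
  ext T T'
  have hdec : ∀ T : Finset V, (T.subtype (· ∈ S)).map (Function.Embedding.subtype _) ∪ (T \ S) = T := by
    intro T
    rw [Finset.subtype_map]
    ext a
    simp only [Finset.mem_union, Finset.mem_filter, Finset.mem_sdiff]
    tauto
  have hmem : T \ S ∈ Sᶜ.powerset := by
    rw [Finset.mem_powerset]
    intro a ha
    simpa using (Finset.mem_sdiff.1 ha).2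
  rw [Matrix.sum_apply]
  simp only [mul_apply, conjTranspose_apply]
  have hne : ∀ R ∈ Sᶜ.powerset, ∀ t : Finset S,
      T = t.map (Function.Embedding.subtype _) ∪ R → t = T.subtype (· ∈ S) ∧ R = T \ S := by
    intro R hR t h
    exact map_union_inj (Finset.mem_powerset.1 hR) (Finset.mem_powerset.1 hmem)
      (h.symm.trans (hdec T).symm)
  rw [Finset.sum_eq_single (T \ S), Finset.sum_eq_single (T.subtype (· ∈ S))]
  · rw [fill, of_apply, of_apply, hdec, if_pos rfl, one_apply]
    by_cases h : T' = T
    · rw [if_pos h, if_pos h.symm, star_mergeSign, mergeSign_mul_self]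
    · rw [if_neg h, if_neg (Ne.symm h), star_zero, mul_zero]
  · intro t _ ht
    rw [fill, of_apply, if_neg fun h => ht (hne _ hmem t h).1, zero_mul]
  · simp
  · intro R hR hRne
    refine Finset.sum_eq_zero fun t _ => ?_
    rw [fill, of_apply, if_neg fun h => hRne (hne R hR t h).2, zero_mul]
  · exact fun h => absurd hmem h

lemma siteSign_union {x : V} {T R : Finset V} (h : Disjoint T R) :
    siteSign x (T ∪ R) = siteSign x T * siteSign x R := by
  rw [siteSign, siteSign, siteSign, Finset.filter_union,
    Finset.card_union_of_disjoint (Finset.disjoint_filter_filter h), pow_add]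

lemma mergeSign_erase {x : V} {T R : Finset V} (hx : x ∈ R) :
    mergeSign T R = mergeSign T (R.erase x) * (-1) ^ (T.filter (x < ·)).card := by
  rw [mergeSign, mergeSign, ← pow_add]
  congr 1
  have h : (T ×ˢ R).filter (fun p => p.2 < p.1) = (T ×ˢ R.erase x).filter (fun p => p.2 < p.1) ∪
      (T.filter (x < ·)).image (fun a => (a, x)) := by
    ext ⟨a, r⟩
    simp only [Finset.mem_filter, Finset.mem_product, Finset.mem_union, Finset.mem_image,
      Finset.mem_erase, Prod.mk.injEq]
    constructor
    · rintro ⟨⟨h1, h2⟩, h3⟩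
      by_cases h4 : r = x
      · exact Or.inr ⟨a, ⟨h1, h4 ▸ h3⟩, rfl, h4.symm⟩
      · exact Or.inl ⟨⟨h1, h4, h2⟩, h3⟩
    · rintro (⟨⟨h1, -, h2⟩, h3⟩ | ⟨a', ⟨h1, h2⟩, rfl, rfl⟩)
      · exact ⟨⟨h1, h2⟩, h3⟩
      · exact ⟨⟨h1, hx⟩, h2⟩
  rw [h, Finset.card_union_of_disjoint, Finset.card_image_of_injective _
    fun a b h => congrArg Prod.fst h]
  rw [Finset.disjoint_right]
  intro p hp hp'
  obtain ⟨a, -, rfl⟩ := Finset.mem_image.1 hp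
  simp at hp'

lemma siteSign_mul_card_filter {x : V} {T : Finset V} (hx : x ∉ T) :
    siteSign x T * (-1) ^ (T.filter (x < ·)).card = (-1) ^ T.card := by
  rw [siteSign, ← pow_add]
  congr 1
  rw [← Finset.card_filter_add_card_filter_not (s := T) (· < x)]
  congr 2
  refine Finset.filter_congr fun y hy => ?_
  have : y ≠ x := fun h => hx (h ▸ hy)
  rw [not_lt]
  exact ⟨le_of_lt, fun h => lt_of_le_of_ne h this.symm⟩

/-- An annihilation operator outside `S` passes the operators `f†_t` up to the parity. -/
lemma annih_mul_fill {x : V} (hx : x ∉ S) (R : Finset V) (hR : R ⊆ Sᶜ) :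
    annih x * fill S R =
      if x ∈ R then siteSign x R • (fill S (R.erase x) * parity S) else 0 := by
  ext T t
  have hxt : x ∉ t.map (Function.Embedding.subtype (· ∈ S)) := by simp [hx]
  set u := t.map (Function.Embedding.subtype (· ∈ S)) with hu
  have hcard : u.card = t.card := Finset.card_map _
  rw [annih_mul_apply]
  by_cases hxR : x ∈ R
  · rw [if_pos hxR, Matrix.smul_apply, parity, mul_diagonal, fill, fill, of_apply, of_apply, ← hu]
    by_cases hT : T = u ∪ R.erase x
    · have h1 : x ∉ T := by simp [hT, hxt]
      have h2 : insert x T = u ∪ R := by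
        rw [hT, ← Finset.union_insert, Finset.insert_erase hxR]
      have hdisj : Disjoint u (R.erase x) := by
        rw [Finset.disjoint_left]
        intro a ha ha'
        have h3 := hR (Finset.mem_of_mem_erase ha')
        rw [Finset.mem_compl] at h3
        obtain ⟨y, -, rfl⟩ := Finset.mem_map.1 ha
        exact h3 y.2
      rw [if_neg h1, if_pos h2, if_pos hT, hT, siteSign_union hdisj, mergeSign_erase hxR,
        siteSign_erase _ _ _ hxR, if_neg (lt_irrefl _), ← hcard, ← siteSign_mul_card_filter hxt]
      rw [smul_eq_mul]
      ring
    · rw [if_neg hT, zero_mul, smul_zero]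
      split_ifs with h1 h2
      · rfl
      · exfalso
        apply hT
        have h3 : (insert x T).erase x = (u ∪ R).erase x := by rw [h2]
        rwa [Finset.erase_insert h1, Finset.erase_union_distrib, Finset.erase_eq_of_notMem hxt] at h3
      · rw [mul_zero]
  · rw [if_neg hxR, Matrix.zero_apply, fill, of_apply, ← hu]
    split_ifs with h1 h2
    · rfl
    · exfalso
      have h3 : x ∈ u ∪ R := h2 ▸ Finset.mem_insert_self _ _
      rcases Finset.mem_union.1 h3 with h4 | h4
      exacts [hxt h4, hxR h4]
    · rw [mul_zero]

lemma commute_annih_extend {x : V} (hx : x ∉ S) {O : Op S} (hO : Commute (parity S) O) :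
    Commute (annih x) (extend S O) := by
  have h1 : annih x * extend S O = ∑ R ∈ Sᶜ.powerset,
      if x ∈ R then siteSign x R • (fill S (R.erase x) * O * parity S * (fill S R)ᴴ) else 0 := by
    rw [extend, Finset.mul_sum]
    refine Finset.sum_congr rfl fun R hR => ?_
    rw [← Matrix.mul_assoc, ← Matrix.mul_assoc, annih_mul_fill hx R (Finset.mem_powerset.1 hR)]
    split_ifs
    · rw [Matrix.smul_mul, Matrix.smul_mul, Matrix.mul_assoc (fill S (R.erase x)), hO.eq,
        ← Matrix.mul_assoc (fill S (R.erase x))]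
    · simp
  have h2 : annih x = ∑ R ∈ Sᶜ.powerset,
      if x ∈ R then siteSign x R • (fill S (R.erase x) * parity S * (fill S R)ᴴ) else 0 := by
    rw [← Matrix.mul_one (annih x), ← sum_fill_mul_conjTranspose (S := S), Finset.mul_sum]
    refine Finset.sum_congr rfl fun R hR => ?_
    rw [← Matrix.mul_assoc, annih_mul_fill hx R (Finset.mem_powerset.1 hR)]
    split_ifs
    · rw [Matrix.smul_mul]
    · simp
  have h3 : extend S O * annih x = ∑ R ∈ Sᶜ.powerset,
      if x ∈ R then siteSign x R • (fill S (R.erase x) * O * parity S * (fill S R)ᴴ) else 0 := by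
    rw [h2, Finset.mul_sum]
    refine Finset.sum_congr rfl fun R hR => ?_
    split_ifs with hxR
    · have hR' : R.erase x ∈ Sᶜ.powerset :=
        Finset.mem_powerset.2 ((Finset.erase_subset _ _).trans (Finset.mem_powerset.1 hR))
      rw [Matrix.mul_smul, extend, Finset.sum_mul, Finset.sum_eq_single (R.erase x)]
      · have h := conjTranspose_fill_mul_fill (Finset.mem_powerset.1 hR') (Finset.mem_powerset.1 hR')
        rw [if_pos rfl] at h
        congr 1
        calc _ = fill S (R.erase x) * O * ((fill S (R.erase x))ᴴ * fill S (R.erase x)) *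
              parity S * (fill S R)ᴴ := by simp only [Matrix.mul_assoc]
          _ = _ := by rw [h, Matrix.mul_one]
      · intro R' hR'' hne
        have h := conjTranspose_fill_mul_fill (Finset.mem_powerset.1 hR'')
          (Finset.mem_powerset.1 hR')
        rw [if_neg hne] at h
        calc _ = fill S R' * O * ((fill S R')ᴴ * fill S (R.erase x)) *
              parity S * (fill S R)ᴴ := by simp only [Matrix.mul_assoc]
          _ = _ := by rw [h]; simp
      · exact fun h => absurd hR' h
    · rw [Matrix.mul_zero]
  exact h1.trans h3.symm

/-- Even operators on the Fock space over `S` commute with the fermionic operators outside `S`. -/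
lemma extend_mem_siteCommutant {O : Op S} (hO : Commute (parity S) O) :
    extend S O ∈ siteCommutant Sᶜ := by
  rw [mem_siteCommutant]
  rintro ⟨x, a⟩ hx
  have hx' : x ∉ S := by simpa using hx
  cases a <;> simp only [gen, if_true, if_false, Bool.false_eq_true]
  · exact commute_annih_extend hx' hO
  · have hO' : Commute (parity S) Oᴴ := by
      have h := congrArg conjTranspose hO.eq
      rw [conjTranspose_mul, conjTranspose_mul, parity_conjTranspose] at h
      exact h.symm
    have h := congrArg conjTranspose (commute_annih_extend hx' hO').eq
    rw [conjTranspose_mul, conjTranspose_mul, extend_conjTranspose, conjTranspose_conjTranspose] at h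
    exact h.symm

lemma parity_mul_fill (R : Finset V) (hR : R ⊆ Sᶜ) :
    parity V * fill S R = (-1 : ℂ) ^ R.card • (fill S R * parity S) := by
  ext T t
  rw [Matrix.smul_apply, parity, parity, diagonal_mul, mul_diagonal, fill, of_apply]
  split_ifs with h
  · have hdisj : Disjoint (t.map (Function.Embedding.subtype (· ∈ S))) R := by
      rw [Finset.disjoint_left]
      intro a ha ha'
      have h3 := hR ha'
      rw [Finset.mem_compl] at h3
      obtain ⟨y, -, rfl⟩ := Finset.mem_map.1 ha
      exact h3 y.2
    rw [h, Finset.card_union_of_disjoint hdisj, Finset.card_map, pow_add, smul_eq_mul]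
    ring
  · simp

/-- The reduction of an even state is even. -/
lemma commute_parity_reduce {ρ : Op V} (hρ : Commute (parity V) ρ) :
    Commute (parity S) (reduce S ρ) := by
  rw [reduce_eq_sum]
  refine Commute.sum_right _ _ _ fun R hR => ?_
  have h1 := parity_mul_fill R (Finset.mem_powerset.1 hR)
  have h2 : fill S R * parity S = (-1 : ℂ) ^ R.card • (parity V * fill S R) := by
    rw [h1, smul_smul, ← mul_pow]
    simp
  have h3 : parity S * (fill S R)ᴴ = (-1 : ℂ) ^ R.card • ((fill S R)ᴴ * parity V) := by
    have h := congrArg conjTranspose h2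
    rw [conjTranspose_mul, conjTranspose_smul, conjTranspose_mul, parity_conjTranspose,
      parity_conjTranspose] at h
    simpa using h
  rw [commute_iff_eq, Matrix.mul_assoc _ _ (parity S), h2, ← Matrix.mul_assoc, ← Matrix.mul_assoc,
    h3, Matrix.smul_mul, Matrix.smul_mul, Matrix.mul_smul, Matrix.mul_assoc _ (parity V), hρ.eq]
  simp only [Matrix.mul_assoc]

end PartialTrace

/-! ### The trace norm -/

section TraceNorm

open Matrix
open scoped ComplexOrder

variable {n : Type*} [Fintype n] [DecidableEq n]

/-- The trace norm is attained by a contraction. -/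
lemma exists_traceNorm_eq (M : Matrix n n ℂ) :
    ∃ O : Matrix n n ℂ, ‖O‖ ≤ 1 ∧ (traceNorm M : ℂ) = trace (O * M) := by
  set hA := isHermitian_conjTranspose_mul_self M with hA'
  set U : Matrix n n ℂ := (hA.eigenvectorUnitary : Matrix n n ℂ) with hU
  set ev := hA.eigenvalues with hev
  have hev0 : ∀ i, 0 ≤ ev i := (posSemidef_conjTranspose_mul_self M).eigenvalues_nonneg
  have hUU : star U * U = 1 := Unitary.coe_star_mul_self hA.eigenvectorUnitary
  have hspec : Mᴴ * M = U * diagonal (fun i => (ev i : ℂ)) * star U := by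
    have h := hA.spectral_theorem
    rw [Unitary.conjStarAlgAut_apply] at h
    exact h
  set s : n → ℂ := fun i => ((√(ev i))⁻¹ : ℝ) with hs
  have hstar : star s = s := by
    funext i
    simp [hs]
  -- The witness is `(MᴴM)^{-1/2} Mᴴ`, with the inverse taken on the complement of the kernel: the
  -- convention `0⁻¹ = 0` removes the kernel.
  refine ⟨U * diagonal s * star U * Mᴴ, ?_, ?_⟩
  · have h1 : (U * diagonal s * star U * Mᴴ) * star (U * diagonal s * star U * Mᴴ) =
        U * diagonal (fun i => s i * ev i * s i) * star U := by
      have h2 : star (U * diagonal s * star U * Mᴴ) = M * (U * diagonal s * star U) := by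
        simp only [star_eq_conjTranspose, conjTranspose_mul, conjTranspose_conjTranspose,
          diagonal_conjTranspose, hstar, Matrix.mul_assoc]
      calc _ = U * diagonal s * star U * (Mᴴ * M) * (U * diagonal s * star U) := by
            rw [h2]; simp only [Matrix.mul_assoc]
        _ = U * diagonal s * (star U * U) * diagonal (fun i => (ev i : ℂ)) * (star U * U) *
            diagonal s * star U := by rw [hspec]; simp only [Matrix.mul_assoc]
        _ = _ := by
            rw [hUU, Matrix.mul_one, Matrix.mul_one, Matrix.mul_assoc U, Matrix.mul_assoc U,
              diagonal_mul_diagonal, diagonal_mul_diagonal]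
    have h3 : ‖U * diagonal (fun i => s i * ev i * s i) * star U‖ ≤ 1 := by
      rw [CStarRing.norm_mul_mem_unitary _ (Unitary.star_mem hA.eigenvectorUnitary.2),
        CStarRing.norm_mem_unitary_mul _ hA.eigenvectorUnitary.2, l2_opNorm_diagonal]
      refine (pi_norm_le_iff_of_nonneg zero_le_one).2 fun i => ?_
      simp only [hs, norm_mul, Complex.norm_real, norm_inv]
      rw [Real.norm_of_nonneg (Real.sqrt_nonneg _), Real.norm_of_nonneg (hev0 i)]
      rcases (hev0 i).eq_or_lt with h | h
      · simp [← h]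
      · have h4 : 0 < √(ev i) := Real.sqrt_pos.2 h
        have h5 := Real.mul_self_sqrt (hev0 i)
        refine le_of_eq ?_
        field_simp
        linarith [h5, sq (√(ev i))]
    rw [← h1, CStarRing.norm_self_mul_star] at h3
    nlinarith [norm_nonneg (U * diagonal s * star U * Mᴴ)]
  · have h1 : trace (U * diagonal s * star U * Mᴴ * M) = trace (diagonal fun i => s i * ev i) := by
      calc _ = trace (U * (diagonal s * (star U * U) * diagonal (fun i => (ev i : ℂ)) * star U)) := by
            rw [Matrix.mul_assoc _ Mᴴ, hspec]; simp only [Matrix.mul_assoc]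
        _ = trace (diagonal s * (star U * U) * diagonal (fun i => (ev i : ℂ)) * (star U * U)) := by
            rw [trace_mul_comm]; simp only [Matrix.mul_assoc]
        _ = _ := by rw [hUU, Matrix.mul_one, Matrix.mul_one, diagonal_mul_diagonal]
    rw [h1, trace_diagonal, traceNorm]
    push_cast
    refine Finset.sum_congr rfl fun i _ => ?_
    simp only [hs]
    rw [← Complex.ofReal_mul]
    congr 1
    change √(ev i) = _
    rcases (hev0 i).eq_or_lt with h | h
    · simp [← h]
    · have h4 : √(ev i) ≠ 0 := (Real.sqrt_pos.2 h).ne'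
      rw [eq_inv_mul_iff_mul_eq₀ h4, Real.mul_self_sqrt (hev0 i)]

end TraceNorm

/-! ### Factorization of thermal states -/

section Factorization

set_option linter.unusedSectionVars false

open Matrix

variable {V : Type*} [Fintype V] [LinearOrder V] {ι : Type*} [Fintype ι]
  {Y : ι → Op V} {supp : ι → Finset V}

lemma evenOps_mono {X X' : Finset V} (h : X ⊆ X') : evenOps X ≤ evenOps X' :=
  Submodule.span_mono fun _ ⟨w, hw, hX, hM⟩ => ⟨w, hw, fun p hp => h (hX p hp), hM⟩

/-- Two edges are adjacent if they overlap. -/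
def Overlap (supp : ι → Finset V) (e f : ι) : Prop := (supp e ∩ supp f).Nonempty

/-- The edge `e` meets the set of sites `S`. -/
def Touches (supp : ι → Finset V) (S : Finset V) (e : ι) : Prop := (supp e ∩ S).Nonempty

lemma ofReal_partitionFn (hY : ∀ e, (Y e).IsHermitian) (t : ι → ℝ) :
    (partitionFn Y t : ℂ) = trace (gibbsExp Y t) :=
  Complex.ext rfl (trace_exp_im (isHermitian_linHam hY t)).symm

/-- A set of edges that is decoupled from the other edges factors out of the thermal state. -/
theorem factorizes_expectFn (hY : ∀ e, (Y e).IsHermitian) (hYe : ∀ e, Y e ∈ evenOps (supp e))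
    {S : Finset V} {A : Op V} (hA : A ∈ siteCommutant Sᶜ) :
    Factorizes (Overlap supp) (Touches supp S) (Fintype.card (Finset V) : ℝ) (partitionFn Y)
      (expectFn Y A) := by
  classical
  intro K hK t ht
  set X := K.biUnion supp with hX
  have hsum : linHam Y t = linHam Y (zeroOn K t) + linHam Y (zeroOn Kᶜ t) := by
    rw [linHam, linHam, linHam, ← Finset.sum_add_distrib]
    refine Finset.sum_congr rfl fun e _ => ?_
    simp only [zeroOn, Finset.mem_compl]
    split_ifs <;> simp_all
  have hsmul : ∀ (W : Submodule ℂ (Op V)) (r : ℝ) (M : Op V), M ∈ W → r • M ∈ W := by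
    intro W r M hM
    rw [← Complex.coe_smul]
    exact W.smul_mem _ hM
  have hon : linHam Y (zeroOn Kᶜ t) ∈ evenOps X := by
    refine Submodule.sum_mem _ fun e _ => ?_
    by_cases he : e ∈ K
    · exact hsmul _ _ _ (evenOps_mono (Finset.subset_biUnion_of_mem supp he) (hYe e))
    · simp [zeroOn, he]
  have hoff : linHam Y (zeroOn K t) ∈ siteCommutant X := by
    refine sum_mem fun e _ => ?_
    by_cases he : zeroOn K t e = 0
    · rw [he, zero_smul]
      exact zero_mem _
    have heK : e ∉ K := fun h => he (by simp [zeroOn, h])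
    have hte : t e ≠ 0 := fun h => he (by simp [zeroOn, h])
    refine hsmul (Subalgebra.toSubmodule (siteCommutant X)) _ _
      (evenOps_le_siteCommutant ?_ (hYe e))
    rw [hX, Finset.disjoint_biUnion_right]
    intro k hk
    rw [Finset.disjoint_iff_inter_eq_empty, ← Finset.not_nonempty_iff_eq_empty, Finset.inter_comm]
    exact fun h => hte (ht e (mem_nbhd.2 ⟨heK, k, hk, h⟩))
  have hXS : X ⊆ Sᶜ := by
    intro x hx
    obtain ⟨k, hk, hxk⟩ := Finset.mem_biUnion.1 hx
    exact Finset.mem_compl.2 fun hxS => hK k hk ⟨x, Finset.mem_inter.2 ⟨hxk, hxS⟩⟩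
  have hcomm : Commute (linHam Y (zeroOn K t)) (linHam Y (zeroOn Kᶜ t)) :=
    commute_of_mem_siteCommutant hoff hon
  have hM : A * gibbsExp Y (zeroOn K t) ∈ siteCommutant X :=
    mul_mem (siteCommutant_mono hXS hA) (exp_mem_siteCommutant hoff)
  have hN : gibbsExp Y (zeroOn Kᶜ t) ∈ siteCommutant Xᶜ :=
    exp_mem_siteCommutant (evenOps_le_siteCommutant disjoint_compl_right hon)
  have key := trace_mul_mul_card hM hN
  have hexp : gibbsExp Y t = gibbsExp Y (zeroOn K t) * gibbsExp Y (zeroOn Kᶜ t) := by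
    rw [gibbsExp, hsum, exp_add_of_commute _ _ hcomm]
    rfl
  rw [expectFn, expectFn, hexp, ← Matrix.mul_assoc, ← Complex.coe_smul, ← Complex.coe_smul,
    smul_eq_mul, smul_eq_mul, ofReal_partitionFn hY, mul_comm, Complex.ofReal_natCast, key, mul_comm]

lemma factorizes_partitionFn (hY : ∀ e, (Y e).IsHermitian) (hYe : ∀ e, Y e ∈ evenOps (supp e))
    (S : Finset V) : Factorizes (Overlap supp) (Touches supp S) (Fintype.card (Finset V) : ℝ)
      (partitionFn Y) (partitionFn Y) := by
  intro K hK t ht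
  have h := factorizes_expectFn hY hYe (S := S) (one_mem (siteCommutant Sᶜ)) K hK t ht
  simp only [expectFn, one_mul, ← ofReal_partitionFn hY] at h
  rw [← Complex.coe_smul, ← Complex.coe_smul, smul_eq_mul, smul_eq_mul,
    ← Complex.ofReal_mul, ← Complex.ofReal_mul] at h
  exact Complex.ofReal_injective h

end Factorization

/-! ### Mixed derivatives of ratios -/

section Response

set_option linter.unusedSectionVars false

open Classical Finset
open scoped _root_.ContDiff

variable {ι : Type*} [Fintype ι] {G : Type*} [NormedAddCommGroup G] [NormedSpace ℝ G]
  {adj : ι → ι → Prop} {T T' : ι → Prop} {D b c ν ν' : ℝ} {Z : (ι → ℝ) → ℝ} {F Ξ Ξ' : (ι → ℝ) → G}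

lemma pd_comm (hF : ContDiff ℝ ∞ F) (e f : ι) (t : ι → ℝ) :
    pd e (pd f F) t = pd f (pd e F) t := by
  have h1 : ∀ g : ι, ∀ s, HasFDerivAt (pd g F)
      ((ContinuousLinearMap.apply ℝ G (Pi.single g (1 : ℝ) : ι → ℝ)).comp
        (fderiv ℝ (fderiv ℝ F) s)) s := by
    intro g s
    have h2 : DifferentiableAt ℝ (fderiv ℝ F) s :=
      ((hF.fderiv_right (m := ∞) le_rfl).differentiable (by simp)).differentiableAt
    exact (ContinuousLinearMap.apply ℝ G (Pi.single g (1 : ℝ) : ι → ℝ)).hasFDerivAt.comp s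
      h2.hasFDerivAt
  have h3 : IsSymmSndFDerivAt ℝ F t :=
    (hF.contDiffAt).isSymmSndFDerivAt (by
      rw [minSmoothness_of_isRCLikeNormedField]
      exact WithTop.coe_le_coe.2 le_top)
  rw [pd, (h1 f t).fderiv, pd, (h1 e t).fderiv]
  exact h3 _ _

lemma pd_sub (hΞ : ContDiff ℝ ∞ Ξ) (hΞ' : ContDiff ℝ ∞ Ξ') (e : ι) :
    pd e (fun t => Ξ t - Ξ' t) = fun t => pd e Ξ t - pd e Ξ' t := by
  funext t
  rw [pd, fderiv_fun_sub (differentiableAt_of_contDiff hΞ) (differentiableAt_of_contDiff hΞ')]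
  rfl

lemma pd_const_smul (hΞ : ContDiff ℝ ∞ Ξ) (r : ℝ) (e : ι) :
    pd e (fun t => r • Ξ t) = fun t => r • pd e Ξ t := by
  funext t
  rw [pd, fderiv_fun_const_smul (differentiableAt_of_contDiff hΞ)]
  rfl

lemma pd_smul_const (hZ : ContDiff ℝ ∞ Z) (x : G) (e : ι) :
    pd e (fun t => Z t • x) = fun t => pd e Z t • x := by
  funext t
  rw [pd, fderiv_smul_const (differentiableAt_of_contDiff hZ)]
  rfl

lemma pdl_sub (hΞ : ContDiff ℝ ∞ Ξ) (hΞ' : ContDiff ℝ ∞ Ξ') : ∀ l : List ι,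
    pdl l (fun t => Ξ t - Ξ' t) = fun t => pdl l Ξ t - pdl l Ξ' t
  | [] => rfl
  | e :: l => by
    rw [pdl, pdl_sub hΞ hΞ' l, pd_sub (contDiff_pdl hΞ l) (contDiff_pdl hΞ' l)]
    rfl

lemma pdl_const_smul (hΞ : ContDiff ℝ ∞ Ξ) (r : ℝ) : ∀ l : List ι,
    pdl l (fun t => r • Ξ t) = fun t => r • pdl l Ξ t
  | [] => rfl
  | e :: l => by
    rw [pdl, pdl_const_smul hΞ r l, pd_const_smul (contDiff_pdl hΞ l)]
    rfl

lemma pdl_smul_const (hZ : ContDiff ℝ ∞ Z) (x : G) : ∀ l : List ι,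
    pdl l (fun t => Z t • x) = fun t => pdl l Z t • x
  | [] => rfl
  | e :: l => by
    rw [pdl, pdl_smul_const hZ x l, pd_smul_const (contDiff_pdl hZ l)]
    rfl

lemma DerivBound.sub (hΞ : ContDiff ℝ ∞ Ξ) (hΞ' : ContDiff ℝ ∞ Ξ') (h : DerivBound b ν Z Ξ)
    (h' : DerivBound b ν' Z Ξ') : DerivBound b (ν + ν') Z fun t => Ξ t - Ξ' t := by
  intro l t
  rw [pdl_sub hΞ hΞ']
  refine (norm_sub_le _ _).trans ((add_le_add (h l t) (h' l t)).trans (le_of_eq ?_))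
  ring

lemma DerivBound.const_smul (hΞ : ContDiff ℝ ∞ Ξ) (h : DerivBound b ν Z Ξ) {r c : ℝ}
    (hr : |r| ≤ c) : DerivBound b (c * ν) Z fun t => r • Ξ t := by
  intro l t
  rw [pdl_const_smul hΞ, norm_smul, Real.norm_eq_abs]
  refine (mul_le_mul hr (h l t) (norm_nonneg _) ((abs_nonneg _).trans hr)).trans (le_of_eq ?_)
  ring

lemma DerivBound.smul_const {Z' : (ι → ℝ) → ℝ} (hZ' : ContDiff ℝ ∞ Z') (h : DerivBound b ν Z Z')
    {x : G} {c : ℝ} (hx : ‖x‖ ≤ c) : DerivBound b (c * ν) Z fun t => Z' t • x := by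
  intro l t
  rw [pdl_smul_const hZ', norm_smul, mul_comm]
  refine (mul_le_mul hx (h l t) (norm_nonneg _) ((norm_nonneg _).trans hx)).trans (le_of_eq ?_)
  ring

lemma DerivBound.pd (h : DerivBound b ν Z Ξ) (e : ι) : DerivBound b (b * ν) Z (pd e Ξ) := by
  intro l t
  rw [← pdl_append_singleton]
  refine (h _ t).trans (le_of_eq ?_)
  rw [List.length_append, List.length_singleton]
  ring

lemma Factorizes.mono (h : Factorizes adj T D Z Ξ) (hT : ∀ k, T k → T' k) :
    Factorizes adj T' D Z Ξ :=
  fun K hK t ht => h K (fun k hk hk' => hK k hk (hT k hk')) t ht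

lemma Factorizes.sub (h : Factorizes adj T D Z Ξ) (h' : Factorizes adj T D Z Ξ') :
    Factorizes adj T D Z fun t => Ξ t - Ξ' t := fun K hK t ht => by
  simp only [smul_sub, h K hK t ht, h' K hK t ht]

lemma Factorizes.const_smul (h : Factorizes adj T D Z Ξ) (r : ℝ) :
    Factorizes adj T D Z fun t => r • Ξ t := fun K hK t ht => by
  simp only [smul_comm _ r, h K hK t ht]

lemma Factorizes.smul_const {Z' : (ι → ℝ) → ℝ} (h : Factorizes adj T D Z Z') (x : G) :
    Factorizes adj T D Z fun t => Z' t • x := fun K hK t ht => by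
  simp only [← smul_assoc, h K hK t ht]

lemma contDiff_ratio (hZs : ContDiff ℝ ∞ Z) (hFs : ContDiff ℝ ∞ F) (hpos : ∀ t, 0 < Z t) :
    ContDiff ℝ ∞ fun t => (Z t)⁻¹ • F t :=
  (hZs.inv fun t => (hpos t).ne').smul hFs

lemma pd_ratio (hZs : ContDiff ℝ ∞ Z) (hFs : ContDiff ℝ ∞ F) (hpos : ∀ t, 0 < Z t) (e : ι)
    (t : ι → ℝ) : pd e (fun t => (Z t)⁻¹ • F t) t =
      (Z t)⁻¹ • (pd e F t - (pd e Z t * (Z t)⁻¹) • F t) := by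
  have hZt := (hpos t).ne'
  have h1 := hasDerivAt_single (e := e) (differentiableAt_of_contDiff hZs (t := t))
  have h2 := hasDerivAt_single (e := e) (differentiableAt_of_contDiff hFs (t := t))
  have h3 := (h1.fun_inv (by simpa using hZt)).smul h2
  have h5 := (hasDerivAt_single (e := e)
    (differentiableAt_of_contDiff (contDiff_ratio hZs hFs hpos))).unique h3
  rw [h5]
  simp only [zero_smul, add_zero]
  rw [smul_sub, smul_smul, sub_eq_add_neg, ← neg_smul]
  congr 2
  field_simp

/-- **Decay of correlations between couplings.** At a fixed point `t₀`, the mixed derivative of the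
ratio `F / Z` is the first derivative of `Ξ / Z` for a truncated function `Ξ`, which factorizes
away from the edge `e`. -/
theorem norm_pd_pd_ratio_le (hF : Factorizes adj T D Z F) (hZ : Factorizes adj T D Z Z)
    (hZs : ContDiff ℝ ∞ Z) (hFs : ContDiff ℝ ∞ F) (hD : D ≠ 0) (hpos : ∀ t, 0 < Z t)
    (hb : 0 ≤ b) (hZb : DerivBound b 1 Z Z) (hFb : DerivBound b 1 Z F) {r : ℕ} {e f : ι}
    (hf : Safe adj (fun k => T k ∨ k = e ∨ adj k e) r f) (t₀ : ι → ℝ) (ht₀ : 0 ≤ t₀) :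
    ‖pd e (pd f fun t => (Z t)⁻¹ • F t) t₀‖ ≤
      2 * b * (3 * b) * clusterSum adj r {f} (fun g => Real.exp (2 * (b * t₀ g)) - 1) := by
  set R : (ι → ℝ) → G := fun t => (Z t)⁻¹ • F t with hR
  have hRs : ContDiff ℝ ∞ R := contDiff_ratio hZs hFs hpos
  set x := R t₀ with hx
  set z := pd e Z t₀ * (Z t₀)⁻¹ with hz
  have hxle : ‖x‖ ≤ 1 := norm_ratio_le hFb hpos t₀
  have hzle : |z| ≤ b := by
    have h := hZb [e] t₀
    simp only [pdl, List.length_singleton, pow_one, one_mul, Real.norm_eq_abs] at h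
    rw [hz, abs_mul, abs_inv, abs_of_pos (hpos t₀), ← div_eq_mul_inv, div_le_iff₀ (hpos t₀)]
    exact h
  set Ξ : (ι → ℝ) → G := fun t => (pd e F t - pd e Z t • x) - z • F t with hΞ
  have hFe := contDiff_pd hFs e
  have hZe := contDiff_pd hZs e
  have hΞs : ContDiff ℝ ∞ Ξ := (hFe.sub (hZe.smul contDiff_const)).sub (hFs.const_smul z)
  have hT : ∀ k, ¬ (T k ∨ k = e ∨ adj k e) → ¬ T k ∧ k ≠ e ∧ ¬ adj k e := fun k hk => by
    simpa only [not_or] using hk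
  have hΞf : Factorizes adj (fun k => T k ∨ k = e ∨ adj k e) D Z Ξ :=
    ((hF.pd_outside hFs e hT).sub ((hZ.pd_outside hZs e hT).smul_const x)).sub
      ((hF.mono fun k hk => Or.inl hk).const_smul z)
  have hΞb : DerivBound b (b * 1 + 1 * (b * 1) + b * 1) Z Ξ :=
    ((hFb.pd e).sub hFe (hZe.smul contDiff_const) ((hZb.pd e).smul_const hZe hxle)).sub
      (hFe.sub (hZe.smul contDiff_const)) (hFs.const_smul z) (hFb.const_smul hFs hzle)
  rw [show b * 1 + 1 * (b * 1) + b * 1 = 3 * b by ring] at hΞb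
  have key := norm_pd_ratio_le hΞf (hZ.mono fun k hk => Or.inl hk) hZs hΞs hD hpos hb
    (by positivity) hZb hΞb hf t₀ ht₀
  refine le_trans (le_of_eq ?_) key
  congr 1
  rw [pd_comm hRs]
  have hpdR : pd e R = fun t => (Z t)⁻¹ • (pd e F t - (pd e Z t * (Z t)⁻¹) • F t) :=
    funext (pd_ratio hZs hFs hpos e)
  -- The product rule, in the form that the two functions differ by a term of second order.
  have hdiff : ∀ t, pd e R t - (Z t)⁻¹ • Ξ t - z • x =
      -((pd e Z t * (Z t)⁻¹ - z) • (R t - x)) := by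
    intro t
    rw [hpdR]
    simp only [hΞ, hR]
    have h1 : (Z t)⁻¹ • (pd e Z t * (Z t)⁻¹) • F t = (pd e Z t * (Z t)⁻¹) • (Z t)⁻¹ • F t :=
      smul_comm _ _ _
    have h2 : (Z t)⁻¹ • z • F t = z • (Z t)⁻¹ • F t := smul_comm _ _ _
    have h3 : (Z t)⁻¹ • pd e Z t • x = (pd e Z t * (Z t)⁻¹) • x := by rw [smul_smul, mul_comm]
    rw [smul_sub, smul_sub, smul_sub, h1, h2, h3, sub_smul, smul_sub, smul_sub]
    abel
  have hW : ContDiff ℝ ∞ fun t => pd e Z t * (Z t)⁻¹ := hZe.mul (hZs.inv fun t => (hpos t).ne')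
  have d1 := hasDerivAt_single (e := f) (differentiableAt_of_contDiff (contDiff_pd hRs e) (t := t₀))
  have d2 := hasDerivAt_single (e := f)
    (differentiableAt_of_contDiff (contDiff_ratio hZs hΞs hpos) (t := t₀))
  have d3 := hasDerivAt_single (e := f) (differentiableAt_of_contDiff hW (t := t₀))
  have d4 := hasDerivAt_single (e := f) (differentiableAt_of_contDiff hRs (t := t₀))
  have d5 := (((d3.sub_const z).smul (d4.sub_const x)).neg).unique
    (((d1.sub d2).sub_const (z • x)).congr_of_eventuallyEq (Filter.Eventually.of_forall fun v =>
      (hdiff _).symm))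
  simp only [zero_smul, add_zero, hx, hz, sub_self, smul_zero, neg_zero] at d5
  exact sub_eq_zero.1 d5.symm

/-- The mean value inequality for the scaling of the couplings in `N`. -/
lemma norm_sub_zeroOn_le (hF : ContDiff ℝ ∞ F) (N : Finset ι) (t : ι → ℝ) (ht0 : 0 ≤ t)
    (ht1 : t ≤ 1) (hc : ∀ e ∈ N, ∀ u : ℝ, 0 ≤ u → u ≤ 1 → ‖pd e F (scaleOn N u t)‖ ≤ c) :
    ‖F t - F (zeroOn N t)‖ ≤ N.card * c := by
  have hbound : ∀ u ∈ Set.Icc (0 : ℝ) 1, ‖∑ e ∈ N, t e • pd e F (scaleOn N u t)‖ ≤ N.card * c := by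
    intro u hu
    refine (norm_sum_le _ _).trans ?_
    rw [← nsmul_eq_mul]
    refine Finset.sum_le_card_nsmul _ _ _ fun e he => ?_
    rw [norm_smul, Real.norm_of_nonneg (ht0 e)]
    exact (mul_le_of_le_one_left (norm_nonneg _) (ht1 e)).trans (hc e he u hu.1 hu.2)
  have h := Convex.norm_image_sub_le_of_norm_hasDerivWithin_le (s := Set.Icc (0 : ℝ) 1)
    (fun u _ => (hasDerivAt_scaleOn hF N t u).hasDerivWithinAt) hbound (convex_Icc 0 1)
    (Set.left_mem_Icc.2 zero_le_one) (Set.right_mem_Icc.2 zero_le_one)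
  simpa [scaleOn_zero, scaleOn_one] using h

/-- If the edges of `K` are decoupled from the rest, the ratio `F / Z` does not depend on them. -/
lemma Factorizes.ratio_eq (hF : Factorizes adj T D Z F) (hZ : Factorizes adj T D Z Z)
    (hD : D ≠ 0) (hpos : ∀ t, 0 < Z t) {K : Finset ι} (hK : ∀ k ∈ K, ¬ T k) (t : ι → ℝ)
    (ht : ∀ f ∈ nbhd adj K, t f = 0) :
    (Z t)⁻¹ • F t = (Z (zeroOn K t))⁻¹ • F (zeroOn K t) := by
  have h1 := hF K hK t ht
  have h2 := hZ K hK t ht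
  have h3 := (hpos (zeroOn K t)).ne'
  have h4 := (hpos t).ne'
  have h5 : F t = (Z t * (Z (zeroOn K t))⁻¹) • F (zeroOn K t) := by
    rw [← (IsUnit.mk0 D hD).smul_left_cancel, h1, smul_smul, ← mul_assoc]
    rw [smul_eq_mul, smul_eq_mul] at h2
    rw [h2, mul_assoc, mul_inv_cancel₀ h3, mul_one]
  rw [h5, smul_smul, ← mul_assoc, inv_mul_cancel₀ h4, one_mul]

lemma Factorizes.pd_ratio_eq_zero (hF : Factorizes adj T D Z F) (hZ : Factorizes adj T D Z Z)
    (hZs : ContDiff ℝ ∞ Z) (hFs : ContDiff ℝ ∞ F) (hD : D ≠ 0) (hpos : ∀ t, 0 < Z t)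
    {K : Finset ι} (hK : ∀ k ∈ K, ¬ T k) {e : ι} (he : e ∈ K) (t : ι → ℝ)
    (ht : ∀ f ∈ nbhd adj K, t f = 0) : pd e (fun t => (Z t)⁻¹ • F t) t = 0 := by
  have h1 := hasDerivAt_single (e := e)
    (differentiableAt_of_contDiff (contDiff_ratio hZs hFs hpos) (t := t))
  refine h1.unique ?_
  have h2 : (fun v : ℝ => (Z (t + v • Pi.single e 1))⁻¹ • F (t + v • Pi.single e 1)) =
      fun _ => (Z (zeroOn K t))⁻¹ • F (zeroOn K t) := by
    funext v
    rw [hF.ratio_eq hZ hD hpos hK, zeroOn_add_single he]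
    intro f hf
    have : f ≠ e := fun h => (mem_nbhd.1 hf).1 (h ▸ he)
    simp [ht f hf, this]
  rw [h2]
  exact hasDerivAt_const _ _

end Response

/-! ### Counting attached sets of edges -/

section Counting

set_option linter.unusedSectionVars false

open Classical Finset

variable {V : Type*} [Fintype V] [LinearOrder V] {E : Finset (Finset V)}

/-- The infimum that defines the growth constant is attained. -/
lemma growthConst_spec (E : Finset (Finset V)) :
    0 ≤ growthConst E ∧ ∀ m : ℕ, (animalNumber E m : ℝ) ≤ growthConst E ^ m := by
  have hclosed : IsClosed {c : ℝ | 0 ≤ c ∧ ∀ m : ℕ, (animalNumber E m : ℝ) ≤ c ^ m} := by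
    simp only [Set.ofPred_and, Set.ofPred_forall]
    exact (isClosed_le continuous_const continuous_id).inter (isClosed_iInter fun m =>
      isClosed_le continuous_const (continuous_pow m))
  refine hclosed.csInf_mem ⟨(E.powerset.card : ℝ), by positivity, fun m => ?_⟩ ⟨0, fun c hc => hc.1⟩
  have hle : animalNumber E m ≤ E.powerset.card :=
    Finset.sup_le fun l _ => card_le_card (filter_subset _ _)
  rcases Nat.eq_zero_or_pos m with rfl | hm
  · have h0 : animalNumber E 0 = 0 := by
      refine Nat.le_zero.1 (Finset.sup_le fun l _ => Nat.le_zero.2 (card_eq_zero.2 ?_))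
      refine filter_eq_empty_iff.2 fun F _ hF => ?_
      rw [card_eq_zero.1 hF.2.2] at hF
      simp at hF
    simp [h0]
  · have h1 : (1 : ℝ) ≤ E.powerset.card := by
      exact_mod_cast card_pos.2 ⟨∅, empty_mem_powerset _⟩
    calc (animalNumber E m : ℝ) ≤ E.powerset.card := by exact_mod_cast hle
      _ ≤ _ := le_self_pow₀ h1 hm.ne'

lemma one_le_growthConst {l : Finset V} (hl : l ∈ E) (hl0 : l.Nonempty) : 1 ≤ growthConst E := by
  have h := (growthConst_spec E).2 1
  rw [pow_one] at h
  refine le_trans (Nat.one_le_cast.2 ?_) h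
  refine le_trans (card_pos.2 ⟨{l}, ?_⟩) (Finset.le_sup (f := fun l => (E.powerset.filter fun F =>
    IsAnimal F ∧ l ∈ F ∧ F.card = 1).card) hl)
  refine mem_filter.2 ⟨mem_powerset.2 (singleton_subset_iff.2 hl), ?_, by simp, by simp⟩
  intro a ha b hb
  rw [mem_singleton.1 ha, mem_singleton.1 hb]
  exact ⟨l, by simp, l, by simp, by simpa using hl0, by simpa using hl0, Relation.ReflTransGen.refl⟩

/-- A set of edges that is attached to the nonempty edge `f` is, together with `f`, an animal. -/
lemma isAnimal_of_attached {f : E} (hf : f.1.Nonempty) {C : Finset E}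
    (hC : Attached (Overlap fun e : E => e.1) {f} C) :
    IsAnimal ((insert f C).map (Function.Embedding.subtype _)) := by
  set F := (insert f C).map (Function.Embedding.subtype (· ∈ E)) with hF
  set rel : Finset V → Finset V → Prop := fun a b => a ∈ F ∧ b ∈ F ∧ (a ∩ b).Nonempty with hrel
  have hmem : ∀ c ∈ insert f C, c.1 ∈ F := fun c hc => mem_map_of_mem _ hc
  have hsymm : ∀ a b, rel a b → rel b a := fun a b h => ⟨h.2.1, h.1, by rw [inter_comm]; exact h.2.2⟩
  have hpath : ∀ c : E, Relation.ReflTransGen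
      (fun a b => Overlap (fun e : E => e.1) a b ∧ b ∈ C) f c →
      c ∈ insert f C ∧ c.1.Nonempty ∧ Relation.ReflTransGen rel f.1 c.1 := by
    intro c hc
    induction hc with
    | refl => exact ⟨mem_insert_self _ _, hf, Relation.ReflTransGen.refl⟩
    | tail _ hbc ih =>
      obtain ⟨hb, _, hfb⟩ := ih
      have hc := mem_insert_of_mem (b := f) hbc.2
      exact ⟨hc, hbc.1.mono inter_subset_right, hfb.tail ⟨hmem _ hb, hmem _ hc, hbc.1⟩⟩
  have hall : ∀ l ∈ F, l.Nonempty ∧ Relation.ReflTransGen rel f.1 l := by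
    intro l hl
    obtain ⟨c, hc, rfl⟩ := mem_map.1 hl
    rcases mem_insert.1 hc with rfl | hc
    · exact ⟨hf, Relation.ReflTransGen.refl⟩
    · obtain ⟨k, hk, hkc⟩ := hC.2 c hc
      rw [mem_singleton.1 hk] at hkc
      exact (hpath c hkc).2
  intro l hl k hk
  refine ⟨l, hl, k, hk, by simpa using (hall l hl).1, by simpa using (hall k hk).1, ?_⟩
  have : Std.Symm rel := ⟨hsymm⟩
  exact (Relation.ReflTransGen.stdSymm.symm _ _ (hall l hl).2).trans (hall k hk).2

/-- A set attached to `f` does not contain `f`, so adding `f` is injective on these sets and raises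
the size by one. -/
lemma card_attached_le {f : E} (hf : f.1.Nonempty) (m : ℕ) :
    (univ.filter fun C => Attached (Overlap fun e : E => e.1) {f} C ∧ C.card = m).card ≤
      animalNumber E (m + 1) := by
  refine le_trans ?_ (Finset.le_sup (f := fun l => (E.powerset.filter fun F =>
    IsAnimal F ∧ l ∈ F ∧ F.card = m + 1).card) f.2)
  have hfC : ∀ C, Attached (Overlap fun e : E => e.1) {f} C → f ∉ C := fun C hC h =>
    Finset.disjoint_left.1 hC.1 h (mem_singleton_self f)
  refine card_le_card_of_injOn (fun C => (insert f C).map (Function.Embedding.subtype _)) ?_ ?_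
  · intro C hC
    obtain ⟨hC, hm⟩ := (mem_filter.1 (mem_coe.1 hC)).2
    refine mem_coe.2 (mem_filter.2 ⟨mem_powerset.2 ?_, isAnimal_of_attached hf hC, ?_, ?_⟩)
    · intro l hl
      obtain ⟨c, _, rfl⟩ := mem_map.1 hl
      exact c.2
    · exact mem_map_of_mem _ (mem_insert_self _ _)
    · rw [card_map, card_insert_of_notMem (hfC C hC), hm]
  · intro C hC C' hC' h
    have h1 := (mem_filter.1 (mem_coe.1 hC)).2.1
    have h2 := (mem_filter.1 (mem_coe.1 hC')).2.1
    have h3 : insert f C = insert f C' := map_injective _ h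
    rw [← erase_insert (hfC C h1), h3, erase_insert (hfC C' h2)]

/-- The weight of the attached sets, bounded by the number of animals. -/
lemma mul_clusterSum_le {f : E} (hf : f.1.Nonempty) {w : E → ℝ} {z : ℝ} (hw : 0 ≤ w)
    (hwz : ∀ e, w e ≤ z) (hz : 0 ≤ z) (hlt : growthConst E * z < 1) (r : ℕ) :
    z * clusterSum (Overlap fun e : E => e.1) r {f} w ≤
      (growthConst E * z) ^ (r + 1) / (1 - growthConst E * z) := by
  obtain ⟨hα, ha⟩ := growthConst_spec E
  set α := growthConst E
  set N := Fintype.card E + 1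
  have hαz : 0 ≤ α * z := mul_nonneg hα hz
  have h1 : clusterSum (Overlap fun e : E => e.1) r {f} w ≤
      ∑ m ∈ Ico r N, α ^ (m + 1) * z ^ m := by
    calc _ ≤ ∑ C ∈ univ.filter (fun C => Attached (Overlap fun e : E => e.1) {f} C ∧ r ≤ C.card),
          z ^ C.card := by
          refine sum_le_sum fun C _ => ?_
          rw [← prod_const]
          exact prod_le_prod (fun e _ => hw e) fun e _ => hwz e
      _ = ∑ m ∈ Ico r N, ∑ C ∈ (univ.filter
          (fun C => Attached (Overlap fun e : E => e.1) {f} C ∧ r ≤ C.card)).filter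
            (fun C => C.card = m), z ^ C.card := by
          refine (sum_fiberwise_of_maps_to (fun C hC => mem_Ico.2 ⟨(mem_filter.1 hC).2.2, ?_⟩) _).symm
          exact Nat.lt_succ_of_le (card_le_univ C)
      _ ≤ _ := by
          refine sum_le_sum fun m _ => ?_
          have h2 : ∀ C ∈ (univ.filter
              (fun C => Attached (Overlap fun e : E => e.1) {f} C ∧ r ≤ C.card)).filter
                (fun C => C.card = m), z ^ C.card = z ^ m := fun C hC => by
            rw [(mem_filter.1 hC).2]
          rw [sum_congr rfl h2, sum_const, nsmul_eq_mul]
          refine mul_le_mul_of_nonneg_right ?_ (pow_nonneg hz m)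
          refine le_trans ?_ (ha (m + 1))
          refine Nat.cast_le.2 (le_trans (card_le_card fun C hC => ?_) (card_attached_le hf m))
          simp only [mem_filter, mem_univ, true_and] at hC ⊢
          exact ⟨hC.1.1, hC.2⟩
  calc z * clusterSum (Overlap fun e : E => e.1) r {f} w
      ≤ z * ∑ m ∈ Ico r N, α ^ (m + 1) * z ^ m := mul_le_mul_of_nonneg_left h1 hz
    _ = (α * z) * ∑ m ∈ Ico r N, (α * z) ^ m := by
        rw [mul_sum, mul_sum]
        refine sum_congr rfl fun m _ => ?_
        ring
    _ ≤ (α * z) * ((α * z) ^ r / (1 - α * z)) :=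
        mul_le_mul_of_nonneg_left (geom_sum_Ico_le_of_lt_one hαz hlt) hαz
    _ = _ := by ring

/-- The decay rate `α e^{2b} (e^{2b} - 1)`, which is `e^{-1/ξ}`. -/
def decayRate (α b : ℝ) : ℝ := α * Real.exp (2 * b) * (Real.exp (2 * b) - 1)

lemma exp_two_mul_sub_one_nonneg {b : ℝ} (hb : 0 ≤ b) : 0 ≤ Real.exp (2 * b) - 1 := by
  simpa using Real.one_le_exp (mul_nonneg two_pos.le hb)

lemma mul_exp_sub_one_le_decayRate {α b : ℝ} (hα : 0 ≤ α) (hb : 0 ≤ b) :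
    α * (Real.exp (2 * b) - 1) ≤ decayRate α b := by
  have h := exp_two_mul_sub_one_nonneg hb
  exact mul_le_mul_of_nonneg_right (le_mul_of_one_le_right hα (by linarith)) h

lemma decayRate_nonneg {α b : ℝ} (hα : 0 ≤ α) (hb : 0 ≤ b) : 0 ≤ decayRate α b :=
  (mul_nonneg hα (exp_two_mul_sub_one_nonneg hb)).trans (mul_exp_sub_one_le_decayRate hα hb)

/-- The weight of the attached sets with at least `r` elements decays exponentially in `r`. -/
lemma two_mul_clusterSum_le {f : E} (hf : f.1.Nonempty) {b : ℝ} (hb : 0 ≤ b)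
    (hq : decayRate (growthConst E) b < 1) {t : E → ℝ} (ht0 : 0 ≤ t) (ht1 : t ≤ 1) (r : ℕ) :
    2 * b * clusterSum (Overlap fun e : E => e.1) r {f} (fun e => Real.exp (2 * (b * t e)) - 1) ≤
      decayRate (growthConst E) b ^ (r + 1) / (1 - decayRate (growthConst E) b) := by
  have hα := (growthConst_spec E).1
  have hz := exp_two_mul_sub_one_nonneg hb
  have hle := mul_exp_sub_one_le_decayRate hα hb
  have hw : (0 : E → ℝ) ≤ fun e => Real.exp (2 * (b * t e)) - 1 := fun e => by
    simpa using Real.one_le_exp (mul_nonneg two_pos.le (mul_nonneg hb (ht0 e)))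
  calc _ ≤ (Real.exp (2 * b) - 1) * clusterSum (Overlap fun e : E => e.1) r {f}
        (fun e => Real.exp (2 * (b * t e)) - 1) := by
        refine mul_le_mul_of_nonneg_right ?_ (clusterSum_nonneg hw)
        linarith [Real.add_one_le_exp (2 * b)]
    _ ≤ _ := by
        refine mul_clusterSum_le hf hw (fun e => ?_) hz (hle.trans_lt hq) r
        gcongr
        exact mul_le_of_le_one_right hb (ht1 e)
    _ ≤ _ := by
        have := mul_nonneg hα hz
        exact div_le_div₀ (pow_nonneg (this.trans hle) _) (pow_le_pow_left₀ this hle _)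
          (sub_pos.2 hq) (sub_le_sub_left hle 1)

end Counting

/-! ### Distances in the hypergraph -/

section Distance

set_option linter.unusedSectionVars false

open Classical Finset

variable {V : Type*} [Fintype V] [LinearOrder V] {E : Finset (Finset V)}

/-- If `f` is within `r` steps of the edge `e` that meets `S`, or of another edge that meets `S`,
then at most `r` edges suffice to connect `S` to `f`. -/
lemma exists_connects_of_not_safe {S : Finset V} {e : E}
    (he : Touches (fun e : E => e.1) S e) : ∀ (r : ℕ) (f : E), f.1.Nonempty →
    ¬ Safe (Overlap fun e : E => e.1) (fun k => Touches (fun e : E => e.1) S k ∨ k = e ∨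
      Overlap (fun e : E => e.1) k e) r f →
    ∃ G ⊆ E, G.card ≤ r ∧ Connects G S f.1
  | 0, _, _, h => absurd trivial h
  | r + 1, f, hf, h => by
    have hsingle : ∀ g : E, Touches (fun e : E => e.1) S g → (g.1 ∩ f.1).Nonempty →
        ∃ G ⊆ E, G.card ≤ r + 1 ∧ Connects G S f.1 := fun g hg hgf =>
      ⟨{g.1}, singleton_subset_iff.2 g.2, by simp, g.1, mem_singleton_self _, g.1,
        mem_singleton_self _, hg, hgf, Relation.ReflTransGen.refl⟩
    rw [Safe, not_and_or, not_not] at h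
    push Not at h
    rcases h with (h | rfl | h) | ⟨g, hfg, hg⟩
    · exact hsingle f h (by simpa using hf)
    · exact hsingle f he (by simpa using hf)
    · exact hsingle e he (by rw [inter_comm]; exact h)
    · obtain ⟨G, hG, hcard, l, hl, k, hk, hlS, hkg, hlk⟩ :=
        exists_connects_of_not_safe he r g (hfg.mono inter_subset_right) hg
      refine ⟨insert g.1 G, insert_subset g.2 hG, (card_insert_le _ _).trans (by lia), l,
        mem_insert_of_mem hl, g.1, mem_insert_self _ _, hlS, by rw [inter_comm]; exact hfg, ?_⟩
      refine Relation.ReflTransGen.tail (Relation.ReflTransGen.mono (fun a b hab =>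
        ⟨mem_insert_of_mem hab.1, mem_insert_of_mem hab.2.1, hab.2.2⟩) _ _ hlk)
        ⟨mem_insert_of_mem hk, mem_insert_self _ _, hkg⟩

/-- A large distance of `F` from `S` makes the edges of `F` graph-distant from the edges that meet
`S` and from the neighbours of any such edge `e`. -/
lemma safe_of_lt_edgeDist {S : Finset V} {F : Finset (Finset V)} {n : ℕ}
    (hn : (n : ℕ∞) < edgeDist E S F) {e f : E} (he : Touches (fun e : E => e.1) S e)
    (hf : f.1 ∈ F) (hf0 : f.1.Nonempty) :
    Safe (Overlap fun e : E => e.1) (fun k => Touches (fun e : E => e.1) S k ∨ k = e ∨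
      Overlap (fun e : E => e.1) k e) n f := by
  by_contra h
  obtain ⟨G, hG, hcard, hconn⟩ := exists_connects_of_not_safe he n f hf0 h
  rw [edgeDist] at hn
  split_ifs at hn
  · simp at hn
  · refine absurd (hn.trans_le (iInf_le _ ⟨G, hG, f.1, hf, hconn⟩)) (not_lt.2 ?_)
    exact_mod_cast hcard

end Distance

/-! ### The constants -/

section Constants

/-- The critical inverse temperature is the one at which the decay rate reaches one. -/
lemma decayRate_lt_one {α J β : ℝ} (hα : 0 ≤ α) (hJ : 0 ≤ J)
    (hβ : ((|β| : ℝ) : EReal) < critBeta α J) : decayRate α (|β| * J) < 1 := by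
  rw [critBeta] at hβ
  split_ifs at hβ with h
  · rcases h with rfl | rfl <;> simp [decayRate]
  · rw [not_or] at h
    have hα' : 0 < α := lt_of_le_of_ne hα (Ne.symm h.2)
    have hJ' : 0 < J := lt_of_le_of_ne hJ (Ne.symm h.1)
    set s := √(1 + 4 / α) with hs
    have hs2 : s ^ 2 = 1 + 4 / α := Real.sq_sqrt (by positivity)
    have hs0 : 0 ≤ s := Real.sqrt_nonneg _
    have h1 : 2 * (|β| * J) < Real.log ((1 + s) / 2) := by
      have := (lt_div_iff₀ (by positivity)).1 (EReal.coe_lt_coe_iff.1 hβ)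
      linarith
    have h2 : Real.exp (2 * (|β| * J)) < (1 + s) / 2 := by
      rwa [Real.lt_log_iff_exp_lt (by positivity)] at h1
    have h3 : 1 ≤ Real.exp (2 * (|β| * J)) := Real.one_le_exp (by positivity)
    rw [decayRate]
    set x := Real.exp (2 * (|β| * J))
    -- `y = (1 + s) / 2` is the solution of `α y (y - 1) = 1`.
    have h4 : α * (s ^ 2 - 1) = 4 := by rw [hs2]; field_simp; ring
    have h5 : x * (x - 1) < (1 + s) / 2 * ((1 + s) / 2 - 1) := by nlinarith
    nlinarith [mul_lt_mul_of_pos_left h5 hα']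

lemma log_three_le : Real.log 3 ≤ 4 / 3 := by
  rw [Real.log_le_iff_le_exp (by norm_num)]
  refine le_trans ?_ (Real.quadratic_le_exp_of_nonneg (by norm_num))
  norm_num

lemma log_three_pos : 0 < Real.log 3 := Real.log_pos (by norm_num)

lemma corrLength_eq (α J β : ℝ) : corrLength α J β = |Real.log (decayRate α (|β| * J))|⁻¹ := by
  rw [corrLength, decayRate, mul_assoc 2 |β| J]

lemma neg_div_corrLength {α J β : ℝ} (hα : 0 ≤ α) (hJ : 0 ≤ J)
    (hq : decayRate α (|β| * J) < 1) (x : ℝ) :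
    -x / corrLength α J β = x * Real.log (decayRate α (|β| * J)) := by
  have h0 := decayRate_nonneg hα (mul_nonneg (abs_nonneg β) hJ)
  rw [corrLength_eq, div_inv_eq_mul, abs_of_nonpos (Real.log_nonpos h0 hq.le)]
  ring

/-- Bounds by `y q ^ n` for all finite `n ≤ d`, with `q = e^{-1/ξ}`, give the bound `y e^{-d/ξ}`,
also for `d = ∞`. -/
lemma le_mul_expDecay {α J β : ℝ} (hα : 0 ≤ α) (hJ : 0 ≤ J) (h0 : 0 < decayRate α (|β| * J))
    (hq : decayRate α (|β| * J) < 1) {d : ℕ∞} {x y : ℝ}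
    (h : ∀ n : ℕ, (n : ℕ∞) ≤ d → x ≤ y * decayRate α (|β| * J) ^ n) :
    x ≤ y * expDecay d (corrLength α J β) := by
  rw [expDecay]
  split_ifs with hd
  · have hlim := (tendsto_pow_atTop_nhds_zero_of_lt_one h0.le hq).const_mul y
    exact ge_of_tendsto' hlim fun n => h n (hd ▸ le_top)
  · refine (h d.toNat (ENat.natCast_toNat hd).le).trans (le_of_eq ?_)
    rw [neg_div_corrLength hα hJ hq, mul_comm (d.toNat : ℝ), Real.exp_mul, Real.exp_log h0,
      Real.rpow_natCast]

end Constants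

/-! ### The response of local expectations -/

section Locality

set_option linter.unusedSectionVars false

open Classical Finset

variable {V : Type*} [Fintype V] [LinearOrder V] {E : Finset (Finset V)}

lemma norm_pd_ratio_le_two_mul {ι G : Type*} [Fintype ι] [NormedAddCommGroup G] [NormedSpace ℝ G]
    {Z : (ι → ℝ) → ℝ} {F : (ι → ℝ) → G} {b : ℝ}
    (hZs : ContDiff ℝ (⊤ : ℕ∞) Z) (hFs : ContDiff ℝ (⊤ : ℕ∞) F) (hpos : ∀ t, 0 < Z t)
    (hZb : DerivBound b 1 Z Z) (hFb : DerivBound b 1 Z F) (e : ι) (t : ι → ℝ) :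
    ‖pd e (fun t => (Z t)⁻¹ • F t) t‖ ≤ 2 * b := by
  have h1 := hFb [e] t
  have h2 := hZb [e] t
  have h3 := hFb [] t
  simp only [pdl, List.length_singleton, List.length_nil, pow_one, pow_zero, one_mul, mul_one]
    at h1 h2 h3
  have hZ := hpos t
  rw [pd_ratio hZs hFs hpos, norm_smul, norm_inv, Real.norm_of_nonneg hZ.le,
    inv_mul_le_iff₀ hZ]
  have h4 : ‖pd e Z t * (Z t)⁻¹‖ ≤ b := by
    rw [norm_mul, norm_inv, Real.norm_of_nonneg hZ.le, ← div_eq_mul_inv, div_le_iff₀ hZ]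
    exact h2
  calc _ ≤ b * Z t + b * Z t := by
        refine (norm_sub_le _ _).trans (add_le_add h1 ?_)
        rw [norm_smul]
        exact mul_le_mul h4 h3 (norm_nonneg _) ((norm_nonneg _).trans h4)
    _ = _ := by ring

/-- The set of edges `F ⊆ E` as a set of elements of `E`. -/
def edgeSet (E F : Finset (Finset V)) : Finset E := univ.filter fun e => e.1 ∈ F

lemma mem_edgeSet {F : Finset (Finset V)} {e : E} : e ∈ edgeSet E F ↔ e.1 ∈ F := by
  simp [edgeSet]

lemma card_edgeSet_le (F : Finset (Finset V)) : (edgeSet E F).card ≤ F.card := by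
  rw [← card_map (Function.Embedding.subtype (· ∈ E))]
  refine card_le_card fun l hl => ?_
  obtain ⟨e, he, rfl⟩ := mem_map.1 hl
  exact mem_edgeSet.1 he

lemma nonempty_of_mem_boundary {X l : Finset V} (h : l ∈ boundary E X) : l.Nonempty :=
  (mem_filter.1 h).2.1.mono inter_subset_left

/-- An edge that meets `S` and overlaps an edge that avoids `S` is a boundary edge of `S`. -/
lemma nbhd_not_touches_subset {S : Finset V} {f : E}
    (hf : f ∈ nbhd (Overlap fun e : E => e.1)
      (univ.filter fun k => ¬ Touches (fun e : E => e.1) S k)) : f.1 ∈ boundary E S := by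
  obtain ⟨hf, k, hk, x, hx⟩ := mem_nbhd.1 hf
  simp only [mem_filter, mem_univ, true_and, not_not] at hf hk
  refine mem_filter.2 ⟨f.2, hf, x, mem_sdiff.2 ⟨(mem_inter.1 hx).2, fun hxS => hk ⟨x, ?_⟩⟩⟩
  exact mem_inter.2 ⟨(mem_inter.1 hx).1, hxS⟩

/-- The couplings to the boundary edges of `B` decouple the edges outside `B`. -/
lemma nbhd_outside_subset {B : Finset V} {f : E}
    (hf : f ∈ nbhd (Overlap fun e : E => e.1)
      (univ.filter fun k : E => ¬ k.1 ⊆ B ∧ ¬ (k.1 ∩ B).Nonempty)) : f.1 ∈ boundary E B := by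
  obtain ⟨hf, k, hk, x, hx⟩ := mem_nbhd.1 hf
  simp only [mem_filter, mem_univ, true_and] at hf hk
  obtain ⟨hxk, hxf⟩ := mem_inter.1 hx
  have hxB : x ∉ B := fun hxB => hk.2 ⟨x, mem_inter.2 ⟨hxk, hxB⟩⟩
  have hfB : ¬ f.1 ⊆ B := fun h => hxB (h hxf)
  refine mem_filter.2 ⟨f.2, ?_, x, mem_sdiff.2 ⟨hxf, hxB⟩⟩
  by_contra h
  exact hf ⟨hfB, h⟩

variable {Y : E → Op V} {S B : Finset V} {A : Op V} {b : ℝ}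

/-- The expectation of `A` in the thermal state with couplings `t`. -/
def expectRatio (Y : E → Op V) (A : Op V) (t : E → ℝ) : ℂ := (partitionFn Y t)⁻¹ • expectFn Y A t

/-- The response of a local expectation to the coupling to a boundary edge of `B`. -/
theorem norm_pd_expectRatio_le (hY : ∀ e, (Y e).IsHermitian) (hYe : ∀ e, Y e ∈ evenOps e.1)
    (hb0 : 0 ≤ b) (hb : ∀ e, ‖Y e‖ ≤ b) (hSB : S ⊆ B) (hA : A ∈ siteCommutant Sᶜ) (hA1 : ‖A‖ ≤ 1)
    (hq : decayRate (growthConst E) b < 1) {n : ℕ}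
    (hn : (n : ℕ∞) ≤ edgeDist E S (boundary E B)) {f : E} (hf : f.1 ∈ boundary E B)
    {t : E → ℝ} (ht0 : 0 ≤ t) (ht1 : t ≤ 1) :
    ‖pd f (expectRatio Y A) t‖ ≤ (boundary E S).card * (4 / Real.log 3 * b *
      (decayRate (growthConst E) b ^ n / (1 - decayRate (growthConst E) b))) := by
  set q := decayRate (growthConst E) b with hqdef
  have hq0 : 0 ≤ q := decayRate_nonneg (growthConst_spec E).1 hb0
  -- The constant `4 / ln 3` exceeds the constants `3` and `2` of the two cases below.
  have hlog : 3 ≤ 4 / Real.log 3 := by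
    rw [le_div_iff₀ log_three_pos]
    linarith [log_three_le]
  have hD : (Fintype.card (Finset V) : ℝ) ≠ 0 := by exact_mod_cast Fintype.card_ne_zero
  have hpos := partitionFn_pos hY
  have hZs := contDiff_partitionFn (Y := Y)
  have hFs := contDiff_expectFn (Y := Y) A
  have hZb := derivBound_partitionFn hY hb hb0
  have hFb : DerivBound b 1 (partitionFn Y) (expectFn Y A) := fun l s =>
    (norm_pdl_expectFn_le hY hb hb0 A l s).trans (mul_le_mul_of_nonneg_right
      (mul_le_mul_of_nonneg_right hA1 (pow_nonneg hb0 _)) (hpos s).le)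
  have hF := factorizes_expectFn (supp := fun e : E => e.1) hY hYe hA
  have hZ := factorizes_partitionFn (supp := fun e : E => e.1) hY hYe S
  have hpow : 0 ≤ q ^ n / (1 - q) := div_nonneg (pow_nonneg hq0 n) (sub_pos.2 hq).le
  by_cases htouch : ∃ l ∈ boundary E B, (l ∩ S).Nonempty
  · -- The distance is zero, and an edge that meets `S` and leaves `B` is a boundary edge of `S`.
    obtain ⟨l, hl, hlS⟩ := htouch
    have hn0 : n = 0 := by
      rw [edgeDist, if_pos (⟨l, hl, hlS⟩)] at hn
      simpa using hn
    have hlE := mem_filter.1 hl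
    have hlS' : l ∈ boundary E S :=
      mem_filter.2 ⟨hlE.1, hlS, hlE.2.2.mono (sdiff_subset_sdiff le_rfl hSB)⟩
    have hcard : (1 : ℝ) ≤ (boundary E S).card := Nat.one_le_cast.2 (card_pos.2 ⟨l, hlS'⟩)
    have h1 : 1 ≤ q ^ n / (1 - q) := by
      rw [hn0, pow_zero, le_div_iff₀ (sub_pos.2 hq)]
      linarith
    calc ‖pd f (expectRatio Y A) t‖ ≤ 2 * b :=
          norm_pd_ratio_le_two_mul hZs hFs hpos hZb hFb f t
      _ ≤ 1 * (4 / Real.log 3 * b * 1) := by nlinarith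
      _ ≤ _ := by
          have := log_three_pos
          gcongr
  · set N := edgeSet E (boundary E S) with hN
    have hfS : ¬ Touches (fun e : E => e.1) S f := fun h => htouch ⟨f.1, hf, h⟩
    have hzero : pd f (expectRatio Y A) (zeroOn N t) = 0 :=
      hF.pd_ratio_eq_zero hZ hZs hFs hD hpos
        (K := univ.filter fun k => ¬ Touches (fun e : E => e.1) S k)
        (fun k hk => (mem_filter.1 hk).2) (mem_filter.2 ⟨mem_univ _, hfS⟩) _ fun g hg =>
          if_pos (mem_edgeSet.2 (nbhd_not_touches_subset hg))
    have hsafe : ∀ e ∈ N, Safe (Overlap fun e : E => e.1)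
        (fun k => Touches (fun e : E => e.1) S k ∨ k = e ∨ Overlap (fun e : E => e.1) k e)
        (n - 1) f := by
      intro e he
      rcases Nat.eq_zero_or_pos n with rfl | hn0
      · trivial
      · refine safe_of_lt_edgeDist (lt_of_lt_of_le ?_ hn)
          (mem_filter.1 (mem_edgeSet.1 he)).2.1 hf (nonempty_of_mem_boundary hf)
        exact_mod_cast Nat.sub_lt hn0 one_pos
    have hmv := norm_sub_zeroOn_le (contDiff_pd (contDiff_ratio hZs hFs hpos) f) N t ht0 ht1
      (c := 4 / Real.log 3 * b * (q ^ n / (1 - q))) fun e he u hu0 hu1 => by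
        have hs0 : 0 ≤ scaleOn N u t := scaleOn_nonneg hu0 ht0
        have hs1 : scaleOn N u t ≤ 1 := fun g => by
          simp only [scaleOn]
          split_ifs
          exacts [mul_le_one₀ hu1 (ht0 g) (ht1 g), ht1 g]
        refine (norm_pd_pd_ratio_le hF hZ hZs hFs hD hpos hb0 hZb hFb (hsafe e he) _ hs0).trans ?_
        have h1 := two_mul_clusterSum_le (nonempty_of_mem_boundary hf) hb0 hq hs0 hs1 (n - 1)
        have h2 : q ^ (n - 1 + 1) / (1 - q) ≤ q ^ n / (1 - q) :=
          div_le_div_of_nonneg_right (pow_le_pow_of_le_one hq0 hq.le (by lia)) (sub_pos.2 hq).le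
        calc _ = 3 * b * (2 * b * clusterSum (Overlap fun e : E => e.1) (n - 1) {f}
              fun g => Real.exp (2 * (b * scaleOn N u t g)) - 1) := by ring
          _ ≤ 3 * b * (q ^ n / (1 - q)) := mul_le_mul_of_nonneg_left (h1.trans h2) (by positivity)
          _ ≤ _ := by gcongr
    have hzero' : pd f (fun t => (partitionFn Y t)⁻¹ • expectFn Y A t) (zeroOn N t) = 0 := hzero
    rw [hzero', sub_zero] at hmv
    refine hmv.trans (mul_le_mul_of_nonneg_right (Nat.cast_le.2 (card_edgeSet_le _)) ?_)
    have := log_three_pos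
    positivity

/-- Cutting the couplings to the boundary edges of `B` decouples `B` from its exterior. -/
lemma expectRatio_zeroOn_boundary (hY : ∀ e, (Y e).IsHermitian) (hYe : ∀ e, Y e ∈ evenOps e.1)
    (hSB : S ⊆ B) (hA : A ∈ siteCommutant Sᶜ) :
    expectRatio Y A (zeroOn (edgeSet E (boundary E B)) 1) =
      expectRatio Y A (fun e => if e.1 ⊆ B then 1 else 0) := by
  have hD : (Fintype.card (Finset V) : ℝ) ≠ 0 := by exact_mod_cast Fintype.card_ne_zero
  refine ((factorizes_expectFn (supp := fun e : E => e.1) hY hYe hA).ratio_eq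
    (factorizes_partitionFn (supp := fun e : E => e.1) hY hYe S) hD (partitionFn_pos hY)
    (K := univ.filter fun k : E => ¬ k.1 ⊆ B ∧ ¬ (k.1 ∩ B).Nonempty) ?_ _ ?_).trans ?_
  · intro k hk h
    exact (mem_filter.1 hk).2.2 (h.mono (inter_subset_inter_left hSB))
  · exact fun f hf => if_pos (mem_edgeSet.2 (nbhd_outside_subset hf))
  · have h : zeroOn (univ.filter fun k : E => ¬ k.1 ⊆ B ∧ ¬ (k.1 ∩ B).Nonempty)
        (zeroOn (edgeSet E (boundary E B)) 1) = fun e => if e.1 ⊆ B then 1 else 0 := by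
      funext e
      simp only [zeroOn, mem_filter, mem_univ, true_and, mem_edgeSet, Pi.one_apply, boundary]
      by_cases h1 : e.1 ⊆ B
      · simp [h1, sdiff_eq_empty_iff_subset.2 h1]
      · have h2 : (e.1 \ B).Nonempty := sdiff_nonempty.2 h1
        by_cases h3 : (e.1 ∩ B).Nonempty <;> simp [h1, h2, h3]
    rw [h]
    rfl

/-- The couplings to the boundary edges of `B` are switched off continuously. -/
theorem norm_expectRatio_sub_le (hY : ∀ e, (Y e).IsHermitian) (hYe : ∀ e, Y e ∈ evenOps e.1)
    (hb0 : 0 ≤ b) (hb : ∀ e, ‖Y e‖ ≤ b) (hSB : S ⊆ B) (hA : A ∈ siteCommutant Sᶜ)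
    (hA1 : ‖A‖ ≤ 1) (hq : decayRate (growthConst E) b < 1) {n : ℕ}
    (hn : (n : ℕ∞) ≤ edgeDist E S (boundary E B)) :
    ‖expectRatio Y A 1 - expectRatio Y A (fun e => if e.1 ⊆ B then 1 else 0)‖ ≤
      (boundary E B).card * ((boundary E S).card * (4 / Real.log 3 * b *
        (decayRate (growthConst E) b ^ n / (1 - decayRate (growthConst E) b)))) := by
  have hq0 := decayRate_nonneg (growthConst_spec E).1 hb0
  rw [← expectRatio_zeroOn_boundary hY hYe hSB hA]
  have hs := contDiff_ratio (contDiff_partitionFn (Y := Y)) (contDiff_expectFn (Y := Y) A)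
    (partitionFn_pos hY)
  refine (norm_sub_zeroOn_le hs _ 1 zero_le_one le_rfl fun f hf u hu0 hu1 =>
    norm_pd_expectRatio_le hY hYe hb0 hb hSB hA hA1 hq hn (mem_edgeSet.1 hf)
      (scaleOn_nonneg hu0 zero_le_one) fun g => ?_).trans ?_
  · simp only [scaleOn]
    split_ifs <;> simp [hu1]
  · refine mul_le_mul_of_nonneg_right (Nat.cast_le.2 (card_edgeSet_le _)) ?_
    have := log_three_pos
    have := sub_pos.2 hq
    positivity

end Locality

/-! ### The trace norm as an expectation -/

section Reduction

open Matrix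

set_option linter.unusedSectionVars false

variable {V : Type*} [Fintype V] [LinearOrder V]

/-- The trace norm of an even operator is attained by an even contraction. -/
lemma exists_commute_traceNorm_eq {M : Op V} (hM : Commute (parity V) M) :
    ∃ O : Op V, ‖O‖ ≤ 1 ∧ Commute (parity V) O ∧ (traceNorm M : ℂ) = trace (O * M) := by
  obtain ⟨O, hO, htr⟩ := exists_traceNorm_eq M
  set P := parity V with hP
  have hPP : P * P = 1 := parity_mul_self
  have hPn : ‖P‖ ≤ 1 := by
    have h := CStarRing.norm_star_mul_self (x := P)
    rw [star_eq_conjTranspose, parity_conjTranspose, hPP] at h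
    have h1 : ‖(1 : Op V)‖ = 1 := CStarRing.norm_one
    nlinarith [norm_nonneg P]
  refine ⟨(1 / 2 : ℂ) • (O + P * O * P), ?_, ?_, ?_⟩
  · have h1 : ‖P * O * P‖ ≤ 1 := by
      refine (norm_mul_le _ _).trans (mul_le_one₀ ((norm_mul_le _ _).trans
        (mul_le_one₀ hPn (norm_nonneg _) hO)) (norm_nonneg _) hPn)
    rw [norm_smul]
    have h2 : ‖(1 / 2 : ℂ)‖ = 1 / 2 := by norm_num
    rw [h2]
    linarith [norm_add_le O (P * O * P)]
  · refine Commute.smul_right ?_ _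
    rw [Commute, SemiconjBy, mul_add, add_mul, ← mul_assoc P (P * O) P, ← mul_assoc P P O, hPP,
      one_mul, mul_assoc (P * O) P P, hPP, mul_one, add_comm]
  · have h1 : trace (P * O * P * M) = trace (O * M) := by
      rw [mul_assoc (P * O), hM.eq, ← mul_assoc, trace_mul_comm, ← mul_assoc, ← mul_assoc, hPP,
        one_mul]
    rw [smul_mul_assoc, add_mul, trace_smul, trace_add, h1, htr, smul_eq_mul]
    ring

lemma commute_parity_thermalState {H : Op V} (hH : Commute (parity V) H) (β : ℝ) :
    Commute (parity V) (thermalState H β) :=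
  ((hH.smul_right _).exp_right).smul_right _

lemma commute_parity_hamiltonian {h : Finset V → Op V} {F : Finset (Finset V)}
    (hF : ∀ l ∈ F, h l ∈ evenOps l) : Commute (parity V) (hamiltonian h F) :=
  Commute.sum_right _ _ _ fun l hl => commute_parity_of_mem_evenOps (hF l hl)

lemma trace_mul_thermalState {E : Finset (Finset V)} {Y : E → Op V}
    (hY : ∀ e, (Y e).IsHermitian) (A : Op V) {t : E → ℝ} {H : Op V} {β : ℝ}
    (hH : linHam Y t = -(β : ℂ) • H) : trace (A * thermalState H β) = expectRatio Y A t := by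
  rw [thermalState, ← hH, expectRatio, expectFn, mul_smul_comm, trace_smul, smul_eq_mul,
    ← Complex.coe_smul, smul_eq_mul, Complex.ofReal_inv, ofReal_partitionFn hY]
  rfl

lemma le_strength {h : Finset V → Op V} {E : Finset (Finset V)} {l : Finset V} (hl : l ∈ E) :
    ‖h l‖ ≤ strength h E :=
  NNReal.coe_le_coe.2 (Finset.le_sup (f := fun l => ‖h l‖₊) hl)

end Reduction

end FermionLattice

end

open FermionLattice
theorem mainTheorem6 {V : Type*} [Fintype V] [LinearOrder V]
    (E : Finset (Finset V)) (h : Finset V → Op V)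
    (h_even : ∀ l ∈ E, h l ∈ evenOps l)
    (h_herm : ∀ l ∈ E, (h l).IsHermitian)
    (α J : ℝ) (hα : α = growthConst E) (hJ : J = strength h E)
    (β : ℝ) (hβ : ((|β| : ℝ) : EReal) < critBeta α J)
    (S B : Finset V) (hSB : S ⊆ B)
    (hdist : ENNReal.ofReal (minDist α J β ((boundary E S).card : ℝ)) ≤
      ((edgeDist E S (boundary E B) : ℕ∞) : ℝ≥0∞)) :
    traceNorm
        (reduce S (thermalState (hamiltonian h E) β)
          - reduce S (thermalState (hamiltonian h (edgesIn E B)) β)) ≤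
      (4 * ((boundary E S).card : ℝ) * ((boundary E B).card : ℝ) / Real.log 3) * |β| * J
        / (1 - Real.exp (-1 / corrLength α J β))
        * expDecay (edgeDist E S (boundary E B)) (corrLength α J β) := by
  have hJ0 : 0 ≤ J := hJ ▸ NNReal.coe_nonneg _
  have hα0 : 0 ≤ α := hα ▸ (growthConst_spec E).1
  set b := |β| * J with hbdef
  have hb0 : 0 ≤ b := mul_nonneg (abs_nonneg β) hJ0
  have hq : decayRate α b < 1 := decayRate_lt_one hα0 hJ0 hβ
  have hq0 : 0 ≤ decayRate α b := decayRate_nonneg hα0 hb0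
  set Y : E → Op V := fun e => -(β : ℂ) • h e.1 with hYdef
  have hY : ∀ e, (Y e).IsHermitian := fun e => by
    rw [Matrix.IsHermitian, hYdef, Matrix.conjTranspose_smul, (h_herm e.1 e.2).eq, star_neg,
      Complex.star_def, Complex.conj_ofReal]
  have hYe : ∀ e, Y e ∈ evenOps e.1 := fun e => Submodule.smul_mem _ _ (h_even e.1 e.2)
  have hb : ∀ e, ‖Y e‖ ≤ b := fun e => by
    rw [hYdef, norm_smul, norm_neg, Complex.norm_real, Real.norm_eq_abs]
    exact mul_le_mul_of_nonneg_left (hJ ▸ le_strength e.2) (abs_nonneg β)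
  have hfull : linHam Y 1 = -(β : ℂ) • hamiltonian h E := by
    rw [linHam, hamiltonian, Finset.smul_sum, ← Finset.sum_coe_sort E]
    simp [hYdef]
  have htrunc : linHam Y (fun e => if e.1 ⊆ B then 1 else 0) =
      -(β : ℂ) • hamiltonian h (edgesIn E B) := by
    rw [linHam, hamiltonian, edgesIn, Finset.sum_filter, Finset.smul_sum, ← Finset.sum_coe_sort E]
    refine Finset.sum_congr rfl fun e _ => ?_
    split_ifs <;> simp [hYdef]
  have hP1 := commute_parity_reduce (S := S)
    (commute_parity_thermalState (commute_parity_hamiltonian h_even) β)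
  have hP2 := commute_parity_reduce (S := S) (commute_parity_thermalState
    (commute_parity_hamiltonian fun l (hl : l ∈ edgesIn E B) =>
      h_even l (Finset.mem_filter.1 hl).1) β)
  obtain ⟨O, hO, hOP, htr⟩ := exists_commute_traceNorm_eq (hP1.sub_right hP2)
  have hA := extend_mem_siteCommutant hOP
  have hA1 : ‖extend S O‖ ≤ 1 := (norm_extend_le O).trans hO
  have hnorm : traceNorm (reduce S (thermalState (hamiltonian h E) β)
      - reduce S (thermalState (hamiltonian h (edgesIn E B)) β)) =
      ‖expectRatio Y (extend S O) 1 -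
        expectRatio Y (extend S O) (fun e => if e.1 ⊆ B then 1 else 0)‖ := by
    rw [mul_sub, Matrix.trace_sub, trace_mul_reduce, trace_mul_reduce,
      trace_mul_thermalState hY _ hfull, trace_mul_thermalState hY _ htrunc] at htr
    rw [← htr, Complex.norm_real]
    exact (Real.norm_of_nonneg (Finset.sum_nonneg fun i _ => Real.sqrt_nonneg _)).symm
  have hbound := fun (n : ℕ) (hn : (n : ℕ∞) ≤ edgeDist E S (boundary E B)) =>
    norm_expectRatio_sub_le hY hYe hb0 hb hSB hA hA1 (hα ▸ hq) hn
  rw [← hnorm, ← hα] at hbound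
  rcases hq0.eq_or_lt with h0 | h0
  · -- A zero decay rate means `β J = 0` or `α = 0`; in the latter case all edges are empty, so that
    -- there are no boundary edges.
    have hzero : b = 0 ∨ ((boundary E B).card : ℝ) = 0 := by
      rcases mul_eq_zero.1 h0.symm with h1 | h1
      · right
        rw [Nat.cast_eq_zero, Finset.card_eq_zero, Finset.eq_empty_iff_forall_notMem]
        intro l hl
        have h2 := one_le_growthConst (Finset.mem_filter.1 hl).1 (nonempty_of_mem_boundary hl)
        have h3 : α = 0 := (mul_eq_zero.1 h1).resolve_right (Real.exp_pos _).ne'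
        linarith
      · left
        linarith [(Real.exp_eq_one_iff _).1 (sub_eq_zero.1 h1)]
    refine (hbound 0 bot_le).trans (le_of_eq ?_)
    rw [mul_assoc _ |β| J, ← hbdef]
    rcases hzero with h1 | h1 <;> simp [h1]
  · have hexp : Real.exp (-1 / corrLength α J β) = decayRate α b := by
      rw [neg_div_corrLength hα0 hJ0 hq, one_mul, Real.exp_log h0]
    rw [hexp]
    refine le_mul_expDecay hα0 hJ0 h0 hq fun n hn => (hbound n hn).trans (le_of_eq ?_)
    rw [hbdef]
    ring
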